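/- Let $k,p\ge 1$ and $q\ge 0$ be integers and $\Theta$ a compact metric space (for instance a compact subset of $\mathbb R^m$). Let $h$ be an injective map from a set of symmetric positive semidefinite $k\times k$ matrices (the volatility matrices) into a separable metric space $F$, with complete image $H$, and let $\ell$ be its inverse, defined on $H$. Let $f(u;x;\theta)\in H$ be defined for $u\in(\mathbb R^k)^q$, $x\in H^p$, $\theta\in\Theta$, and measurable in $u$. For a process $(X_t)_{t\in\mathbb Z}$ in $\mathbb R^k$ let $\phi_t(\cdot,\theta):H^p\to H^p$ be the map $(x_1,\dots,x_p)\mapsto (f(X_{t-1},\dots,X_{t-q};x_1,\dots,x_p;\theta),x_1,\dots,x_{p-1})$, let $\phi_t^{(r)}(\cdot,\theta)=\phi_t(\cdot,\theta)\circ\cdots\circ\phi_{t-r+1}(\cdot,\theta)$, and let $d$ be a metric on $H^p$ equivalent, up to multiplicative constants, to the maximum product metric. For $\theta\in\Theta$, a stationary solution at $\theta$ is a stationary process $(g_t(\theta))_{t\in\mathbb Z}$ in $H$ such that, almost surely, $g_t(\theta)=f(X_{t-1},\dots,X_{t-q};g_{t-1}(\theta),\dots,g_{t-p}(\theta);\theta)$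 for all $t$. Let $\theta_0\in\Theta$ and assume: (ST) $X_t=\Sigma_t^{1/2}Z_t$ with volatility matrices $\Sigma_t$ such that, almost surely, $h(\Sigma_t)=f(X_{t-1},\dots,X_{t-q};h(\Sigma_{t-1}),\dots,h(\Sigma_{t-p});\theta_0)$ for all $t\in\mathbb Z$; the process $(X_t,h(\Sigma_t))$ is stationary; $(X_t)$ is ergodic and non anticipative (up to null sets $X_t$ is a measurable function of $Z_t,Z_{t-1},\dots$), and $\mathbb E[\log^+\|X_0\|]<\infty$. (CI) Almost surely, $\theta\mapsto\phi_t(x,\theta)$ is continuous for all $t$ and $x$. There is a stationary process $(\Lambda_{\phi_t})$ of nonnegative continuous functions on $\Theta$ such that, almost surely, $d(\phi_t(x,\theta),\phi_t(y,\theta))\le\Lambda_{\phi_t}(\theta)d(x,y)$ for all $t,\theta,x,y$. For some integer $r\ge1$ there is likewise a stationary process $(\Lambda^{(r)}_{\phi_t})$ of nonnegative continuous functions on $\Theta$ bounding in the same way the Lipschitz coefficients of $\phi_t^{(r)}(\cdot,\theta)$, with $\mathbb E[\log\Lambda_{\phi_0}^{(r)}(\theta)]\in[-\infty,0)$ for every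 $\theta\in\Theta$ and $\mathbb E[\sup_\Theta\log^+\Lambda_{\phi_0}^{(r)}(\theta)]<\infty$. There is $y\in H^p$ with $\mathbb E[\sup_\Theta\log^+d(\phi_0(y,\theta),y)]<\infty$. (IN) The $Z_t$, $t\in\mathbb Z$, are iid random vectors in $\mathbb R^k$ and $\mathbb E[Z_0Z_0^T]$ is the identity matrix. (IV) $\det\ell>0$ on $H$, the functions $y\mapsto\ell(y)^{-1}$ (matrix inverse) and $y\mapsto\log\det\ell(y)$ are Lipschitz on $H$, and there is a continuous $C:\Theta\to(0,\infty)$ such that, for every $\theta\in\Theta$, the stationary solution satisfies $\det\ell(g_0(\theta))\ge C(\theta)$ almost surely. (Identifiability) For $\theta\in\Theta$, the stationary solution satisfies $g_0(\theta)=h(\Sigma_0)$ almost surely if and only if $\theta=\theta_0$. Let $\hat g_t(\theta)$, $t\ge1$, be defined by $(\hat g_t(\theta),\dots,\hat g_{t-p+1}(\theta))=\phi_t((\hat g_{t-1}(\theta),\dots,\hat g_{t-p}(\theta)),\theta)$ with arbitrary initial values $(\hat g_0(\theta),\dots,\hat g_{1-p}(\theta))$ depending continuously on $\theta$ (they may be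 random), and let $$\hat S_n(\theta)=\frac1n\sum_{t=1}^n\frac12\Big(X_t^T\ell(\hat g_t(\theta))^{-1}X_t+\log\det\ell(\hat g_t(\theta))\Big).$$ If, almost surely, $\hat\theta_n$ minimizes $\hat S_n$ over $\Theta$ for every $n\ge1$, then $\hat\theta_n\to\theta_0$ almost surely. -/

import Mathlib

open MeasureTheory ProbabilityTheory Filter Topology

namespace VolatilitySRE

noncomputable section

/-! ### Processes indexed by `ℤ` -/

/-- The left shift on two-sided sequences. -/
def shift {S : Type*} (y : ℤ → S) : ℤ → S := fun t => y (t + 1)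

/-- The law of a process on the space of its paths (product sigma-algebra). -/
def pathLaw {Ω S : Type*} [MeasurableSpace Ω] [MeasurableSpace S] (P : Measure Ω)
    (Y : ℤ → Ω → S) : Measure (ℤ → S) :=
  P.map (fun ω t => Y t ω)

/-- Strict stationarity: the path law is invariant under the shift. -/
structure IsStationary {Ω S : Type*} [MeasurableSpace Ω] [MeasurableSpace S] (P : Measure Ω)
    (Y : ℤ → Ω → S) : Prop where
  measurable : ∀ t, Measurable (Y t)
  invariant : MeasurePreserving shift (pathLaw P Y) (pathLaw P Y)

/-- Stationarity and ergodicity: the shift is an ergodic transformation of the path law. -/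
structure IsStationaryErgodic {Ω S : Type*} [MeasurableSpace Ω] [MeasurableSpace S]
    (P : Measure Ω) (Y : ℤ → Ω → S) : Prop where
  measurable : ∀ t, Measurable (Y t)
  ergodic : Ergodic shift (pathLaw P Y)

/-- The sigma-algebra generated by `Z_t, Z_{t-1}, …`. -/
abbrev pastSigma {Ω S : Type*} [MeasurableSpace S] (Z : ℤ → Ω → S) (t : ℤ) : MeasurableSpace Ω :=
  ⨆ s ≤ t, MeasurableSpace.comap (Z s) inferInstance

/-- The vector of lags `(Y_{t-1}, …, Y_{t-n})`. -/
def lags {Ω S : Type*} (Y : ℤ → Ω → S) (n : ℕ) (t : ℤ) (ω : Ω) : Fin n → S :=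
  fun i => Y (t - 1 - (i : ℤ)) ω

/-- Expectation of an extended real random variable: `E[f⁺] - E[f⁻]`, with values in
`[-∞, ∞]` (it is only used when `E[f⁺]` is finite). -/
def extExpectation {Ω : Type*} [MeasurableSpace Ω] (P : Measure Ω) (f : Ω → EReal) : EReal :=
  ((∫⁻ ω, (f ω).toENNReal ∂P : ENNReal) : EReal)
    - ((∫⁻ ω, (-f ω).toENNReal ∂P : ENNReal) : EReal)

/-- The logarithm of a nonnegative real number, with `log 0 = -∞`. -/
def extLog (x : ℝ) : EReal := ENNReal.log (ENNReal.ofReal x)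

/-! ### The model -/

open scoped MatrixOrder in
/-- The positive semidefinite square root `A^{1/2}`. -/
def matSqrt {k : ℕ} (A : Matrix (Fin k) (Fin k) ℝ) : Matrix (Fin k) (Fin k) ℝ := CFC.sqrt A

/-- The deterministic ingredients of a parametric volatility model of dimension `k`, with `p` lags
of the transformed volatility and `q` lags of the observations: the set `vol` of volatility
matrices, the injective transformation `h` of `vol` into `F`, with complete image, and the map
`f` with `h(Σ_t) = f(X_{t-1},…,X_{t-q}; h(Σ_{t-1}),…,h(Σ_{t-p}); θ)`. -/
structure Model (k p q : ℕ) (F Θ : Type*) [MetricSpace F] [MeasurableSpace F] where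
  vol : Set (Matrix (Fin k) (Fin k) ℝ)
  posSemidef : ∀ A ∈ vol, A.PosSemidef
  h : vol → F
  injective : Function.Injective h
  complete : IsComplete (Set.range h)
  f : (Fin q → (Fin k → ℝ)) → (Fin p → Set.range h) → Θ → Set.range h
  measurable_f : ∀ x θ, Measurable (fun u => f u x θ)

namespace Model

variable {k p q : ℕ} {F Θ : Type*} [MetricSpace F] [MeasurableSpace F]

/-- The image of `h`. -/
abbrev State (M : Model k p q F Θ) : Type _ := Set.range M.h

/-- The transformation `h`, as a map onto its image. -/
def toState (M : Model k p q F Θ) (A : M.vol) : M.State := ⟨M.h A, A, rfl⟩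

/-- The link function `ℓ`, the inverse of `h` on its image. -/
def link (M : Model k p q F Θ) (y : M.State) : Matrix (Fin k) (Fin k) ℝ :=
  ((Equiv.ofInjective M.h M.injective).symm y : M.vol)

/-- The link function inverts `h`. -/
theorem link_toState (M : Model k p q F Θ) (A : M.vol) : M.link (M.toState A) = A := by
  have : (Equiv.ofInjective M.h M.injective).symm (M.toState A) = A :=
    Equiv.ofInjective_symm_apply M.injective A
  simp [link, this]

/-- The map of the stochastic recurrence equation on the space of `p`-tuples: it puts the new
value in front of the tuple of lags and drops the oldest lag. -/
def step (M : Model k p q F Θ) (u : Fin q → (Fin k → ℝ)) (θ : Θ) (x : Fin p → M.State) :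
    Fin p → M.State :=
  fun i => if (i : ℕ) = 0 then M.f u x θ else x ⟨(i : ℕ) - 1, by omega⟩

/-- The random map `φ_t(·, θ)`, driven by the observations `X_{t-1}, …, X_{t-q}`. -/
def phi (M : Model k p q F Θ) {Ω : Type*} (X : ℤ → Ω → (Fin k → ℝ)) (t : ℤ) (ω : Ω) (θ : Θ) :
    (Fin p → M.State) → (Fin p → M.State) :=
  M.step (lags X q t ω) θ

/-- The `r`-fold composition `φ_t ∘ φ_{t-1} ∘ ⋯ ∘ φ_{t-r+1}` at `θ`. -/
def phiIter (M : Model k p q F Θ) {Ω : Type*} (X : ℤ → Ω → (Fin k → ℝ)) :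
    ℕ → ℤ → Ω → Θ → (Fin p → M.State) → (Fin p → M.State)
  | 0, _, _, _, x => x
  | r + 1, t, ω, θ, x => M.phi X t ω θ (phiIter M X r (t - 1) ω θ x)

/-- `Y` solves the stochastic recurrence equation driven by the observations, at `θ`. -/
def IsSolution (M : Model k p q F Θ) {Ω : Type*} [MeasurableSpace Ω] (P : Measure Ω)
    (X : ℤ → Ω → (Fin k → ℝ)) (θ : Θ) (Y : ℤ → Ω → M.State) : Prop :=
  ∀ᵐ ω ∂P, ∀ t : ℤ, Y t ω = M.f (lags X q t ω) (lags Y p t ω) θ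

/-- `Y` is the stationary solution `(g_t(θ))` of the recurrence equation at `θ`. -/
structure IsStationarySolution (M : Model k p q F Θ) {Ω : Type*} [MeasurableSpace Ω]
    (P : Measure Ω) (X : ℤ → Ω → (Fin k → ℝ)) (θ : Θ) (Y : ℤ → Ω → M.State) : Prop where
  stationary : IsStationary P Y
  solution : M.IsSolution P X θ Y

/-- A metric on the space `E` of `p`-tuples that is equivalent, up to multiplicative
constants, to the maximum product metric; for instance the mean of the coordinate distances, or
the root of the sum of their squares. -/
structure LagMetric (M : Model k p q F Θ) where
  d : (Fin p → M.State) → (Fin p → M.State) → ℝ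
  comm : ∀ x y, d x y = d y x
  triangle : ∀ x y z, d x z ≤ d x y + d y z
  lower : ∃ c : ℝ, 0 < c ∧ ∀ x y, c * dist x y ≤ d x y
  upper : ∃ c : ℝ, ∀ x y, d x y ≤ c * dist x y

/-- The family of random maps `Ψ_t(·, θ)` satisfies `(CL)` with the stationary process `L` of
continuous Lipschitz coefficients. -/
structure HasLipschitzCoeff (M : Model k p q F Θ) [TopologicalSpace Θ] {Ω : Type*}
    [MeasurableSpace Ω] (P : Measure Ω) (E : M.LagMetric)
    (Ψ : ℤ → Ω → Θ → (Fin p → M.State) → (Fin p → M.State)) (L : ℤ → Ω → Θ → ℝ) : Prop where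
  continuous : ∀ t ω, Continuous (L t ω)
  nonneg : ∀ t ω θ, 0 ≤ L t ω θ
  stationary : IsStationary P L
  lipschitz : ∀ᵐ ω ∂P, ∀ t θ x y, E.d (Ψ t ω θ x) (Ψ t ω θ y) ≤ L t ω θ * E.d x y

/-- Condition `(ST)`: `X_t = Σ_t^{1/2} Z_t`, where `(h(Σ_t))` solves the recurrence equation at
the true parameter `θ₀`; the solution is stationary, `(X_t)` is ergodic, non anticipative (up to
null sets `X_t` is a function of `Z_t, Z_{t-1}, …`), with finite logarithmic moment. -/
structure ST (M : Model k p q F Θ) {Ω : Type*} [MeasurableSpace Ω] (P : Measure Ω) (θ₀ : Θ)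
    (Z X : ℤ → Ω → (Fin k → ℝ)) (V : ℤ → Ω → M.vol) : Prop where
  observation : ∀ᵐ ω ∂P, ∀ t, X t ω = (matSqrt (V t ω : Matrix (Fin k) (Fin k) ℝ)).mulVec (Z t ω)
  recurrence : M.IsSolution P X θ₀ (fun t ω => M.toState (V t ω))
  stationary : IsStationary P (fun t ω => (X t ω, M.toState (V t ω)))
  ergodic : IsStationaryErgodic P X
  nonAnticipative : ∀ t, ∃ X' : Ω → (Fin k → ℝ), Measurable[pastSigma Z t] X' ∧ X t =ᵐ[P] X'
  logMoment : ∫⁻ ω, ENNReal.ofReal (Real.posLog ‖X 0 ω‖) ∂P < ⊤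

/-- Condition `(CI)`. -/
structure CI (M : Model k p q F Θ) [TopologicalSpace Θ] {Ω : Type*} [MeasurableSpace Ω]
    (P : Measure Ω) (X : ℤ → Ω → (Fin k → ℝ)) (E : M.LagMetric) : Prop where
  continuous : ∀ᵐ ω ∂P, ∀ t x, Continuous (fun θ => M.phi X t ω θ x)
  coeff : ∃ L : ℤ → Ω → Θ → ℝ, M.HasLipschitzCoeff P E (M.phi X) L
  lyapunov : ∃ r : ℕ, 1 ≤ r ∧ ∃ L : ℤ → Ω → Θ → ℝ,
    M.HasLipschitzCoeff P E (M.phiIter X r) L ∧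
    (∀ θ, extExpectation P (fun ω => extLog (L 0 ω θ)) < 0) ∧
    ∫⁻ ω, ⨆ θ, ENNReal.ofReal (Real.posLog (L 0 ω θ)) ∂P < ⊤
  logMoment : ∃ y : Fin p → M.State,
    ∫⁻ ω, ⨆ θ, ENNReal.ofReal (Real.posLog (E.d (M.phi X 0 ω θ y) y)) ∂P < ⊤

/-- Condition `(IV)`: `ℓ⁻¹` (matrix inverse) and `log det ℓ` are Lipschitz on the image of `h`,
where `det ℓ > 0`, and `det ℓ(g_0(θ)) ≥ C(θ)` for some positive continuous `C`. The Lipschitz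
property of the matrix valued map is stated entrywise. -/
structure IV (M : Model k p q F Θ) [TopologicalSpace Θ] {Ω : Type*} [MeasurableSpace Ω]
    (P : Measure Ω) (X : ℤ → Ω → (Fin k → ℝ)) : Prop where
  det_pos : ∀ y, 0 < (M.link y).det
  inv_lipschitz : ∃ K : NNReal, ∀ i j, LipschitzWith K (fun y => (M.link y)⁻¹ i j)
  logDet_lipschitz : ∃ K : NNReal, LipschitzWith K (fun y => Real.log (M.link y).det)
  lowerBound : ∃ C : Θ → ℝ, Continuous C ∧ (∀ θ, 0 < C θ) ∧
    ∀ θ Y, M.IsStationarySolution P X θ Y → ∀ᵐ ω ∂P, C θ ≤ (M.link (Y 0 ω)).det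

/-- Identifiability: `g_0(θ) = h(Σ_0)` almost surely if and only if `θ = θ₀`. -/
def Identifiable (M : Model k p q F Θ) {Ω : Type*} [MeasurableSpace Ω] (P : Measure Ω) (θ₀ : Θ)
    (X : ℤ → Ω → (Fin k → ℝ)) (V : ℤ → Ω → M.vol) : Prop :=
  ∀ θ Y, M.IsStationarySolution P X θ Y →
    ((∀ᵐ ω ∂P, Y 0 ω = M.toState (V 0 ω)) ↔ θ = θ₀)

/-- The vector `(ĝ_t(θ), …, ĝ_{t-p+1}(θ))` obtained from the initial values `ζ(θ)` at time `0`
by the recurrence driven by the observations. -/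
def fitted (M : Model k p q F Θ) {Ω : Type*} (X : ℤ → Ω → (Fin k → ℝ))
    (ζ : Ω → Θ → (Fin p → M.State)) (ω : Ω) (θ : Θ) : ℕ → (Fin p → M.State)
  | 0 => ζ ω θ
  | t + 1 => M.phi X ((t : ℤ) + 1) ω θ (fitted M X ζ ω θ t)

/-- The volatility forecast in the transformed scale, `ĝ_t(θ)`. -/
def gHat (M : Model k p q F Θ) [NeZero p] {Ω : Type*} (X : ℤ → Ω → (Fin k → ℝ))
    (ζ : Ω → Θ → (Fin p → M.State)) (ω : Ω) (θ : Θ) (t : ℕ) : M.State :=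
  M.fitted X ζ ω θ t 0

/-- The QLIK loss `½ (xᵀ ℓ(y)⁻¹ x + log det ℓ(y))`. -/
def loss (M : Model k p q F Θ) (x : Fin k → ℝ) (y : M.State) : ℝ :=
  2⁻¹ * (dotProduct x ((M.link y)⁻¹.mulVec x) + Real.log (M.link y).det)

/-- The QLIK criterion `Ŝ_n(θ) = n⁻¹ ∑_{t=1}^n ŝ_t(θ)`. -/
def qlik (M : Model k p q F Θ) [NeZero p] {Ω : Type*} (X : ℤ → Ω → (Fin k → ℝ))
    (ζ : Ω → Θ → (Fin p → M.State)) (n : ℕ) (ω : Ω) (θ : Θ) : ℝ :=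
  (n : ℝ)⁻¹ * ∑ t ∈ Finset.Icc 1 n, M.loss (X (t : ℤ) ω) (M.gHat X ζ ω θ t)

end Model

/-- Condition `(IN)`: the innovations are iid and the matrix `E[Z_0 Z_0ᵀ]` is the identity. -/
structure IN {k : ℕ} {Ω : Type*} [MeasurableSpace Ω] (P : Measure Ω)
    (Z : ℤ → Ω → (Fin k → ℝ)) : Prop where
  measurable : ∀ t, Measurable (Z t)
  indep : iIndepFun Z P
  ident : ∀ t, IdentDistrib (Z t) (Z 0) P P
  integrable : ∀ i j, Integrable (fun ω => Z 0 ω i * Z 0 ω j) P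
  secondMoment : ∀ i j, ∫ ω, Z 0 ω i * Z 0 ω j ∂P = (1 : Matrix (Fin k) (Fin k) ℝ) i j

end

end VolatilitySRE

/-! This is Wald's argument for a minimum contrast estimator. The limit criterion, the mean of `loss
(X_0) (g_0(θ))` with `+∞` allowed, has its unique minimum at `θ₀`. Lower bounds that are uniform
near each `θ ≠ θ₀`, compactness of `Θ` and the ergodic theorem keep the empirical criterion away
from `θ₀` strictly above its value at `θ₀` (`ae_tendsto_of_separation`). The forecasts may replace
the stationary solution because the recurrence forgets its initial values exponentially fast,
uniformly in `θ`.

Uniform forgetting (`CI.ae_contracts`). The Lyapunov condition is pointwise in `θ`; dominated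
convergence extends it to suprema over a small ball (`exists_ball_integral_neg`), and compactness
extends the contraction to `Θ`. The coefficients in `CI` are only stationary, so they are replaced
by suprema of Lipschitz quotients over countable dense sets: these are functions of the past of `X`,
and ergodicity of `X` applies to them. The `r`-th power of the shift need not be ergodic;
`exists_exponential_decay` avoids it by averaging over `r` interlaced chains of blocks. Backward
iterates then converge uniformly to a continuous `g_t(θ)`, and the forecast error `exp (C - δ n)`
beats the subexponential growth of `‖X_n‖ ^ 2`.

Separation (`lt_lintegral_loss`). Put `S = ℓ(g_0(θ₀))^{1/2}` and `A = S ℓ(g_0(θ))⁻¹ S`. Since `Z_0`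
is independent of the past and has identity second moment, the excess of the mean loss at `θ`, when
finite, is half the mean of `tr A - k - log det A`. This is nonnegative, and zero only if `A = 1`,
that is `g_0(θ) = g_0(θ₀)`. Integrability of `log det` at `θ₀` must come from the logarithmic moment
of `X_0 = S Z_0` alone: the vectors `z` for which `S z` has a logarithmic moment form a subspace
that carries the law of `Z_0`, hence the whole space (`lintegral_posLog_det_lt_top`).

The only ergodic theorem needed is one-sided: partial sums stay below any slope larger than the mean
(`ae_bddAbove_birkhoffSum`). -/

namespace VolatilitySRE

noncomputable section

/-! ### A one-sided ergodic theorem -/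

/-- The running maximum of the partial sums along an orbit, started from `0`. -/
def runningMax {α : Type*} (T : α → α) (f : α → ℝ) : ℕ → α → ℝ
  | 0, _ => 0
  | n + 1, x => max 0 (f x + runningMax T f n (T x))

section Birkhoff

variable {α : Type*} {T : α → α} {f : α → ℝ}

theorem runningMax_nonneg (n : ℕ) (x : α) : 0 ≤ runningMax T f n x := by
  cases n <;> simp [runningMax]

theorem runningMax_le_succ (n : ℕ) (x : α) : runningMax T f n x ≤ runningMax T f (n + 1) x := by
  induction n generalizing x with
  | zero => simp [runningMax]
  | succ n ih =>
    rw [runningMax, runningMax]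
    exact max_le_max le_rfl (by linarith [ih (T x)])

theorem runningMax_mono (x : α) : Monotone fun n => runningMax T f n x :=
  monotone_nat_of_le_succ fun n => runningMax_le_succ n x

theorem birkhoffSum_le_runningMax (n : ℕ) (x : α) : birkhoffSum T f n x ≤ runningMax T f n x := by
  induction n generalizing x with
  | zero => simp [runningMax]
  | succ n ih =>
    rw [birkhoffSum_succ', runningMax]
    exact le_max_of_le_right (by linarith [ih (T x)])

variable [MeasurableSpace α] {μ : Measure α}

theorem measurable_runningMax (hT : Measurable T) (hf : Measurable f) (n : ℕ) :
    Measurable (runningMax T f n) := by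
  induction n with
  | zero => exact measurable_const
  | succ n ih => exact measurable_const.max (hf.add (ih.comp hT))

theorem integrable_runningMax (hT : MeasurePreserving T μ μ) (hf : Integrable f μ) (n : ℕ) :
    Integrable (runningMax T f n) μ := by
  induction n with
  | zero => exact integrable_zero _ _ _
  | succ n ih =>
    have h : Integrable (fun x => f x + runningMax T f n (T x)) μ :=
      hf.add (hT.integrable_comp_of_integrable ih)
    exact (integrable_zero _ _ _).sup h

/-- If `∫ f < 0` and `T` is ergodic, then the partial sums of `f` along almost every orbit are
bounded above. -/
theorem ae_bddAbove_birkhoffSum [IsProbabilityMeasure μ] (hT : Ergodic T μ)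
    (hfm : Measurable f) (hf : Integrable f μ) (hneg : ∫ x, f x ∂μ < 0) :
    ∀ᵐ x ∂μ, ∃ C, ∀ n, birkhoffSum T f n x ≤ C := by
  let A : Set α := {x | ∃ C : ℕ, ∀ n, runningMax T f n x ≤ C}
  have hA : MeasurableSet A := by
    have : A = ⋃ C : ℕ, ⋂ n, {x | runningMax T f n x ≤ C} := by ext; simp [A]
    rw [this]
    exact .iUnion fun C => .iInter fun n =>
      measurableSet_le (measurable_runningMax hT.measurable hfm n) measurable_const
  have hinv : T ⁻¹' A = A := by
    ext x
    constructor
    · rintro ⟨C, hC⟩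
      obtain ⟨C', hC'⟩ := exists_nat_ge (|f x| + C)
      refine ⟨C', fun n => (runningMax_le_succ n x).trans ?_⟩
      rw [runningMax]
      have h1 := hC n
      exact max_le C'.cast_nonneg (by linarith [le_abs_self (f x)])
    · rintro ⟨C, hC⟩
      obtain ⟨C', hC'⟩ := exists_nat_ge (|f x| + C)
      refine ⟨C', fun n => ?_⟩
      have h1 := hC (n + 1)
      rw [runningMax, max_le_iff] at h1
      linarith [neg_abs_le (f x), h1.2]
  rcases hT.toPreErgodic.ae_mem_or_ae_notMem hA hinv with h | h
  · filter_upwards [h] with x hx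
    obtain ⟨C, hC⟩ := hx
    exact ⟨C, fun n => (birkhoffSum_le_runningMax n x).trans (hC n)⟩
  -- If the running maximum `M_n` is unbounded almost everywhere, then `M_{n+1}(x) - M_n(T x) = max
  -- (-M_n(T x)) (f x)` is eventually `f x`, and it is dominated by `|f|`. Its integral is
  -- nonnegative by invariance and monotonicity, so `∫ f ≥ 0` in the limit.
  · exfalso
    have hmp := hT.toMeasurePreserving
    have hlim : Tendsto (fun n => ∫ x, max (-runningMax T f n (T x)) (f x) ∂μ) atTop
        (𝓝 (∫ x, f x ∂μ)) := by
      refine tendsto_integral_of_dominated_convergence (fun x => |f x|) ?_ hf.abs ?_ ?_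
      · intro n
        exact (((measurable_runningMax hT.measurable hfm n).comp hT.measurable).neg.max
          hfm).aestronglyMeasurable
      · intro n
        refine .of_forall fun x => ?_
        have h0 : 0 ≤ runningMax T f n (T x) := runningMax_nonneg n _
        rw [Real.norm_eq_abs]
        rcases max_cases (-runningMax T f n (T x)) (f x) with ⟨h1, h2⟩ | ⟨h1, h2⟩
        · rw [h1, abs_neg, abs_of_nonneg h0, abs_of_nonpos (by linarith)]; linarith
        · rw [h1]
      · filter_upwards [h] with x hx
        have hx' : T x ∉ A := fun hm => hx (by rw [← hinv]; exact hm)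
        obtain ⟨C, hC⟩ := exists_nat_ge |f x|
        have : ∃ n, (C : ℝ) < runningMax T f n (T x) := by
          by_contra! hc
          exact hx' ⟨C, hc⟩
        obtain ⟨N, hN⟩ := this
        refine tendsto_const_nhds.congr' ?_
        filter_upwards [eventually_ge_atTop N] with n hn
        have h1 := runningMax_mono (T := T) (f := f) (T x) hn
        simp only at h1
        exact (max_eq_right (by linarith [neg_abs_le (f x)])).symm
    refine absurd (ge_of_tendsto' hlim fun n => ?_) (not_le.2 hneg)
    have e : (fun x => max (-runningMax T f n (T x)) (f x))
        = fun x => runningMax T f (n + 1) x - runningMax T f n (T x) := by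
      funext x
      rw [runningMax, ← max_sub_sub_right, zero_sub, add_sub_cancel_right]
    have hi := integrable_runningMax hmp hf
    have hi' : Integrable (fun x => runningMax T f n (T x)) μ :=
      hmp.integrable_comp_of_integrable (hi n)
    rw [e, integral_sub (hi _) hi',
      ← integral_map hmp.measurable.aemeasurable
        (by rw [hmp.map_eq]; exact (hi n).aestronglyMeasurable), hmp.map_eq]
    exact sub_nonneg.2 (integral_mono (hi _) (hi _) fun x => runningMax_le_succ n x)

end Birkhoff

/-! ### Exponential decay of submultiplicative arrays -/

section Array

variable {R : ℕ → ℕ → ℝ → Prop} {r : ℕ} {b c : ℕ → ℝ}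

/-- Jumping back by steps of length `r` until the first favourable time. -/
theorem exists_favourable_time (hr : 1 ≤ r) {κ : ℝ}
    (trans : ∀ s t u x y, s ≤ t → t ≤ u → R s t x → R t u y → R s u (x + y))
    (mono : ∀ s t x y, x ≤ y → R s t x → R s t y) (refl : ∀ s, R s s 0)
    (hb : ∀ s, R s (s + r) (b s)) (hc0 : ∀ s, 0 ≤ c s)
    (hc : ∀ s, (∀ j < r, R (s + r - j) (s + r) κ) ∨ |b s| + 1 ≤ c s) (n : ℕ) :
    ∃ τ ≤ n, (τ < r ∨ ∀ j < r, R (τ - j) τ κ) ∧ R τ n (∑ s ∈ Finset.range n, c s) ∧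
      (n : ℝ) - τ ≤ r * ∑ s ∈ Finset.range n, c s := by
  induction n using Nat.strong_induction_on with
  | _ n ih =>
    have hpos : 0 ≤ ∑ s ∈ Finset.range n, c s := Finset.sum_nonneg fun s _ => hc0 s
    have hself : R n n (∑ s ∈ Finset.range n, c s) := mono _ _ _ _ hpos (refl n)
    rcases lt_or_ge n r with h | h
    · exact ⟨n, le_rfl, .inl h, hself, by rw [sub_self]; positivity⟩
    obtain ⟨m, rfl⟩ := Nat.exists_eq_add_of_le' h
    rcases hc m with h1 | h1
    · exact ⟨m + r, le_rfl, .inr h1, hself, by rw [sub_self]; positivity⟩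
    -- The jump over `r` is paid by `c m` twice over: `|b m| ≤ c m` covers its Lipschitz cost, and
    -- `1 ≤ c m` counts it, which bounds `n - τ`.
    obtain ⟨τ, hτ, h2, h3, h4⟩ := ih m (by omega)
    have hsum : ∑ s ∈ Finset.range m, c s + c m ≤ ∑ s ∈ Finset.range (m + r), c s := by
      rw [← Finset.sum_range_succ]
      exact Finset.sum_le_sum_of_subset_of_nonneg
        (Finset.range_subset_range.2 (by omega)) fun s _ _ => hc0 s
    refine ⟨τ, by omega, h2, mono _ _ _ _ ?_ (trans τ m (m + r) _ _ hτ (by omega) h3 (hb m)), ?_⟩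
    · linarith [le_abs_self (b m)]
    · have hr' : (0 : ℝ) ≤ r := r.cast_nonneg
      have : (r : ℝ) * (∑ s ∈ Finset.range m, c s + c m) ≤ r * ∑ s ∈ Finset.range (m + r), c s :=
        mul_le_mul_of_nonneg_left hsum hr'
      have h5 : (r : ℝ) * 1 ≤ r * c m :=
        mul_le_mul_of_nonneg_left (by linarith [abs_nonneg (b m)]) hr'
      push_cast
      linarith

/-- The sum of the costs along the steps of length `r` that end at `n`. -/
def chainSum (r : ℕ) (b : ℕ → ℝ) (n : ℕ) : ℝ :=
  if _h : 1 ≤ r ∧ r ≤ n then b (n - r) + chainSum r b (n - r) else 0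
termination_by n
decreasing_by omega

theorem chainSum_of_lt {n : ℕ} (h : n < r) : chainSum r b n = 0 := by
  rw [chainSum, dif_neg (by omega)]

theorem chainSum_add (hr : 1 ≤ r) (n : ℕ) : chainSum r b (n + r) = b n + chainSum r b n := by
  rw [chainSum, dif_pos (by omega), Nat.add_sub_cancel]

/-- The chains that end at `n, …, n + r - 1` lie in distinct residue classes modulo `r`, and each `s
< n` starts exactly one of their blocks. Partial sums of `b` thus control the average chain, with no
appeal to the `r`-th power of the shift. -/
theorem sum_chainSum (hr : 1 ≤ r) (n : ℕ) :
    ∑ j ∈ Finset.range r, chainSum r b (n + j) = ∑ s ∈ Finset.range n, b s := by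
  induction n with
  | zero =>
    simp only [zero_add, Finset.range_zero, Finset.sum_empty]
    exact Finset.sum_eq_zero fun j hj => chainSum_of_lt (Finset.mem_range.1 hj)
  | succ n ih =>
    obtain ⟨q, rfl⟩ := Nat.exists_eq_add_of_le' hr
    rw [Finset.sum_range_succ (fun s => b s) n, ← ih, Finset.sum_range_succ,
      Finset.sum_range_succ' _ q]
    have : n + 1 + q = n + (q + 1) := by ring
    rw [this, chainSum_add hr]
    have e : ∀ j, n + 1 + j = n + (j + 1) := fun j => by ring
    simp only [e, add_zero]
    ring

theorem chain_bound (hr : 1 ≤ r) {C₀ : ℝ}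
    (trans : ∀ s t u x y, s ≤ t → t ≤ u → R s t x → R t u y → R s u (x + y))
    (hb : ∀ s, R s (s + r) (b s)) (h0 : ∀ s < r, R 0 s C₀) (n : ℕ) :
    R 0 n (C₀ + chainSum r b n) := by
  induction n using Nat.strong_induction_on with
  | _ n ih =>
    rcases lt_or_ge n r with h | h
    · rw [chainSum_of_lt h, add_zero]; exact h0 n h
    · obtain ⟨m, rfl⟩ := Nat.exists_eq_add_of_le' h
      have := trans 0 m (m + r) _ _ (Nat.zero_le _) (by omega) (ih m (by omega)) (hb m)
      rwa [add_assoc, add_comm (chainSum r b m), ← chainSum_add hr] at this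

/-- Exponential decay: the costs of the steps of length `r` have a negative mean, and those of the
steps that end at unfavourable times are negligible. -/
theorem exists_exponential_decay (hr : 1 ≤ r) {κ β ε C₁ C₂ : ℝ}
    (trans : ∀ s t u x y, s ≤ t → t ≤ u → R s t x → R t u y → R s u (x + y))
    (mono : ∀ s t x y, x ≤ y → R s t x → R s t y) (refl : ∀ s, R s s 0)
    (hb : ∀ s, R s (s + r) (b s)) (hc0 : ∀ s, 0 ≤ c s)
    (hc : ∀ s, (∀ j < r, R (s + r - j) (s + r) κ) ∨ |b s| + 1 ≤ c s)
    (hfin : ∀ s, ∃ x, R 0 s x) (hβ : 0 < β)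
    (hsum : ∀ n : ℕ, ∑ s ∈ Finset.range n, b s ≤ -β * n + C₁)
    (hcsum : ∀ n : ℕ, ∑ s ∈ Finset.range n, c s ≤ ε * n + C₂)
    (hε : ε * (1 + β) < β / r) :
    ∃ C δ : ℝ, 0 < δ ∧ ∀ n : ℕ, R 0 n (C - δ * n) := by
  choose x hx using hfin
  obtain ⟨C₀, hC₀⟩ : ∃ C₀, ∀ s < r, x s ≤ C₀ := by
    refine ⟨∑ s ∈ Finset.range r, |x s|, fun s hs => (le_abs_self _).trans ?_⟩
    exact Finset.single_le_sum (f := fun s => |x s|) (fun _ _ => abs_nonneg _)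
      (Finset.mem_range.2 hs)
  have h0 : ∀ s < r, R 0 s C₀ := fun s hs => mono _ _ _ _ (hC₀ s hs) (hx s)
  have hr0 : (0 : ℝ) < r := by exact_mod_cast hr
  have hβr : 0 < β / r := div_pos hβ hr0
  -- the cost up to a favourable time
  have key : ∀ τ : ℕ, (τ < r ∨ ∀ j < r, R (τ - j) τ κ) →
      R 0 τ (C₀ + |κ| + |C₁| / r + β - β / r * τ) := by
    intro τ hτ
    rcases lt_or_ge τ r with h | h
    · refine mono _ _ _ _ ?_ (h0 τ h)
      have h1 : β / r * τ ≤ β / r * r :=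
        mul_le_mul_of_nonneg_left (by exact_mod_cast h.le) hβr.le
      rw [div_mul_cancel₀ _ hr0.ne'] at h1
      have : 0 ≤ |C₁| / r := by positivity
      linarith [abs_nonneg κ]
    · have hκ : ∀ j < r, R (τ - j) τ κ := hτ.resolve_left (by omega)
      obtain ⟨m, hm⟩ : ∃ m, τ = m + (r - 1) := ⟨τ - (r - 1), by omega⟩
      have hs := sum_chainSum (b := b) hr m
      -- Some chain is at most the average of the `r` chains. It ends less than `r` steps before the
      -- favourable time `τ`, so closing the gap costs at most `κ`.
      obtain ⟨j, hj, hle⟩ : ∃ j ∈ Finset.range r,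
          chainSum r b (m + j) ≤ (∑ s ∈ Finset.range m, b s) / r := by
        refine Finset.exists_le_of_sum_le (Finset.nonempty_range_iff.2 (by omega)) ?_
        rw [hs, Finset.sum_const, Finset.card_range, nsmul_eq_mul, mul_div_cancel₀ _ hr0.ne']
      have hj' := Finset.mem_range.1 hj
      have h1 := chain_bound hr trans hb h0 (m + j)
      have h2 := hκ (r - 1 - j) (by omega)
      have e : τ - (r - 1 - j) = m + j := by omega
      rw [e] at h2
      refine mono _ _ _ _ ?_ (trans _ _ _ _ _ (Nat.zero_le _) (by omega) h1 h2)
      have h3 : (∑ s ∈ Finset.range m, b s) / r ≤ (-β * m + C₁) / r := by gcongr; exact hsum m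
      have h4 : (τ : ℝ) ≤ m + r := by rw [hm]; exact_mod_cast (by omega)
      have h5 : β / r * τ ≤ β / r * (m + r) := mul_le_mul_of_nonneg_left h4 hβr.le
      have h6 : (-β * m + C₁) / r = C₁ / r - β / r * m := by field_simp; ring
      have h7 : β / r * (m + r) = β / r * m + β := by field_simp
      have h8 : C₁ / r ≤ |C₁| / r := by gcongr; exact le_abs_self _
      linarith [le_abs_self κ]
  -- Stopping at `τ` instead of `n` forfeits `β / r * (n - τ) ≤ β * ∑ c`, and the way from `τ` to
  -- `n` costs another `∑ c`; together `(1 + β) * ∑ c`.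
  refine ⟨C₀ + |κ| + |C₁| / r + β + C₂ * (1 + β), β / r - ε * (1 + β), by linarith, fun n => ?_⟩
  obtain ⟨τ, hτ, h1, h2, h3⟩ := exists_favourable_time hr trans mono refl hb hc0 hc n
  refine mono _ _ _ _ ?_ (trans _ _ _ _ _ (Nat.zero_le _) hτ (key τ h1) h2)
  have h4 := hcsum n
  have h5 : β / r * ((n : ℝ) - τ) ≤ β / r * (r * ∑ s ∈ Finset.range n, c s) :=
    mul_le_mul_of_nonneg_left h3 hβr.le
  have h6 : β / r * (r * ∑ s ∈ Finset.range n, c s) = β * ∑ s ∈ Finset.range n, c s := by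
    field_simp
  have h7 : (1 + β) * ∑ s ∈ Finset.range n, c s ≤ (1 + β) * (ε * n + C₂) :=
    mul_le_mul_of_nonneg_left h4 (by linarith)
  nlinarith

end Array

/-! ### Causal functionals of a stationary process -/

/-- The infinite past `(Y_{t-1}, Y_{t-2}, …)`. -/
def past {Ω S : Type*} (Y : ℤ → Ω → S) (t : ℤ) (ω : Ω) : ℕ → S := fun n => Y (t - 1 - n) ω

/-- `F_t` is almost surely a fixed measurable function of the past `X_{t-1}, X_{t-2}, …`. -/
def Causal {Ω S S' : Type*} [MeasurableSpace Ω] [MeasurableSpace S] [MeasurableSpace S']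
    (P : Measure Ω) (X : ℤ → Ω → S) (F : ℤ → Ω → S') : Prop :=
  ∃ G : (ℕ → S) → S', Measurable G ∧ ∀ t, ∀ᵐ ω ∂P, F t ω = G (past X t ω)

/-- The shift as a measurable equivalence. -/
def shiftEquiv (S : Type*) [MeasurableSpace S] : (ℤ → S) ≃ᵐ (ℤ → S) where
  toFun := shift
  invFun := fun w t => w (t - 1)
  left_inv := fun w => by funext t; simp [shift]
  right_inv := fun w => by funext t; simp [shift]
  measurable_toFun := measurable_pi_lambda _ fun t => measurable_pi_apply _
  measurable_invFun := measurable_pi_lambda _ fun t => measurable_pi_apply _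

theorem shift_iterate_apply {S : Type*} (n : ℕ) (w : ℤ → S) (t : ℤ) :
    shift^[n] w t = w (t + n) := by
  induction n generalizing w with
  | zero => simp
  | succ n ih => rw [Function.iterate_succ_apply, ih, shift]; push_cast; ring_nf

theorem shiftEquiv_symm_iterate_apply {S : Type*} [MeasurableSpace S] (n : ℕ) (w : ℤ → S) (t : ℤ) :
    (shiftEquiv S).symm^[n] w t = w (t - n) := by
  induction n generalizing w with
  | zero => simp
  | succ n ih =>
    rw [Function.iterate_succ_apply, ih]
    change w (t - n - 1) = _
    push_cast; ring_nf

section Causal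

variable {Ω S S' : Type*} [MeasurableSpace Ω] [MeasurableSpace S] [MeasurableSpace S']
  {P : Measure Ω} {X : ℤ → Ω → S} {F : ℤ → Ω → S'}

theorem measurable_past (hX : ∀ t, Measurable (X t)) (t : ℤ) : Measurable (past X t) :=
  measurable_pi_lambda _ fun _ => hX _

theorem map_past (hX : IsStationaryErgodic P X) (t : ℤ) :
    P.map (past X t) = P.map (past X 0) := by
  have hm : Measurable fun ω (t : ℤ) => X t ω := measurable_pi_lambda _ fun _ => hX.measurable _
  have hev : ∀ t : ℤ, Measurable fun (w : ℤ → S) (n : ℕ) => w (t - 1 - n) := fun t =>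
    measurable_pi_lambda _ fun _ => measurable_pi_apply _
  have h1 : ∀ t, P.map (past X t) = (pathLaw P X).map fun w (n : ℕ) => w (t - 1 - n) := fun t => by
    rw [pathLaw, Measure.map_map (hev t) hm]; rfl
  have h2 : ∀ t, P.map (past X (t + 1)) = P.map (past X t) := fun t => by
    have h3 : (pathLaw P X).map (fun w (n : ℕ) => w (t - 1 - n)) =
        ((pathLaw P X).map shift).map fun w (n : ℕ) => w (t - 1 - n) := by
      rw [hX.ergodic.toMeasurePreserving.map_eq]
    rw [h1 t, h3, Measure.map_map (hev t) hX.ergodic.measurable, h1]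
    congr 1
    funext w n
    simp only [Function.comp_apply, shift]
    ring_nf
  induction t using Int.induction_on with
  | zero => rfl
  | succ i ih => rw [h2, ih]
  | pred i ih => rw [← ih, ← h2, sub_add_cancel]

theorem Causal.of_past {G : (ℕ → S) → S'} (hG : Measurable G) :
    Causal P X fun t ω => G (past X t ω) := ⟨G, hG, fun _ => .of_forall fun _ => rfl⟩

theorem Causal.lagged (n : ℕ) : Causal P X fun t => X (t - 1 - n) :=
  .of_past (G := fun w => w n) (measurable_pi_apply n)

theorem Causal.const (c : S') : Causal P X fun _ _ => c := .of_past measurable_const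

theorem Causal.congr {F' : ℤ → Ω → S'} (hF : Causal P X F) (h : ∀ t, ∀ᵐ ω ∂P, F' t ω = F t ω) :
    Causal P X F' := by
  obtain ⟨G, hG, hFG⟩ := hF
  refine ⟨G, hG, fun t => ?_⟩
  filter_upwards [h t, hFG t] with ω h1 h2
  rw [h1, h2]

theorem Causal.comp {S'' : Type*} [MeasurableSpace S''] {g : S' → S''} (hF : Causal P X F)
    (hg : Measurable g) : Causal P X fun t ω => g (F t ω) := by
  obtain ⟨G, hG, hFG⟩ := hF
  refine ⟨g ∘ G, hg.comp hG, fun t => ?_⟩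
  filter_upwards [hFG t] with ω h
  rw [h, Function.comp_apply]

theorem Causal.pi {ι : Type*} [Countable ι] {S' : ι → Type*} [∀ i, MeasurableSpace (S' i)]
    {F : ∀ i, ℤ → Ω → S' i} (hF : ∀ i, Causal P X (F i)) :
    Causal P X fun t ω i => F i t ω := by
  choose G hG hFG using hF
  refine ⟨fun w i => G i w, measurable_pi_lambda _ hG, fun t => ?_⟩
  filter_upwards [ae_all_iff.2 fun i => hFG i t] with ω h
  exact funext h

theorem Causal.prodMk {S'' : Type*} [MeasurableSpace S''] {F' : ℤ → Ω → S''} (hF : Causal P X F)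
    (hF' : Causal P X F') : Causal P X fun t ω => (F t ω, F' t ω) := by
  obtain ⟨G, hG, hFG⟩ := hF
  obtain ⟨G', hG', hFG'⟩ := hF'
  refine ⟨fun w => (G w, G' w), hG.prodMk hG', fun t => ?_⟩
  filter_upwards [hFG t, hFG' t] with ω h h'
  rw [h, h']

theorem Causal.lag (hF : Causal P X F) (m : ℕ) : Causal P X fun t => F (t - m) := by
  obtain ⟨G, hG, hFG⟩ := hF
  refine ⟨fun w => G fun n => w (n + m), hG.comp (measurable_pi_lambda _ fun n =>
    measurable_pi_apply _), fun t => ?_⟩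
  filter_upwards [hFG (t - m)] with ω h
  rw [h]
  congr 1
  funext n
  simp only [past]
  congr 1
  push_cast; ring

/-- The past has the same law at all times, and one function `G` serves them all. -/
theorem Causal.ae_mem (hX : IsStationaryErgodic P X) (hF : Causal P X F) {A : Set S'}
    (hA : MeasurableSet A) (s t : ℤ) (h : ∀ᵐ ω ∂P, F s ω ∈ A) : ∀ᵐ ω ∂P, F t ω ∈ A := by
  obtain ⟨G, hG, hFG⟩ := hF
  have h1 : ∀ t, (∀ᵐ ω ∂P, F t ω ∈ A) ↔ ∀ᵐ w ∂(P.map (past X 0)), G w ∈ A := fun t => by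
    rw [← map_past hX t, ae_map_iff (measurable_past hX.measurable t).aemeasurable (hG hA)]
    refine ⟨fun h => ?_, fun h => ?_⟩ <;> filter_upwards [h, hFG t] with ω h1 h2
    · rwa [← h2]
    · rwa [h2]
  exact (h1 t).2 ((h1 s).1 h)

theorem Causal.aemeasurable (hX : IsStationaryErgodic P X) (hF : Causal P X F) (t : ℤ) :
    AEMeasurable (F t) P := by
  obtain ⟨G, hG, hFG⟩ := hF
  exact ⟨_, hG.comp (measurable_past hX.measurable t), hFG t⟩

theorem Causal.identDistrib (hX : IsStationaryErgodic P X) (hF : Causal P X F) (s t : ℤ) :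
    IdentDistrib (F s) (F t) P P := by
  refine ⟨hF.aemeasurable hX s, hF.aemeasurable hX t, ?_⟩
  obtain ⟨G, hG, hFG⟩ := hF
  have key : ∀ t, P.map (F t) = (P.map (past X 0)).map G := fun t => by
    rw [Measure.map_congr (hFG t), ← map_past hX t,
      Measure.map_map hG (measurable_past hX.measurable t)]
    rfl
  rw [key, key]

/-- The limit of the functions `G n` is taken once, under the law of the past at time `0`. The past
has this law at every time, so the same limit represents `F' t` for all `t`. No measurability of
`F'` is assumed. -/
theorem Causal.of_tendsto [TopologicalSpace S'] [PolishSpace S'] [BorelSpace S']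
    (hX : IsStationaryErgodic P X) {F : ℕ → ℤ → Ω → S'} {F' : ℤ → Ω → S'}
    (hF : ∀ n, Causal P X (F n))
    (h : ∀ t, ∀ᵐ ω ∂P, Tendsto (fun n => F n t ω) atTop (𝓝 (F' t ω))) : Causal P X F' := by
  choose G hG hFG using hF
  have key : ∀ t, ∀ᵐ w ∂(P.map (past X t)), ∃ l, Tendsto (fun n => G n w) atTop (𝓝 l) := fun t => by
    let := TopologicalSpace.upgradeIsCompletelyMetrizable S'
    rw [ae_map_iff (measurable_past hX.measurable t).aemeasurable (measurableSet_exists_tendsto hG)]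
    filter_upwards [h t, ae_all_iff.2 fun n => hFG n t] with ω h1 h2
    exact ⟨F' t ω, by simpa only [← h2] using h1⟩
  obtain ⟨G', hG', hlim⟩ := measurable_limit_of_tendsto_metrizable_ae
    (fun n => (hG n).aemeasurable) (key 0)
  refine ⟨G', hG', fun t => ?_⟩
  rw [← map_past hX t] at hlim
  filter_upwards [h t, ae_all_iff.2 fun n => hFG n t,
    ae_of_ae_map (measurable_past hX.measurable t).aemeasurable hlim] with ω h1 h2 h3
  simp only [← h2] at h3
  exact tendsto_nhds_unique h1 h3

theorem Causal.iSup {ι : Type*} [Countable ι] {F : ι → ℤ → Ω → ENNReal}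
    (hF : ∀ i, Causal P X (F i)) : Causal P X fun t ω => ⨆ i, F i t ω :=
  (Causal.pi hF).comp (g := fun v => ⨆ i, v i) (.iSup fun i => measurable_pi_apply i)

theorem Causal.iInf {ι : Type*} [Countable ι] {F : ι → ℤ → Ω → ENNReal}
    (hF : ∀ i, Causal P X (F i)) : Causal P X fun t ω => ⨅ i, F i t ω :=
  (Causal.pi hF).comp (g := fun v => ⨅ i, v i) (.iInf fun i => measurable_pi_apply i)

variable [IsProbabilityMeasure P]

/-- This is `ae_bddAbove_birkhoffSum` for `F - a`, whose mean is negative, under the shift and under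
its inverse. -/
theorem Causal.ae_sum_le {F : ℤ → Ω → ℝ} (hX : IsStationaryErgodic P X) (hF : Causal P X F)
    (hint : Integrable (F 0) P) {a : ℝ} (ha : ∫ ω, F 0 ω ∂P < a) :
    ∀ᵐ ω ∂P, ∀ t : ℤ, (∃ C, ∀ n : ℕ, ∑ s ∈ Finset.range n, F (t + s) ω ≤ a * n + C) ∧
      ∃ C, ∀ n : ℕ, ∑ s ∈ Finset.range n, F (t - s) ω ≤ a * n + C := by
  obtain ⟨G, hG, hFG⟩ := hF
  have hm : Measurable fun ω (t : ℤ) => X t ω := measurable_pi_lambda _ fun _ => hX.measurable _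
  have hprob : IsProbabilityMeasure (pathLaw P X) := Measure.isProbabilityMeasure_map hm.aemeasurable
  have hev : ∀ t : ℤ, Measurable fun (w : ℤ → S) (n : ℕ) => w (t - 1 - n) := fun t =>
    measurable_pi_lambda _ fun _ => measurable_pi_apply _
  rw [ae_all_iff]
  intro t
  have hGev : Measurable fun w : ℤ → S => G fun n => w (t - 1 - n) := hG.comp (hev t)
  let g : (ℤ → S) → ℝ := fun w => G (fun n => w (t - 1 - n)) - a
  have hg : Measurable g := hGev.sub_const a
  have hpast0 := measurable_past hX.measurable 0
  have hpast := measurable_past hX.measurable t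
  have hG0 : Integrable G (P.map (past X 0)) := by
    rw [integrable_map_measure hG.aestronglyMeasurable hpast0.aemeasurable]
    exact hint.congr (hFG 0)
  have hGt : Integrable (fun w : ℤ → S => G (fun n => w (t - 1 - n))) (pathLaw P X) := by
    rw [← map_past hX t, integrable_map_measure hG.aestronglyMeasurable hpast.aemeasurable] at hG0
    rw [pathLaw, integrable_map_measure hGev.aestronglyMeasurable hm.aemeasurable]
    exact hG0
  have hgint : Integrable g (pathLaw P X) := hGt.sub (integrable_const a)
  have hgneg : ∫ w, g w ∂(pathLaw P X) < 0 := by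
    have h1 : ∫ w, G (fun n => w (t - 1 - n)) ∂(pathLaw P X) = ∫ ω, F 0 ω ∂P := by
      rw [pathLaw, integral_map hm.aemeasurable hGev.aestronglyMeasurable,
        integral_congr_ae (hFG 0)]
      change ∫ ω, G (past X t ω) ∂P = _
      rw [← integral_map hpast.aemeasurable hG.aestronglyMeasurable, map_past hX t,
        integral_map hpast0.aemeasurable hG.aestronglyMeasurable]
    rw [integral_sub hGt (integrable_const a), h1]
    simpa using ha
  have hall : ∀ᵐ ω ∂P, ∀ s, F s ω = G (past X s ω) := ae_all_iff.2 hFG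
  have hfw := ae_of_ae_map hm.aemeasurable (ae_bddAbove_birkhoffSum (μ := pathLaw P X) hX.ergodic hg hgint hgneg)
  have hsymm : Ergodic (shiftEquiv S).symm (pathLaw P X) :=
    Ergodic.symm (e := shiftEquiv S) hX.ergodic
  have hbw := ae_of_ae_map hm.aemeasurable (ae_bddAbove_birkhoffSum (μ := pathLaw P X) hsymm hg hgint hgneg)
  filter_upwards [hall, hfw, hbw] with ω h1 h2 h3
  constructor
  · obtain ⟨C, hC⟩ := h2
    refine ⟨C, fun n => ?_⟩
    have h4 := hC n
    simp only [birkhoffSum, g, shift_iterate_apply, Finset.sum_sub_distrib, Finset.sum_const,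
      Finset.card_range, nsmul_eq_mul] at h4
    have e : ∀ s : ℕ, F (t + s) ω = G fun n => X (t - 1 - n + s) ω := fun s => by
      rw [h1]; congr 1; funext n; simp only [past]; congr 1; ring
    simp only [e]
    linarith
  · obtain ⟨C, hC⟩ := h3
    refine ⟨C, fun n => ?_⟩
    have h4 := hC n
    simp only [birkhoffSum, g, shiftEquiv_symm_iterate_apply, Finset.sum_sub_distrib,
      Finset.sum_const, Finset.card_range, nsmul_eq_mul] at h4
    have e : ∀ s : ℕ, F (t - s) ω = G fun n => X (t - 1 - n - s) ω := fun s => by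
      rw [h1]; congr 1; funext n; simp only [past]; congr 1; ring
    simp only [e]
    linarith

theorem le_of_sum_le {u : ℕ → ℝ} {m ε C C' : ℝ}
    (h : ∀ n : ℕ, ∑ s ∈ Finset.range n, u s ≤ (m + ε) * n + C)
    (h' : ∀ n : ℕ, ∑ s ∈ Finset.range n, -u s ≤ (-m + ε) * n + C') (n : ℕ) :
    u n ≤ 2 * ε * n + (m + ε + C + C') := by
  have h1 := h (n + 1)
  have h2 := h' n
  rw [Finset.sum_range_succ] at h1
  rw [Finset.sum_neg_distrib] at h2
  push_cast at h1
  linarith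

/-- A single term is a difference of two partial sums, and these are squeezed between slopes close
to the mean (`le_of_sum_le`). The countably many margins `1 / (k + 1)` give one null set for all
`ε`. -/
theorem Causal.ae_sublinear {F : ℤ → Ω → ℝ} (hX : IsStationaryErgodic P X) (hF : Causal P X F)
    (hint : Integrable (F 0) P) :
    ∀ᵐ ω ∂P, ∀ t : ℤ, ∀ ε > 0, (∃ C, ∀ n : ℕ, F (t + n) ω ≤ ε * n + C) ∧
      ∃ C, ∀ n : ℕ, F (t - n) ω ≤ ε * n + C := by
  set m := ∫ ω, F 0 ω ∂P with hm
  have hpos : ∀ k : ℕ, (0 : ℝ) < 1 / (k + 1) := fun k => Nat.one_div_pos_of_nat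
  have h1 := fun k : ℕ => hF.ae_sum_le hX hint (a := m + 1 / (k + 1)) (by linarith [hpos k])
  have h2 := fun k : ℕ => (hF.comp measurable_neg).ae_sum_le hX hint.neg (a := -m + 1 / (k + 1))
    (by rw [integral_neg]; linarith [hpos k])
  filter_upwards [ae_all_iff.2 h1, ae_all_iff.2 h2] with ω h1 h2 t ε hε
  obtain ⟨k, hk⟩ := exists_nat_one_div_lt (half_pos hε)
  have hle : ∀ n : ℕ, 2 * (1 / ((k : ℝ) + 1)) * n ≤ ε * n := fun n =>
    mul_le_mul_of_nonneg_right (by linarith) n.cast_nonneg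
  obtain ⟨⟨C₁, hC₁⟩, ⟨C₂, hC₂⟩⟩ := h1 k t
  obtain ⟨⟨C₃, hC₃⟩, ⟨C₄, hC₄⟩⟩ := h2 k t
  exact ⟨⟨_, fun n => (le_of_sum_le hC₁ hC₃ n).trans (add_le_add (hle n) le_rfl)⟩,
    ⟨_, fun n => (le_of_sum_le hC₂ hC₄ n).trans (add_le_add (hle n) le_rfl)⟩⟩

theorem Causal.ae_sublinear_ennreal {F : ℤ → Ω → ENNReal} (hX : IsStationaryErgodic P X)
    (hF : Causal P X F) (hint : ∫⁻ ω, F 0 ω ∂P < ⊤) :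
    ∀ᵐ ω ∂P, ∀ t : ℤ, ∀ ε > 0, (∃ C, ∀ n : ℕ, F (t + n) ω ≤ ENNReal.ofReal (ε * n + C)) ∧
      ∃ C, ∀ n : ℕ, F (t - n) ω ≤ ENNReal.ofReal (ε * n + C) := by
  have hm := hF.aemeasurable hX 0
  have hfin : ∀ t, ∀ᵐ ω ∂P, F t ω ∈ Set.Iio ⊤ := fun t =>
    hF.ae_mem hX measurableSet_Iio 0 t (ae_lt_top' hm hint.ne)
  filter_upwards [(hF.comp ENNReal.measurable_toReal).ae_sublinear hX
    (integrable_toReal_of_lintegral_ne_top hm hint.ne), ae_all_iff.2 hfin] with ω h1 h2 t ε hε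
  obtain ⟨⟨C, hC⟩, ⟨C', hC'⟩⟩ := h1 t ε hε
  refine ⟨⟨C, fun n => ?_⟩, ⟨C', fun n => ?_⟩⟩
  · exact (ENNReal.le_ofReal_iff_toReal_le (h2 _).ne
      (ENNReal.toReal_nonneg.trans (hC n))).2 (hC n)
  · exact (ENNReal.le_ofReal_iff_toReal_le (h2 _).ne
      (ENNReal.toReal_nonneg.trans (hC' n))).2 (hC' n)

end Causal

/-! ### The random maps of the recurrence equation -/

namespace Model

/-! ### Metrics equivalent to the maximum metric -/

section LagMetric

variable {k p q : ℕ} {F Θ : Type*} [MetricSpace F] [MeasurableSpace F] {M : Model k p q F Θ}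

theorem LagMetric.self (E : M.LagMetric) (x : Fin p → M.State) : E.d x x = 0 := by
  obtain ⟨c, -, hc⟩ := E.lower
  obtain ⟨c', hc'⟩ := E.upper
  have h1 := hc x x
  have h2 := hc' x x
  rw [dist_self, mul_zero] at h1 h2
  exact le_antisymm h2 h1

theorem LagMetric.nonneg (E : M.LagMetric) (x y : Fin p → M.State) : 0 ≤ E.d x y := by
  obtain ⟨c, hc0, hc⟩ := E.lower
  exact (mul_nonneg hc0.le dist_nonneg).trans (hc x y)

theorem LagMetric.eq_of_nonpos (E : M.LagMetric) {x y : Fin p → M.State} (h : E.d x y ≤ 0) :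
    x = y := by
  obtain ⟨c, hc0, hc⟩ := E.lower
  have h1 := (hc x y).trans h
  exact dist_le_zero.1 (by by_contra! h2; linarith [mul_pos hc0 h2])

theorem LagMetric.exists_dist_le (E : M.LagMetric) :
    ∃ c : ℝ, 0 < c ∧ ∀ x y, dist x y ≤ c * E.d x y := by
  obtain ⟨c, hc0, hc⟩ := E.lower
  exact ⟨c⁻¹, inv_pos.2 hc0, fun x y => by
    rw [← div_eq_inv_mul, le_div_iff₀ hc0, mul_comm]; exact hc x y⟩

theorem LagMetric.exists_le_dist (E : M.LagMetric) :
    ∃ c : NNReal, ∀ x y, E.d x y ≤ c * dist x y := by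
  obtain ⟨c, hc⟩ := E.upper
  refine ⟨c.toNNReal, fun x y => (hc x y).trans ?_⟩
  exact mul_le_mul_of_nonneg_right (Real.le_coe_toNNReal c) dist_nonneg

theorem LagMetric.continuous (E : M.LagMetric) :
    Continuous fun z : (Fin p → M.State) × (Fin p → M.State) => E.d z.1 z.2 := by
  obtain ⟨c, hc⟩ := E.exists_le_dist
  refine (LipschitzWith.of_dist_le_mul (K := 2 * c) fun z w => ?_).continuous
  have key : ∀ z w : (Fin p → M.State) × (Fin p → M.State),
      E.d z.1 z.2 - E.d w.1 w.2 ≤ 2 * c * dist z w := fun z w => by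
    have h1 := E.triangle z.1 w.1 z.2
    have h2 := E.triangle w.1 w.2 z.2
    have h3 := hc z.1 w.1
    have h4 := hc w.2 z.2
    have h5 : c * dist z.1 w.1 ≤ c * dist z w :=
      mul_le_mul_of_nonneg_left (le_max_left _ _) c.2
    have h6 : c * dist w.2 z.2 ≤ c * dist z w :=
      mul_le_mul_of_nonneg_left (by rw [dist_comm]; exact le_max_right _ _) c.2
    linarith
  rw [Real.dist_eq, abs_le]
  push_cast
  have h1 := key z w
  have h2 := key w z
  rw [dist_comm] at h2
  exact ⟨by linarith, h1⟩

end LagMetric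

/-! ### Iterated maps along a fixed path -/

section Paths

variable {k p q : ℕ} {F Θ : Type*} [MetricSpace F] [MeasurableSpace F] {M : Model k p q F Θ}
  {Ω : Type*} {X : ℤ → Ω → (Fin k → ℝ)} {E : M.LagMetric} {ω : Ω}

theorem phiIter_add (m n : ℕ) (t : ℤ) (ω : Ω) (θ : Θ) (x : Fin p → M.State) :
    M.phiIter X (m + n) t ω θ x = M.phiIter X m t ω θ (M.phiIter X n (t - m) ω θ x) := by
  induction m generalizing t with
  | zero => simp [phiIter]
  | succ m ih =>
    rw [Nat.add_right_comm, phiIter, ih, phiIter]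
    congr 3
    push_cast; ring

theorem fitted_eq_phiIter (ζ : Ω → Θ → (Fin p → M.State)) (θ : Θ) (n : ℕ) :
    M.fitted X ζ ω θ n = M.phiIter X n n ω θ (ζ ω θ) := by
  induction n with
  | zero => rfl
  | succ n ih =>
    rw [fitted, ih, phiIter]
    push_cast
    rw [add_sub_cancel_right]

/-- The `n`-fold composition up to time `t` is Lipschitz with coefficient `exp a` on `B`. -/
def LogLip (M : Model k p q F Θ) (X : ℤ → Ω → (Fin k → ℝ)) (E : M.LagMetric) (B : Set Θ) (ω : Ω)
    (n : ℕ) (t : ℤ) (a : ℝ) : Prop :=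
  ∀ θ ∈ B, ∀ x y, E.d (M.phiIter X n t ω θ x) (M.phiIter X n t ω θ y) ≤ Real.exp a * E.d x y

theorem LogLip.zero {B : Set Θ} (t : ℤ) : M.LogLip X E B ω 0 t 0 := fun θ _ x y => by
  simp [phiIter]

theorem LogLip.mono {B : Set Θ} {n : ℕ} {t : ℤ} {a b : ℝ} (h : M.LogLip X E B ω n t a)
    (hab : a ≤ b) : M.LogLip X E B ω n t b := fun θ hθ x y =>
  (h θ hθ x y).trans (mul_le_mul_of_nonneg_right (Real.exp_le_exp.2 hab) (E.nonneg _ _))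

theorem LogLip.comp {B : Set Θ} {m n : ℕ} {t : ℤ} {a b : ℝ} (h : M.LogLip X E B ω m t a)
    (h' : M.LogLip X E B ω n (t - m) b) : M.LogLip X E B ω (m + n) t (b + a) := fun θ hθ x y => by
  rw [phiIter_add, phiIter_add]
  refine (h θ hθ _ _).trans ?_
  rw [add_comm, Real.exp_add, mul_assoc]
  exact mul_le_mul_of_nonneg_left (h' θ hθ x y) (Real.exp_nonneg _)

variable [TopologicalSpace Θ]

/-- Along the path `ω`, the random maps are continuous in the parameter and Lipschitz, uniformly
in the parameter. -/
structure PathRegular (M : Model k p q F Θ) (X : ℤ → Ω → (Fin k → ℝ)) (E : M.LagMetric) (ω : Ω) :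
    Prop where
  continuous : ∀ t x, Continuous fun θ => M.phi X t ω θ x
  lipschitz : ∀ t, ∃ a, ∀ θ x y, E.d (M.phi X t ω θ x) (M.phi X t ω θ y) ≤ Real.exp a * E.d x y

theorem CI.ae_pathRegular [MeasurableSpace Ω] {P : Measure Ω} [CompactSpace Θ]
    (h : M.CI P X E) : ∀ᵐ ω ∂P, M.PathRegular X E ω := by
  obtain ⟨L, hL⟩ := h.coeff
  filter_upwards [h.continuous, hL.lipschitz] with ω h1 h2
  refine ⟨h1, fun t => ?_⟩
  obtain ⟨K, hK⟩ := (isCompact_range (hL.continuous t ω)).bddAbove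
  refine ⟨Real.log (max K 1), fun θ x y => (h2 t θ x y).trans ?_⟩
  rw [Real.exp_log (by positivity)]
  exact mul_le_mul_of_nonneg_right ((hK ⟨θ, rfl⟩).trans (le_max_left _ _)) (E.nonneg _ _)

theorem PathRegular.continuous_phi (h : M.PathRegular X E ω) (t : ℤ) :
    Continuous fun z : Θ × (Fin p → M.State) => M.phi X t ω z.1 z.2 := by
  obtain ⟨a, ha⟩ := h.lipschitz t
  obtain ⟨c, hc0, hc⟩ := E.exists_dist_le
  obtain ⟨c', hc'⟩ := E.exists_le_dist
  refine continuous_prod_of_continuous_lipschitzWith' _ (c.toNNReal * (Real.exp a).toNNReal * c') ?_ ?_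
  · intro θ
    refine LipschitzWith.of_dist_le_mul fun x y => (hc _ _).trans ?_
    push_cast
    rw [Real.coe_toNNReal _ hc0.le, Real.coe_toNNReal _ (Real.exp_nonneg a), mul_assoc, mul_assoc]
    gcongr
    exact (ha θ x y).trans (by gcongr; exact hc' x y)
  · exact fun x => h.continuous t x

theorem PathRegular.continuous_phiIter (h : M.PathRegular X E ω) (n : ℕ) (t : ℤ) :
    Continuous fun z : Θ × (Fin p → M.State) => M.phiIter X n t ω z.1 z.2 := by
  induction n generalizing t with
  | zero => exact continuous_snd
  | succ n ih => exact (h.continuous_phi t).comp (continuous_fst.prodMk (ih (t - 1)))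

theorem PathRegular.exists_logLip (h : M.PathRegular X E ω) (B : Set Θ) (n : ℕ) (t : ℤ) :
    ∃ a, M.LogLip X E B ω n t a := by
  induction n generalizing t with
  | zero => exact ⟨0, LogLip.zero t⟩
  | succ n ih =>
    obtain ⟨a, ha⟩ := h.lipschitz t
    obtain ⟨b, hb⟩ := ih (t - 1)
    have h1 : M.LogLip X E B ω 1 t a := fun θ _ x y => ha θ x y
    exact ⟨b + a, by rw [add_comm n]; exact h1.comp (by simpa using hb)⟩

end Paths

/-! ### Measurable Lipschitz coefficients -/

section LipSup

variable {k p q : ℕ} {F Θ : Type*} [MetricSpace F] [MeasurableSpace F] {M : Model k p q F Θ}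
  {Ω : Type*} {X : ℤ → Ω → (Fin k → ℝ)} {E : M.LagMetric} {ω : Ω}

/-- The largest Lipschitz quotient of the `n`-fold composition, over parameters in `D` and
arguments in `D'`. -/
def lipSup (M : Model k p q F Θ) (X : ℤ → Ω → (Fin k → ℝ)) (E : M.LagMetric) (D : Set Θ)
    (D' : Set (Fin p → M.State)) (n : ℕ) (t : ℤ) (ω : Ω) : ENNReal :=
  ⨆ z : D × D' × D', ENNReal.ofReal
    (E.d (M.phiIter X n t ω z.1 z.2.1) (M.phiIter X n t ω z.1 z.2.2) / E.d z.2.1 z.2.2)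

theorem lipSup_le {D : Set Θ} {D' : Set (Fin p → M.State)} {n : ℕ} {t : ℤ} {K : ℝ} (hK : 0 ≤ K)
    (h : ∀ θ ∈ D, ∀ x y, E.d (M.phiIter X n t ω θ x) (M.phiIter X n t ω θ y) ≤ K * E.d x y) :
    M.lipSup X E D D' n t ω ≤ ENNReal.ofReal K := by
  refine iSup_le fun z => ENNReal.ofReal_le_ofReal ?_
  exact div_le_of_le_mul₀ (E.nonneg _ _) hK (h _ z.1.2 _ _)

theorem lipSup_mono {D₁ D₂ : Set Θ} (h : D₁ ⊆ D₂) {D' : Set (Fin p → M.State)} {n : ℕ} {t : ℤ} :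
    M.lipSup X E D₁ D' n t ω ≤ M.lipSup X E D₂ D' n t ω :=
  iSup_le fun z => le_iSup (fun z : D₂ × D' × D' => ENNReal.ofReal
    (E.d (M.phiIter X n t ω z.1 z.2.1) (M.phiIter X n t ω z.1 z.2.2) / E.d z.2.1 z.2.2))
    (⟨z.1, h z.1.2⟩, z.2)

/-- The Lipschitz inequality is a closed condition on `(θ, x, y)`, so it extends from the dense sets
where it is tested; as `B` is open, `B ∩ D` is dense in it. Equal arguments give the quotient `0 / 0
= 0`, but there the inequality is trivial. -/
theorem logLip_of_lipSup_le [TopologicalSpace Θ] (h : M.PathRegular X E ω) {B D : Set Θ}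
    (hB : IsOpen B) (hD : Dense D)
    {D' : Set (Fin p → M.State)} (hD' : Dense D') {n : ℕ} {t : ℤ} {a : ℝ}
    (hle : M.lipSup X E (B ∩ D) D' n t ω ≤ ENNReal.ofReal (Real.exp a)) :
    M.LogLip X E B ω n t a := by
  have hc := h.continuous_phiIter n t
  let A : Set (Θ × (Fin p → M.State) × (Fin p → M.State)) :=
    {z | E.d (M.phiIter X n t ω z.1 z.2.1) (M.phiIter X n t ω z.1 z.2.2)
      ≤ Real.exp a * E.d z.2.1 z.2.2}
  have hA : IsClosed A := by
    refine isClosed_le (E.continuous.comp (Continuous.prodMk ?_ ?_))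
      (continuous_const.mul (E.continuous.comp continuous_snd))
    · exact hc.comp (continuous_fst.prodMk (continuous_fst.comp continuous_snd))
    · exact hc.comp (continuous_fst.prodMk (continuous_snd.comp continuous_snd))
  have hsub : (B ∩ D) ×ˢ (D' ×ˢ D') ⊆ A := by
    rintro ⟨θ, x, y⟩ ⟨hθ, hx, hy⟩
    have h1 := (le_iSup (fun z : ↥(B ∩ D) × D' × D' => ENNReal.ofReal
      (E.d (M.phiIter X n t ω z.1 z.2.1) (M.phiIter X n t ω z.1 z.2.2) / E.d z.2.1 z.2.2))
      (⟨θ, hθ⟩, ⟨x, hx⟩, ⟨y, hy⟩)).trans hle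
    rw [ENNReal.ofReal_le_ofReal_iff (Real.exp_nonneg a)] at h1
    change E.d _ _ ≤ _ * E.d x y
    rcases (E.nonneg x y).eq_or_lt with h2 | h2
    · rw [E.eq_of_nonpos h2.ge, E.self, E.self, mul_zero]
    · exact (div_le_iff₀ h2).1 h1
  intro θ hθ x y
  refine closure_minimal hsub hA (show (θ, x, y) ∈ _ from ?_)
  rw [closure_prod_eq, closure_prod_eq]
  exact ⟨hD.open_subset_closure_inter hB hθ, hD' x, hD' y⟩

theorem measurable_step (θ : Θ) (x : Fin p → M.State) : Measurable fun u => M.step u θ x := by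
  refine measurable_pi_lambda _ fun i => ?_
  unfold step
  split_ifs
  · exact M.measurable_f x θ
  · exact measurable_const

variable [TopologicalSpace.SeparableSpace F] [BorelSpace F] [TopologicalSpace Θ]
  [MeasurableSpace Ω] {P : Measure Ω}

instance : PolishSpace M.State := by
  have : CompleteSpace M.State := M.complete.completeSpace_coe
  have : SecondCountableTopology F := UniformSpace.secondCountable_of_separable F
  infer_instance

theorem causal_lags (n : ℕ) : Causal P X (lags X n) :=
  Causal.pi fun i : Fin n => Causal.lagged (i : ℕ)

/-- `f` is measurable in `u` for fixed `x` and, along regular paths, continuous in `x`. Replacing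
`x` by its nearest point among finitely many terms of a dense sequence gives jointly measurable maps
that converge. -/
theorem causal_phi (hX : IsStationaryErgodic P X) (hreg : ∀ᵐ ω ∂P, M.PathRegular X E ω) (θ : Θ)
    {x : ℤ → Ω → (Fin p → M.State)} (hx : Causal P X x) :
    Causal P X fun t ω => M.phi X t ω θ (x t ω) := by
  have : SecondCountableTopology F := UniformSpace.secondCountable_of_separable F
  rcases isEmpty_or_nonempty (Fin p → M.State) with hemp | hne
  · exact hx.congr fun t => .of_forall fun ω => (hemp.false (x t ω)).elim
  let e := TopologicalSpace.denseSeq (Fin p → M.State)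
  have hmeas : ∀ N, Measurable fun z : (Fin q → (Fin k → ℝ)) × (Fin p → M.State) =>
      M.step z.1 θ (SimpleFunc.nearestPt e N z.2) := fun N =>
    SimpleFunc.measurable_bind ((SimpleFunc.nearestPt e N).comp Prod.snd measurable_snd)
      (fun y z => M.step z.1 θ y) fun y => (measurable_step θ y).comp measurable_fst
  refine Causal.of_tendsto hX (fun N => ((causal_lags q).prodMk hx).comp (hmeas N)) fun t => ?_
  filter_upwards [hreg] with ω hω
  have h1 : Tendsto (fun N => SimpleFunc.nearestPt e N (x t ω)) atTop (𝓝 (x t ω)) :=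
    SimpleFunc.tendsto_nearestPt (TopologicalSpace.denseRange_denseSeq _ _)
  exact (((hω.continuous_phi t).comp (Continuous.prodMk_right θ)).tendsto _).comp h1

theorem causal_phiIter (hX : IsStationaryErgodic P X) (hreg : ∀ᵐ ω ∂P, M.PathRegular X E ω)
    (θ : Θ) (x : Fin p → M.State) (n : ℕ) : Causal P X fun t ω => M.phiIter X n t ω θ x := by
  induction n with
  | zero => exact .const x
  | succ n ih => exact causal_phi hX hreg θ (by simpa using ih.lag 1)

/-- Countable suprema keep this coefficient a functional of the past of `X`. The coefficients in
`CI` are merely stationary, and ergodicity of `X` says nothing about their averages. -/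
theorem causal_lipSup (hX : IsStationaryErgodic P X) (hreg : ∀ᵐ ω ∂P, M.PathRegular X E ω)
    {D : Set Θ} (hD : D.Countable) {D' : Set (Fin p → M.State)} (hD' : D'.Countable) (n : ℕ) :
    Causal P X (M.lipSup X E D D' n) := by
  have : SecondCountableTopology F := UniformSpace.secondCountable_of_separable F
  have := hD.to_subtype
  have := hD'.to_subtype
  refine Causal.iSup fun z => ?_
  have h1 := causal_phiIter hX hreg (z.1 : Θ) (z.2.1 : Fin p → M.State) n
  have h2 := causal_phiIter hX hreg (z.1 : Θ) (z.2.2 : Fin p → M.State) n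
  exact (h1.prodMk h2).comp
    (g := fun v => ENNReal.ofReal (E.d v.1 v.2 / E.d z.2.1 z.2.2))
    (ENNReal.measurable_ofReal.comp (E.continuous.measurable.div_const _))

end LipSup

end Model

/-! ### Negative Lyapunov exponent -/

/-- The logarithm, truncated from below at `-m`. -/
def truncLog (m : ℝ) (x : ℝ) : ℝ := Real.log (max x (Real.exp (-m)))

theorem continuous_truncLog (m : ℝ) : Continuous (truncLog m) :=
  (continuous_id.max continuous_const).log fun _ => (lt_max_of_lt_right (Real.exp_pos _)).ne'

theorem truncLog_mono (m : ℝ) : Monotone (truncLog m) := fun _ _ h =>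
  Real.log_le_log (lt_max_of_lt_right (Real.exp_pos _)) (max_le_max h le_rfl)

theorem exp_truncLog (m x : ℝ) : Real.exp (truncLog m x) = max x (Real.exp (-m)) :=
  Real.exp_log (lt_max_of_lt_right (Real.exp_pos _))

theorem neg_le_truncLog (m x : ℝ) : -m ≤ truncLog m x := by
  rw [truncLog, Real.le_log_iff_exp_le (lt_max_of_lt_right (Real.exp_pos _))]
  exact le_max_right _ _

theorem truncLog_le_posLog {m x : ℝ} (hm : 0 ≤ m) (hx : 0 ≤ x) : truncLog m x ≤ Real.posLog x := by
  rw [truncLog, Real.posLog_eq_log_max_one hx, max_comm 1 x]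
  exact Real.log_le_log (lt_max_of_lt_right (Real.exp_pos _))
    (max_le_max le_rfl (Real.exp_le_one_iff.2 (by linarith)))

/-- The form `log⁺` minus truncated `log⁻` lets monotone convergence act on the second part as `m`
grows. -/
theorem truncLog_eq (m : ℕ) {x : ℝ} (hx : 0 ≤ x) :
    truncLog m x = Real.posLog x - (min (-extLog x).toENNReal m).toReal := by
  rcases hx.eq_or_lt with rfl | hx
  · have : truncLog m 0 = -m := by
      rw [truncLog, max_eq_right (Real.exp_pos _).le, Real.log_exp]
    rw [this]
    simp [extLog]
  have h1 : (-extLog x).toENNReal = ENNReal.ofReal (-Real.log x) := by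
    rw [extLog, ENNReal.log_ofReal_of_pos hx, ← EReal.coe_neg, EReal.toENNReal_of_ne_top (by simp)]
    simp
  rw [h1]
  have h2 : (min (ENNReal.ofReal (-Real.log x)) (m : ENNReal)).toReal
      = min (max (-Real.log x) 0) m := by
    rw [ENNReal.toReal_min (by simp) (by simp), ENNReal.toReal_ofReal', ENNReal.toReal_natCast]
  have hm : (0 : ℝ) ≤ m := m.cast_nonneg
  have h3 : truncLog m x = max (Real.log x) (-m) := by
    rw [truncLog]
    rcases le_total x (Real.exp (-m)) with h | h
    · rw [max_eq_right h, Real.log_exp, max_eq_right]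
      rwa [Real.log_le_iff_le_exp hx]
    · rw [max_eq_left h, max_eq_left]
      rwa [Real.le_log_iff_exp_le hx]
  rw [h2, h3, Real.posLog]
  grind

theorem toENNReal_extLog {x : ℝ} (hx : 0 ≤ x) :
    (extLog x).toENNReal = ENNReal.ofReal (Real.posLog x) := by
  rcases hx.eq_or_lt with rfl | hx
  · simp [extLog]
  rw [extLog, ENNReal.log_ofReal_of_pos hx, EReal.real_coe_toENNReal, Real.posLog]
  rcases le_total 0 (Real.log x) with h | h
  · rw [max_eq_right h]
  · rw [max_eq_left h, ENNReal.ofReal_of_nonpos h, ENNReal.ofReal_zero]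

theorem measurable_extLog : Measurable extLog :=
  ENNReal.measurable_log.comp ENNReal.measurable_ofReal

/-- The mean of the logarithm may be `-∞`. Its negativity means `∫ log⁺ < ∫ log⁻`, and the right
side is the supremum over `m` of the integrals of `min (log⁻) m`. -/
theorem exists_integral_truncLog_neg {Ω : Type*} [MeasurableSpace Ω] {P : Measure Ω}
    [IsFiniteMeasure P] {f : Ω → ℝ} (hf : Measurable f) (h0 : ∀ ω, 0 ≤ f ω)
    (hfin : ∫⁻ ω, ENNReal.ofReal (Real.posLog (f ω)) ∂P < ⊤)
    (hneg : extExpectation P (fun ω => extLog (f ω)) < 0) :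
    ∃ m : ℕ, Integrable (fun ω => truncLog m (f ω)) P ∧ ∫ ω, truncLog m (f ω) ∂P < 0 := by
  let N : Ω → ENNReal := fun ω => (-extLog (f ω)).toENNReal
  have hN : Measurable N := (measurable_extLog.comp hf).neg.ereal_toENNReal
  have hpos : Measurable fun ω => Real.posLog (f ω) := by
    unfold Real.posLog; fun_prop
  have hlt : ∫⁻ ω, ENNReal.ofReal (Real.posLog (f ω)) ∂P < ∫⁻ ω, N ω ∂P := by
    by_contra! hcon
    refine absurd hneg (not_lt.2 ?_)
    rw [extExpectation]
    simp only [toENNReal_extLog (h0 _)]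
    refine EReal.sub_nonneg ?_ ?_ |>.2 ?_
    · left; simpa using hfin.ne
    · left; simp
    · exact_mod_cast hcon
  have hsup : ∫⁻ ω, N ω ∂P = ⨆ m : ℕ, ∫⁻ ω, min (N ω) m ∂P := by
    rw [← lintegral_iSup (fun m => hN.min measurable_const)]
    · congr 1
      funext ω
      rw [← inf_iSup_eq, ENNReal.iSup_natCast, inf_top_eq]
    · exact fun a b hab ω => min_le_min le_rfl (by exact_mod_cast hab)
  rw [hsup, lt_iSup_iff] at hlt
  obtain ⟨m, hm⟩ := hlt
  have hmin : Measurable fun ω => min (N ω) (m : ENNReal) := hN.min measurable_const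
  have hminfin : ∫⁻ ω, min (N ω) (m : ENNReal) ∂P ≠ ⊤ := by
    refine ne_top_of_le_ne_top ?_ (lintegral_mono fun ω => min_le_right (N ω) (m : ENNReal))
    rw [lintegral_const]
    exact ENNReal.mul_ne_top (by simp) (measure_ne_top _ _)
  have hi1 : Integrable (fun ω => Real.posLog (f ω)) P :=
    (lintegral_ofReal_ne_top_iff_integrable hpos.aestronglyMeasurable
      (.of_forall fun ω => Real.posLog_nonneg)).1 hfin.ne
  have hi2 : Integrable (fun ω => (min (N ω) (m : ENNReal)).toReal) P :=
    integrable_toReal_of_lintegral_ne_top hmin.aemeasurable hminfin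
  have e : (fun ω => truncLog m (f ω))
      = fun ω => Real.posLog (f ω) - (min (N ω) (m : ENNReal)).toReal :=
    funext fun ω => truncLog_eq m (h0 ω)
  refine ⟨m, e ▸ hi1.sub hi2, ?_⟩
  rw [e, integral_sub hi1 hi2, integral_toReal hmin.aemeasurable
    (.of_forall fun ω => (min_le_right _ _).trans_lt (by simp)), integral_eq_lintegral_of_nonneg_ae
      (.of_forall fun ω => Real.posLog_nonneg) hpos.aestronglyMeasurable, sub_neg]
  exact (ENNReal.toReal_lt_toReal hfin.ne hminfin).2 hm

/-! ### Contraction that is uniform in the parameter -/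

namespace Model

variable {k p q : ℕ} {F Θ : Type*} [MetricSpace F] [MeasurableSpace F] {M : Model k p q F Θ}
  {Ω : Type*} {X : ℤ → Ω → (Fin k → ℝ)} {E : M.LagMetric}

/-- Exponential contraction along the path `ω`, forward and backward from any time, uniformly
over `B`. -/
def Contracts (M : Model k p q F Θ) (X : ℤ → Ω → (Fin k → ℝ)) (E : M.LagMetric) (B : Set Θ)
    (ω : Ω) : Prop :=
  ∀ t : ℤ, (∃ C δ : ℝ, 0 < δ ∧ ∀ n : ℕ, M.LogLip X E B ω n (t + n) (C - δ * n)) ∧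
    ∃ C δ : ℝ, 0 < δ ∧ ∀ n : ℕ, M.LogLip X E B ω n t (C - δ * n)

theorem LogLip.union {ω : Ω} {A B : Set Θ} {n : ℕ} {t : ℤ} {a : ℝ} (hA : M.LogLip X E A ω n t a)
    (hB : M.LogLip X E B ω n t a) : M.LogLip X E (A ∪ B) ω n t a :=
  fun θ hθ => hθ.elim (hA θ) (hB θ)

theorem Contracts.union {A B : Set Θ} {ω : Ω} (hA : M.Contracts X E A ω)
    (hB : M.Contracts X E B ω) : M.Contracts X E (A ∪ B) ω := by
  have hle : ∀ C C' δ δ' : ℝ, ∀ n : ℕ, C - δ * n ≤ max C C' - min δ δ' * n ∧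
      C' - δ' * n ≤ max C C' - min δ δ' * n := fun C C' δ δ' n => by
    have h0 : (0 : ℝ) ≤ n := n.cast_nonneg
    exact ⟨sub_le_sub (le_max_left _ _) (mul_le_mul_of_nonneg_right (min_le_left _ _) h0),
      sub_le_sub (le_max_right _ _) (mul_le_mul_of_nonneg_right (min_le_right _ _) h0)⟩
  intro t
  obtain ⟨⟨C₁, δ₁, hδ₁, h₁⟩, ⟨C₂, δ₂, hδ₂, h₂⟩⟩ := hA t
  obtain ⟨⟨C₃, δ₃, hδ₃, h₃⟩, ⟨C₄, δ₄, hδ₄, h₄⟩⟩ := hB t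
  exact ⟨⟨max C₁ C₃, min δ₁ δ₃, lt_min hδ₁ hδ₃, fun n => ((h₁ n).mono (hle _ _ _ _ n).1).union
      ((h₃ n).mono (hle _ _ _ _ n).2)⟩,
    ⟨max C₂ C₄, min δ₂ δ₄, lt_min hδ₂ hδ₄, fun n => ((h₂ n).mono (hle _ _ _ _ n).1).union
      ((h₄ n).mono (hle _ _ _ _ n).2)⟩⟩

theorem contracts_empty (ω : Ω) : M.Contracts X E ∅ ω := fun _ =>
  ⟨⟨0, 1, one_pos, fun _ _ hθ => hθ.elim⟩, ⟨0, 1, one_pos, fun _ _ hθ => hθ.elim⟩⟩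

theorem Contracts.subset {A B : Set Θ} {ω : Ω} (hB : M.Contracts X E B ω) (h : A ⊆ B) :
    M.Contracts X E A ω := fun t => by
  obtain ⟨⟨C₁, δ₁, hδ₁, h₁⟩, ⟨C₂, δ₂, hδ₂, h₂⟩⟩ := hB t
  exact ⟨⟨C₁, δ₁, hδ₁, fun n θ hθ => h₁ n θ (h hθ)⟩, ⟨C₂, δ₂, hδ₂, fun n θ hθ => h₂ n θ (h hθ)⟩⟩

section Topological

variable [TopologicalSpace Θ]

theorem PathRegular.lipSup_ne_top {ω : Ω} (h : M.PathRegular X E ω) (D : Set Θ)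
    (D' : Set (Fin p → M.State)) (n : ℕ) (t : ℤ) : M.lipSup X E D D' n t ω ≠ ⊤ := by
  obtain ⟨a, ha⟩ := h.exists_logLip D n t
  exact ne_top_of_le_ne_top ENNReal.ofReal_ne_top (lipSup_le (Real.exp_nonneg a) ha)

variable [TopologicalSpace.SeparableSpace F] [BorelSpace F]
  [MeasurableSpace Ω] {P : Measure Ω} [IsProbabilityMeasure P]

/-- The input of `exists_exponential_decay` consists of the costs `b` of blocks of length `r`, with
negative mean, and of the penalties `c K`, which vanish unless some short composition in the block
has a coefficient above `exp K`. Short compositions have finite coefficients, so the mean of `c K`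
tends to `0`. -/
theorem ae_contracts_of_integral_neg (hX : IsStationaryErgodic P X)
    (hreg : ∀ᵐ ω ∂P, M.PathRegular X E ω) {B D : Set Θ} (hB : IsOpen B) (hD : Dense D)
    (hDc : D.Countable) {D' : Set (Fin p → M.State)} (hD' : Dense D') (hDc' : D'.Countable)
    {r : ℕ} (hr : 1 ≤ r) {m : ℝ}
    (hint : Integrable (fun ω => truncLog m (M.lipSup X E (B ∩ D) D' r 0 ω).toReal) P)
    (hneg : ∫ ω, truncLog m (M.lipSup X E (B ∩ D) D' r 0 ω).toReal ∂P < 0) :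
    ∀ᵐ ω ∂P, M.Contracts X E B ω := by
  have hc := fun n => causal_lipSup (E := E) hX hreg (hDc.mono Set.inter_subset_right) hDc' n
    (D := B ∩ D)
  let S : ℕ → ℤ → Ω → ENNReal := M.lipSup X E (B ∩ D) D'
  let b : ℤ → Ω → ℝ := fun t ω => truncLog m (S r t ω).toReal
  have hb : Causal P X b :=
    (hc r).comp ((continuous_truncLog m).measurable.comp ENNReal.measurable_toReal)
  -- The `j` most recent maps of the block that ends at `t`, needed forward in time, and its `j`
  -- oldest maps, needed when time is reversed.
  let Q : ℤ → Ω → ENNReal := fun t ω => ⨆ j : Fin r, max (S j t ω) (S j (t - (r - j : ℕ)) ω)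
  have hQ : Causal P X Q := Causal.iSup fun j : Fin r =>
    ((hc j).prodMk ((hc j).lag (r - j))).comp (measurable_fst.max measurable_snd)
  let c : ℕ → ℤ → Ω → ℝ := fun K t ω =>
    if Q t ω ≤ ENNReal.ofReal (Real.exp K) then 0 else |b t ω| + 1
  have hcc : ∀ K, Causal P X (c K) := fun K => (hQ.prodMk hb).comp
    (g := fun z : ENNReal × ℝ => if z.1 ≤ ENNReal.ofReal (Real.exp K) then 0 else |z.2| + 1)
    (Measurable.ite (measurableSet_le measurable_fst measurable_const) measurable_const
      ((continuous_abs.measurable.comp measurable_snd).add_const 1))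
  have hdom : Integrable (fun ω => |b 0 ω| + 1) P := hint.abs.add (integrable_const 1)
  have hcle : ∀ K ω, ‖c K 0 ω‖ ≤ |b 0 ω| + 1 := fun K ω => by
    have : 0 ≤ |b 0 ω| + 1 := by positivity
    simp only [c]
    split_ifs
    · simpa using this
    · rw [Real.norm_of_nonneg this]
  have hcint : ∀ K, Integrable (c K 0) P := fun K =>
    hdom.mono' ((hcc K).aemeasurable hX 0).aestronglyMeasurable (.of_forall (hcle K))
  have hlim : Tendsto (fun K => ∫ ω, c K 0 ω ∂P) atTop (𝓝 (∫ _, (0 : ℝ) ∂P)) := by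
    refine tendsto_integral_of_dominated_convergence _
      (fun K => ((hcc K).aemeasurable hX 0).aestronglyMeasurable) hdom
      (fun K => .of_forall (hcle K)) ?_
    filter_upwards [hreg] with ω hω
    have hQtop : Q 0 ω ≠ ⊤ := by
      refine (iSup_lt_iff.2 ?_).ne
      refine ⟨∑ j : Fin r, max (S j 0 ω) (S j (0 - (r - j : ℕ)) ω), ?_, fun j => ?_⟩
      · exact ENNReal.sum_lt_top.2 fun j _ => max_lt (hω.lipSup_ne_top _ _ _ _).lt_top
          (hω.lipSup_ne_top _ _ _ _).lt_top
      · exact Finset.single_le_sum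
          (f := fun j : Fin r => max (S j 0 ω) (S j (0 - (r - j : ℕ)) ω))
          (fun _ _ => zero_le) (Finset.mem_univ j)
    obtain ⟨K, hK⟩ := exists_nat_ge (Q 0 ω).toReal
    refine tendsto_const_nhds.congr' ?_
    filter_upwards [eventually_ge_atTop K] with K' hK'
    refine (if_pos ?_).symm
    rw [ENNReal.le_ofReal_iff_toReal_le hQtop (Real.exp_nonneg _)]
    have : (K : ℝ) ≤ K' := by exact_mod_cast hK'
    linarith [Real.add_one_le_exp (K' : ℝ)]
  rw [integral_zero] at hlim
  obtain ⟨β, hβ, hβ'⟩ : ∃ β : ℝ, 0 < β ∧ ∫ ω, b 0 ω ∂P < -β :=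
    ⟨-(∫ ω, b 0 ω ∂P) / 2, by change _ < (0 : ℝ) at hneg; linarith, by
      change _ < (0 : ℝ) at hneg; linarith⟩
  have hr0 : (0 : ℝ) < r := by exact_mod_cast hr
  obtain ⟨ε, hε0, hε⟩ : ∃ ε : ℝ, 0 < ε ∧ ε * (1 + β) < β / r := by
    refine ⟨β / r / (2 * (1 + β)), by positivity, ?_⟩
    have : β / r / (2 * (1 + β)) * (1 + β) = β / r / 2 := by field_simp
    rw [this]
    exact half_lt_self (by positivity)
  obtain ⟨K, hK⟩ := (hlim.eventually (gt_mem_nhds hε0)).exists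
  filter_upwards [hreg, hb.ae_sum_le hX hint hβ', (hcc K).ae_sum_le hX (hcint K) hK]
    with ω hω hbω hcω
  have hstep : ∀ t, M.LogLip X E B ω r t (b t ω) := fun t => by
    refine logLip_of_lipSup_le hω hB hD hD' ?_
    rw [exp_truncLog, ← ENNReal.ofReal_toReal (hω.lipSup_ne_top _ _ _ _)]
    exact ENNReal.ofReal_le_ofReal (le_max_left _ _)
  have hc0 : ∀ t, 0 ≤ c K t ω := fun t => by
    simp only [c]
    split_ifs
    · exact le_rfl
    · positivity
  have hgood : ∀ t, (∀ j < r, M.LogLip X E B ω j t K ∧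
      M.LogLip X E B ω j (t - (r - j : ℕ)) K) ∨ |b t ω| + 1 ≤ c K t ω := fun t => by
    by_cases h : Q t ω ≤ ENNReal.ofReal (Real.exp K)
    · left
      intro j hj
      have h1 := (iSup_le_iff.1 h) ⟨j, hj⟩
      exact ⟨logLip_of_lipSup_le hω hB hD hD' ((le_max_left _ _).trans h1),
        logLip_of_lipSup_le hω hB hD hD' ((le_max_right _ _).trans h1)⟩
    · right
      simp only [c, if_neg h, le_refl]
  intro t
  constructor
  -- Forward: `R s u` concerns the maps at times `t + s + 1, …, t + u`. The block from `s` to `s +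
  -- r` ends at `t + r + s`, whence the shift by `r`.
  · obtain ⟨C₁, hC₁⟩ := (hbω (t + r)).1
    obtain ⟨C₂, hC₂⟩ := (hcω (t + r)).1
    have key := exists_exponential_decay
      (R := fun s u a => M.LogLip X E B ω (u - s) (t + u) a) (b := fun s => b (t + r + s) ω)
      (c := fun s => c K (t + r + s) ω) hr (κ := K) ?_ ?_ ?_ ?_ ?_ ?_ ?_ hβ hC₁ hC₂ hε
    · simpa using key
    · intro s u v x y hsu huv h1 h2
      have e1 : v - s = (v - u) + (u - s) := by omega
      have e2 : t + u = t + v - (v - u : ℕ) := by push_cast [huv]; ring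
      rw [e1]
      rw [e2] at h1
      exact h2.comp h1
    · exact fun s u x y hxy h => h.mono hxy
    · intro s
      simpa using LogLip.zero (B := B) (t + s)
    · intro s
      have := hstep (t + r + s)
      rw [Nat.add_sub_cancel_left]
      convert this using 1
      push_cast; ring
    · exact fun s => hc0 _
    · intro s
      refine (hgood (t + r + s)).imp_left fun h j hj => ?_
      have := (h j hj).1
      convert this using 1
      · omega
      · push_cast; ring
    · exact fun s => hω.exists_logLip B _ _
  -- Backward: `R s u` concerns the maps at times `t - s, …, t - u + 1`, so a later segment is
  -- composed on the inside.
  · obtain ⟨C₁, hC₁⟩ := (hbω t).2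
    obtain ⟨C₂, hC₂⟩ := (hcω t).2
    have key := exists_exponential_decay
      (R := fun s u a => M.LogLip X E B ω (u - s) (t - s) a) (b := fun s => b (t - s) ω)
      (c := fun s => c K (t - s) ω) hr (κ := K) ?_ ?_ ?_ ?_ ?_ ?_ ?_ hβ hC₁ hC₂ hε
    · simpa using key
    · intro s u v x y hsu huv h1 h2
      have e1 : v - s = (u - s) + (v - u) := by omega
      have e2 : t - u = t - s - (u - s : ℕ) := by push_cast [hsu]; ring
      rw [e1, add_comm x]
      rw [e2] at h2
      exact h1.comp h2
    · exact fun s u x y hxy h => h.mono hxy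
    · intro s
      simpa using LogLip.zero (B := B) (t - s)
    · intro s
      rw [Nat.add_sub_cancel_left]
      exact hstep (t - s)
    · exact fun s => hc0 _
    · intro s
      refine (hgood (t - s)).imp_left fun h j hj => ?_
      have := (h j hj).2
      convert this using 1
      · omega
      · push_cast [hj.le, (by omega : j ≤ s + r)]; ring
    · exact fun s => hω.exists_logLip B _ _

end Topological

section Metric

variable {Θ : Type*} [MetricSpace Θ] [CompactSpace Θ] {M : Model k p q F Θ} {E : M.LagMetric}
  [TopologicalSpace.SeparableSpace F] [BorelSpace F]
  [MeasurableSpace Ω] {P : Measure Ω} [IsProbabilityMeasure P]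

/-- As the ball shrinks to `θ`, the truncated logarithm of the supremum decreases to a limit at most
that of `L 0 ω θ`, because `L 0 ω` is continuous. Dominated convergence then passes the negative
mean from `θ` to a ball; the domination comes from the truncation below and the integrable supremum
of `log⁺` above. -/
theorem exists_ball_integral_neg (hX : IsStationaryErgodic P X)
    (hreg : ∀ᵐ ω ∂P, M.PathRegular X E ω) {D : Set Θ}
    (hDc : D.Countable) {D' : Set (Fin p → M.State)} (hDc' : D'.Countable)
    {r : ℕ} {L : ℤ → Ω → Θ → ℝ} (hL : M.HasLipschitzCoeff P E (M.phiIter X r) L)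
    (hneg : ∀ θ, extExpectation P (fun ω => extLog (L 0 ω θ)) < 0)
    (hfin : ∫⁻ ω, ⨆ θ, ENNReal.ofReal (Real.posLog (L 0 ω θ)) ∂P < ⊤) (θ : Θ) :
    ∃ B : Set Θ, IsOpen B ∧ θ ∈ B ∧ ∃ m : ℝ,
      Integrable (fun ω => truncLog m (M.lipSup X E (B ∩ D) D' r 0 ω).toReal) P ∧
      ∫ ω, truncLog m (M.lipSup X E (B ∩ D) D' r 0 ω).toReal ∂P < 0 := by
  have hLm : Measurable fun ω => L 0 ω θ :=
    (measurable_pi_apply θ).comp (hL.stationary.measurable 0)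
  obtain ⟨m, hmint, hmneg⟩ := exists_integral_truncLog_neg hLm (fun ω => hL.nonneg 0 ω θ)
    ((lintegral_mono fun ω => le_iSup (fun θ => ENNReal.ofReal (Real.posLog (L 0 ω θ))) θ).trans_lt
      hfin) (hneg θ)
  let B : ℕ → Set Θ := fun n => Metric.ball θ (1 / (n + 1))
  have hθB : ∀ n, θ ∈ B n := fun n => Metric.mem_ball_self Nat.one_div_pos_of_nat
  have hBanti : Antitone B := fun a b hab => Metric.ball_subset_ball (Nat.one_div_le_one_div hab)
  let b : ℕ → Ω → ℝ := fun n ω => truncLog m (M.lipSup X E (B n ∩ D) D' r 0 ω).toReal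
  have hbm : ∀ n, AEMeasurable (b n) P := fun n =>
    ((causal_lipSup hX hreg (hDc.mono Set.inter_subset_right) hDc' r).comp
      ((continuous_truncLog m).measurable.comp ENNReal.measurable_toReal)).aemeasurable hX 0
  -- comparison with the maximum of the Lipschitz coefficient over a ball
  have hmax : ∀ ω, ∃ u : ℕ → Θ, ∀ n : ℕ, u n ∈ Metric.closedBall θ (1 / ((n : ℝ) + 1)) ∧
      ∀ θ' ∈ B n, L 0 ω θ' ≤ L 0 ω (u n) := fun ω => by
    have h : ∀ n : ℕ, ∃ v ∈ Metric.closedBall θ (1 / ((n : ℝ) + 1)),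
        IsMaxOn (L 0 ω) (Metric.closedBall θ (1 / ((n : ℝ) + 1))) v := fun n =>
      (Metric.isClosed_closedBall.isCompact).exists_isMaxOn
        ⟨θ, Metric.mem_closedBall_self Nat.one_div_pos_of_nat.le⟩ (hL.continuous 0 ω).continuousOn
    choose u hu hu' using h
    exact ⟨u, fun n => ⟨hu n, fun θ' hθ' => hu' n (Metric.ball_subset_closedBall hθ')⟩⟩
  have hble : ∀ᵐ ω ∂P, ∀ n θ', (∀ θ'' ∈ B n, L 0 ω θ'' ≤ L 0 ω θ') →
      (M.lipSup X E (B n ∩ D) D' r 0 ω).toReal ≤ L 0 ω θ' := by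
    filter_upwards [hL.lipschitz] with ω hω n θ' hθ'
    refine ENNReal.toReal_le_of_le_ofReal (hL.nonneg 0 ω θ') (lipSup_le (hL.nonneg 0 ω θ') ?_)
    exact fun θ'' hθ'' x y => (hω 0 θ'' x y).trans
      (mul_le_mul_of_nonneg_right (hθ' θ'' hθ''.1) (E.nonneg _ _))
  have hanti : ∀ᵐ ω ∂P, Antitone fun n => b n ω := by
    filter_upwards [hreg] with ω hω i j hij
    exact truncLog_mono _ (ENNReal.toReal_mono (hω.lipSup_ne_top _ _ _ _)
      (lipSup_mono (Set.inter_subset_inter_left _ (hBanti hij))))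
  have hm0 : (0 : ℝ) ≤ m := m.cast_nonneg
  have hlow : ∀ n ω, -(m : ℝ) ≤ b n ω := fun n ω => neg_le_truncLog _ _
  have hpos0 : Integrable (fun ω => max (b 0 ω) 0) P := by
    have hmeas : AEMeasurable (fun ω => max (b 0 ω) 0) P := (hbm 0).max aemeasurable_const
    refine (lintegral_ofReal_ne_top_iff_integrable hmeas.aestronglyMeasurable
      (.of_forall fun ω => le_max_right _ _)).1 (ne_top_of_le_ne_top hfin.ne (lintegral_mono_ae ?_))
    filter_upwards [hble] with ω hω
    obtain ⟨u, hu⟩ := hmax ω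
    refine le_trans ?_ (le_iSup _ (u 0))
    refine ENNReal.ofReal_le_ofReal (max_le ?_ Real.posLog_nonneg)
    exact (truncLog_mono _ (hω 0 (u 0) (hu 0).2)).trans
      (truncLog_le_posLog hm0 (hL.nonneg 0 ω _))
  have hdom : Integrable (fun ω => max (b 0 ω) 0 + m) P := hpos0.add (integrable_const _)
  have hbound : ∀ n, ∀ᵐ ω ∂P, ‖b n ω‖ ≤ max (b 0 ω) 0 + m := fun n => by
    filter_upwards [hanti] with ω hω
    have h1 : b n ω ≤ b 0 ω := hω n.zero_le
    rw [Real.norm_eq_abs, abs_le]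
    constructor
    · linarith [hlow n ω, le_max_right (b 0 ω) 0]
    · linarith [le_max_left (b 0 ω) 0]
  have hbint : ∀ n, Integrable (b n) P := fun n =>
    hdom.mono' (hbm n).aestronglyMeasurable (hbound n)
  have htend : ∀ᵐ ω ∂P, Tendsto (fun n => b n ω) atTop (𝓝 (⨅ n, b n ω)) := by
    filter_upwards [hanti] with ω hω
    exact tendsto_atTop_ciInf hω ⟨-m, by rintro _ ⟨n, rfl⟩; exact hlow n ω⟩
  have hlimle : ∀ᵐ ω ∂P, ⨅ n, b n ω ≤ truncLog m (L 0 ω θ) := by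
    filter_upwards [htend, hble] with ω h1 h2
    obtain ⟨u, hu⟩ := hmax ω
    have h3 : Tendsto u atTop (𝓝 θ) := by
      rw [tendsto_iff_dist_tendsto_zero]
      exact squeeze_zero (fun _ => dist_nonneg) (fun n => (hu n).1)
        tendsto_one_div_add_atTop_nhds_zero_nat
    have h4 := (((continuous_truncLog m).comp (hL.continuous 0 ω)).tendsto θ).comp h3
    exact le_of_tendsto_of_tendsto' h1 h4 fun n => truncLog_mono _ (h2 n (u n) (hu n).2)
  have hconv := tendsto_integral_of_dominated_convergence _
    (fun n => (hbm n).aestronglyMeasurable) hdom hbound htend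
  have hinfint : Integrable (fun ω => ⨅ n, b n ω) P := by
    refine hdom.mono' (aestronglyMeasurable_of_tendsto_ae atTop
      (fun n => (hbm n).aestronglyMeasurable) htend) ?_
    filter_upwards [htend, ae_all_iff.2 hbound] with ω h1 h2
    exact le_of_tendsto' h1.norm h2
  have hlt : ∫ ω, ⨅ n, b n ω ∂P < 0 := (integral_mono_ae hinfint hmint hlimle).trans_lt hmneg
  obtain ⟨n, hn⟩ := (hconv.eventually (gt_mem_nhds hlt)).exists
  exact ⟨B n, Metric.isOpen_ball, hθB n, m, hbint n, hn⟩

/-- Almost sure contraction over a set passes to subsets and finite unions, so the local statement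
spreads over the compact space `Θ`. -/
theorem CI.ae_contracts (hX : IsStationaryErgodic P X) (hCI : M.CI P X E) :
    ∀ᵐ ω ∂P, M.Contracts X E Set.univ ω := by
  have : SecondCountableTopology F := UniformSpace.secondCountable_of_separable F
  have hreg := hCI.ae_pathRegular
  obtain ⟨D, hDc, hD⟩ := TopologicalSpace.exists_countable_dense Θ
  obtain ⟨D', hDc', hD'⟩ := TopologicalSpace.exists_countable_dense (Fin p → M.State)
  obtain ⟨r, hr, L, hL, hneg, hfin⟩ := hCI.lyapunov
  refine isCompact_univ.induction_on (p := fun B => ∀ᵐ ω ∂P, M.Contracts X E B ω)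
    (.of_forall contracts_empty) (fun A B hAB hB => ?_) (fun A B hA hB => ?_) fun θ _ => ?_
  · filter_upwards [hB] with ω h using h.subset hAB
  · filter_upwards [hA, hB] with ω h h' using h.union h'
  · obtain ⟨B, hB, hθ, m, h1, h2⟩ :=
      exists_ball_integral_neg hX hreg hDc hDc' hL hneg hfin θ
    exact ⟨B, mem_nhdsWithin_of_mem_nhds (hB.mem_nhds hθ),
      ae_contracts_of_integral_neg hX hreg hB hD hDc hD' hDc' hr h1 h2⟩

end Metric

end Model

/-! ### The stationary solution -/

theorem le_exp_posLog {x : ℝ} (hx : 0 ≤ x) : x ≤ Real.exp (Real.posLog x) := by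
  rcases hx.eq_or_lt with rfl | h
  · exact (Real.exp_pos _).le
  · calc x = Real.exp (Real.log x) := (Real.exp_log h).symm
      _ ≤ _ := Real.exp_le_exp.2 (le_max_right _ _)

theorem exists_dist_le_geometric {T S : Type*} [MetricSpace S] [CompleteSpace S] (u : ℕ → T → S)
    {A δ : ℝ} (hδ : 0 < δ) (h : ∀ n θ, dist (u n θ) (u (n + 1) θ) ≤ A * Real.exp (-δ) ^ n) :
    ∃ g : T → S, TendstoUniformly u g atTop := by
  have hr : Real.exp (-δ) < 1 := Real.exp_lt_one_iff.2 (by linarith)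
  have hc : ∀ θ, CauchySeq fun n => u n θ := fun θ =>
    cauchySeq_of_le_geometric _ A hr fun n => h n θ
  choose g hg using fun θ => cauchySeq_tendsto_of_complete (hc θ)
  refine ⟨g, Metric.tendstoUniformly_iff.2 fun ε hε => ?_⟩
  have h0 : Tendsto (fun n => A * Real.exp (-δ) ^ n / (1 - Real.exp (-δ))) atTop (𝓝 0) := by
    have := ((tendsto_pow_atTop_nhds_zero_of_lt_one (Real.exp_pos _).le hr).const_mul A).div_const
      (1 - Real.exp (-δ))
    simpa using this
  filter_upwards [h0.eventually (gt_mem_nhds hε)] with n hn θ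
  rw [dist_comm]
  exact (dist_le_of_le_geometric_of_tendsto _ A hr (fun n => h n θ) (hg θ) n).trans_lt hn

theorem isStationary_of_past {Ω S S' : Type*} [MeasurableSpace Ω] [MeasurableSpace S]
    [MeasurableSpace S'] {P : Measure Ω} {X : ℤ → Ω → S} (hX : IsStationaryErgodic P X)
    {G : (ℕ → S) → S'} (hG : Measurable G) : IsStationary P fun t ω => G (past X t ω) := by
  have hm : Measurable fun ω (t : ℤ) => X t ω := measurable_pi_lambda _ fun _ => hX.measurable _
  let Φ : (ℤ → S) → ℤ → S' := fun w t => G fun n => w (t - 1 - n)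
  have hΦ : Measurable Φ := measurable_pi_lambda _ fun t =>
    hG.comp (measurable_pi_lambda _ fun n => measurable_pi_apply _)
  have hshift : Measurable (shift (S := S')) := (shiftEquiv S').measurable
  have hlaw : pathLaw P (fun t ω => G (past X t ω)) = (pathLaw P X).map Φ := by
    rw [pathLaw, pathLaw, Measure.map_map hΦ hm]; rfl
  have hcomm : shift ∘ Φ = Φ ∘ shift := by
    funext w t
    simp only [Function.comp_apply, shift, Φ]
    congr 1
    funext n
    congr 1
    ring
  refine ⟨fun t => hG.comp (measurable_past hX.measurable t), hshift, ?_⟩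
  rw [hlaw, Measure.map_map hshift hΦ, hcomm, ← Measure.map_map hΦ hX.ergodic.measurable,
    hX.ergodic.toMeasurePreserving.map_eq]

namespace Model

section Path

variable {k p q : ℕ} {F Θ : Type*} [MetricSpace F] [MeasurableSpace F] {M : Model k p q F Θ}
  {Ω : Type*} {X : ℤ → Ω → (Fin k → ℝ)} {E : M.LagMetric}

/-- The limit of the backward iterations, started from `y`. -/
def backwardLimit (M : Model k p q F Θ) (X : ℤ → Ω → (Fin k → ℝ)) (y : Fin p → M.State) (t : ℤ)
    (ω : Ω) (θ : Θ) : Fin p → M.State :=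
  haveI : Nonempty (Fin p → M.State) := ⟨y⟩
  limUnder atTop fun n => M.phiIter X n t ω θ y

/-- The path `ω` is regular, contracting, and its random maps move `y` subexponentially. -/
structure Tame [TopologicalSpace Θ] (M : Model k p q F Θ) (X : ℤ → Ω → (Fin k → ℝ))
    (E : M.LagMetric) (y : Fin p → M.State) (ω : Ω) : Prop where
  regular : M.PathRegular X E ω
  contracts : M.Contracts X E Set.univ ω
  sublinear : ∀ t : ℤ, ∀ ε > 0, ∃ C, ∀ (n : ℕ) (θ : Θ),
    Real.posLog (E.d (M.phi X (t - n) ω θ y) y) ≤ ε * n + C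

variable [TopologicalSpace Θ] {y : Fin p → M.State} {ω : Ω}

/-- Consecutive iterates are images of `y` and `φ_{t-n}(y)` under the same `n` maps. These two
points are at distance at most `exp (δ n / 2 + C')`, and the contraction `exp (C - δ n)` leaves a
geometric series of ratio `exp (-δ / 2)`. -/
theorem Tame.exists_tendstoUniformly (h : M.Tame X E y ω) (t : ℤ) :
    ∃ g : Θ → (Fin p → M.State),
      TendstoUniformly (fun n θ => M.phiIter X n t ω θ y) g atTop := by
  have : CompleteSpace M.State := M.complete.completeSpace_coe
  obtain ⟨C, δ, hδ, hC⟩ := (h.contracts t).2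
  obtain ⟨C', hC'⟩ := h.sublinear t (δ / 2) (half_pos hδ)
  obtain ⟨c, hc0, hc⟩ := E.exists_dist_le
  refine exists_dist_le_geometric _ (A := c * Real.exp (C + C')) (half_pos hδ) fun n θ => ?_
  refine (hc _ _).trans ?_
  rw [mul_assoc]
  refine mul_le_mul_of_nonneg_left ?_ hc0.le
  rw [phiIter_add n 1]
  refine (hC n θ trivial _ _).trans ?_
  have h1 : E.d y (M.phiIter X 1 (t - n) ω θ y) ≤ Real.exp (δ / 2 * n + C') := by
    rw [E.comm]
    exact (le_exp_posLog (E.nonneg _ _)).trans (Real.exp_le_exp.2 (hC' n θ))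
  refine (mul_le_mul_of_nonneg_left h1 (Real.exp_pos _).le).trans_eq ?_
  rw [← Real.exp_nat_mul, ← Real.exp_add, ← Real.exp_add]
  ring_nf

theorem Tame.tendstoUniformly (h : M.Tame X E y ω) (t : ℤ) :
    TendstoUniformly (fun n θ => M.phiIter X n t ω θ y) (M.backwardLimit X y t ω) atTop := by
  obtain ⟨g, hg⟩ := h.exists_tendstoUniformly t
  have : M.backwardLimit X y t ω = g := funext fun θ => (hg.tendsto_at θ).limUnder_eq
  rwa [this]

theorem Tame.continuous_backwardLimit (h : M.Tame X E y ω) (t : ℤ) :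
    Continuous (M.backwardLimit X y t ω) :=
  (h.tendstoUniformly t).continuous (.of_forall fun n =>
    (h.regular.continuous_phiIter n t).comp (Continuous.prodMk_left y))

theorem Tame.backwardLimit_eq (h : M.Tame X E y ω) (t : ℤ) (θ : Θ) :
    M.backwardLimit X y t ω θ = M.phi X t ω θ (M.backwardLimit X y (t - 1) ω θ) := by
  have h1 := (((h.regular.continuous_phi t).comp (Continuous.prodMk_right θ)).tendsto _).comp
    ((h.tendstoUniformly (t - 1)).tendsto_at θ)
  exact tendsto_nhds_unique (((h.tendstoUniformly t).tendsto_at θ).comp (tendsto_add_atTop_nat 1)) h1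

theorem Tame.backwardLimit_eq_phiIter (h : M.Tame X E y ω) (n : ℕ) (t : ℤ) (θ : Θ) :
    M.backwardLimit X y t ω θ = M.phiIter X n t ω θ (M.backwardLimit X y (t - n) ω θ) := by
  induction n generalizing t with
  | zero => simp [phiIter]
  | succ n ih =>
    rw [h.backwardLimit_eq, phiIter, ih (t - 1)]
    congr 3
    push_cast; ring

variable [NeZero p]

/-- The stationary solution `g_t(θ)`. -/
def g (M : Model k p q F Θ) (X : ℤ → Ω → (Fin k → ℝ)) (y : Fin p → M.State) (t : ℤ)
    (ω : Ω) (θ : Θ) : M.State :=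
  M.backwardLimit X y t ω θ 0

theorem Tame.continuous_g (h : M.Tame X E y ω) (t : ℤ) : Continuous (M.g X y t ω) :=
  (continuous_apply 0).comp (h.continuous_backwardLimit t)

theorem Tame.backwardLimit_apply (h : M.Tame X E y ω) (t : ℤ) (θ : Θ) (i : Fin p) :
    M.backwardLimit X y t ω θ i = M.g X y (t - (i : ℤ)) ω θ := by
  obtain ⟨i, hi⟩ := i
  induction i generalizing t with
  | zero => simp [g]
  | succ i ih =>
    rw [h.backwardLimit_eq, phi, step, if_neg (by simp)]
    rw [show (⟨(⟨i + 1, hi⟩ : Fin p).1 - 1, by omega⟩ : Fin p) = ⟨i, by omega⟩ from rfl, ih]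
    congr 1
    push_cast; ring

theorem Tame.g_eq (h : M.Tame X E y ω) (t : ℤ) (θ : Θ) :
    M.g X y t ω θ = M.f (lags X q t ω) (lags (fun t ω => M.g X y t ω θ) p t ω) θ := by
  rw [g, h.backwardLimit_eq, phi, step, if_pos (by simp)]
  congr 1
  funext i
  rw [h.backwardLimit_apply, lags]

/-- Both vectors are images under the same `n` maps, of `ζ` and of the stationary vector at time
`0`; the distance of these two is bounded in `θ` by continuity and compactness. -/
theorem Tame.exists_dist_gHat_le [CompactSpace Θ] (h : M.Tame X E y ω)
    {ζ : Ω → Θ → (Fin p → M.State)} (hζ : Continuous (ζ ω)) :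
    ∃ C δ : ℝ, 0 < δ ∧ ∀ (n : ℕ) θ,
      dist (M.gHat X ζ ω θ n) (M.g X y n ω θ) ≤ Real.exp (C - δ * n) := by
  obtain ⟨C, δ, hδ, hC⟩ := (h.contracts 0).1
  obtain ⟨c, hc0, hc⟩ := E.exists_dist_le
  obtain ⟨K, hK⟩ := (isCompact_range (E.continuous.comp
    (hζ.prodMk (h.continuous_backwardLimit 0)))).bddAbove
  refine ⟨Real.log (c * max K 1) + C, δ, hδ, fun n θ => ?_⟩
  have hpos : 0 < c * max K 1 := by positivity
  have h1 : dist (M.gHat X ζ ω θ n) (M.g X y n ω θ)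
      ≤ dist (M.fitted X ζ ω θ n) (M.backwardLimit X y n ω θ) := dist_le_pi_dist _ _ 0
  refine h1.trans ((hc _ _).trans ?_)
  rw [fitted_eq_phiIter, h.backwardLimit_eq_phiIter n, sub_self, add_sub_assoc, Real.exp_add,
    Real.exp_log hpos, mul_assoc]
  refine mul_le_mul_of_nonneg_left ?_ hc0.le
  have h2 := hC n θ trivial (ζ ω θ) (M.backwardLimit X y 0 ω θ)
  rw [zero_add] at h2
  refine h2.trans ?_
  rw [mul_comm]
  exact mul_le_mul_of_nonneg_right ((hK ⟨θ, rfl⟩).trans (le_max_left _ _)) (Real.exp_pos _).le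

end Path

/-! ### Almost sure existence and measurability of the stationary solution -/

section Stationary

variable {k p q : ℕ} {F Θ : Type*} [MetricSpace F] [MeasurableSpace F]
  [MetricSpace Θ] [CompactSpace Θ] {M : Model k p q F Θ}
  {Ω : Type*} {X : ℤ → Ω → (Fin k → ℝ)} {E : M.LagMetric}
  [TopologicalSpace.SeparableSpace F] [BorelSpace F]
  [MeasurableSpace Ω] {P : Measure Ω} [IsProbabilityMeasure P]

/-- A supremum over a countable dense set of parameters is a causal functional, so its growth is
sublinear; continuity in `θ` recovers the other parameters. -/
theorem CI.exists_ae_tame (hX : IsStationaryErgodic P X) (hCI : M.CI P X E) :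
    ∃ y : Fin p → M.State, ∀ᵐ ω ∂P, M.Tame X E y ω := by
  have : SecondCountableTopology F := UniformSpace.secondCountable_of_separable F
  obtain ⟨y, hy⟩ := hCI.logMoment
  have hreg := hCI.ae_pathRegular
  obtain ⟨D, hDc, hD⟩ := TopologicalSpace.exists_countable_dense Θ
  have := hDc.to_subtype
  have hd : Continuous fun x : Fin p → M.State => Real.posLog (E.d x y) :=
    Real.continuous_posLog.comp (E.continuous.comp (Continuous.prodMk_left y))
  have hcausal : Causal P X fun t ω =>
      ⨆ θ : D, ENNReal.ofReal (Real.posLog (E.d (M.phi X t ω θ y) y)) :=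
    Causal.iSup fun θ => (causal_phi hX hreg (θ : Θ) (.const y)).comp
      (g := fun x => ENNReal.ofReal (Real.posLog (E.d x y)))
      (ENNReal.measurable_ofReal.comp hd.measurable)
  have hfin := (lintegral_mono fun ω => iSup_le fun θ : D =>
    le_iSup (fun θ => ENNReal.ofReal (Real.posLog (E.d (M.phi X 0 ω θ y) y))) (θ : Θ)).trans_lt hy
  refine ⟨y, ?_⟩
  filter_upwards [hreg, hCI.ae_contracts hX, hcausal.ae_sublinear_ennreal hX hfin]
    with ω h1 h2 h3
  refine ⟨h1, h2, fun t ε hε => ?_⟩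
  obtain ⟨C, hC⟩ := (h3 t ε hε).2
  refine ⟨|C|, fun n θ => ?_⟩
  have hnn : 0 ≤ ε * n + |C| := by positivity
  have hcl : IsClosed {θ | Real.posLog (E.d (M.phi X (t - n) ω θ y) y) ≤ ε * n + |C|} :=
    isClosed_le (hd.comp (h1.continuous _ y)) continuous_const
  refine closure_minimal (fun θ hθ => ?_) hcl (hD θ)
  have h4 := (le_iSup (fun θ : D => ENNReal.ofReal (Real.posLog
    (E.d (M.phi X (t - n) ω θ y) y))) ⟨θ, hθ⟩).trans (hC n)
  have h5 := h4.trans (ENNReal.ofReal_le_ofReal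
    (add_le_add le_rfl (le_abs_self C) : ε * n + C ≤ ε * n + |C|))
  exact (ENNReal.ofReal_le_ofReal_iff hnn).1 h5

variable [NeZero p]

omit [CompactSpace Θ] [IsProbabilityMeasure P] in
theorem causal_g (hX : IsStationaryErgodic P X) {y : Fin p → M.State}
    (hy : ∀ᵐ ω ∂P, M.Tame X E y ω) (θ : Θ) : Causal P X fun t ω => M.g X y t ω θ := by
  have : SecondCountableTopology F := UniformSpace.secondCountable_of_separable F
  have h1 : Causal P X fun t ω => M.backwardLimit X y t ω θ :=
    Causal.of_tendsto hX (causal_phiIter hX (hy.mono fun _ h => h.regular) θ y) fun t => by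
      filter_upwards [hy] with ω h using (h.tendstoUniformly t).tendsto_at θ
  exact h1.comp (measurable_pi_apply 0)

-- Stationarity includes measurability at each time, which `g` may lack. The version `G (past X t)`
-- has it, inherits stationarity from `X`, and agrees with `g` at all times outside one null set.
omit [CompactSpace Θ] [IsProbabilityMeasure P] in
theorem exists_isStationarySolution (hX : IsStationaryErgodic P X) {y : Fin p → M.State}
    (hy : ∀ᵐ ω ∂P, M.Tame X E y ω) (θ : Θ) :
    ∃ Y, M.IsStationarySolution P X θ Y ∧ ∀ᵐ ω ∂P, ∀ t, Y t ω = M.g X y t ω θ := by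
  obtain ⟨G, hG, hgG⟩ := causal_g hX hy θ
  have hall := ae_all_iff.2 hgG
  refine ⟨fun t ω => G (past X t ω), ⟨isStationary_of_past hX hG, ?_⟩, ?_⟩
  · filter_upwards [hall, hy] with ω h1 h2 t
    have e : lags (fun t ω => G (past X t ω)) p t ω = lags (fun t ω => M.g X y t ω θ) p t ω :=
      funext fun i => (h1 _).symm
    rw [e, ← h2.g_eq, h1]
  · filter_upwards [hall] with ω h1 t
    exact (h1 t).symm

end Stationary

end Model

/-! ### The criterion along a path -/

theorem sum_Icc_one_eq_sum_range {A : Type*} [AddCommMonoid A] (f : ℕ → A) (n : ℕ) :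
    ∑ t ∈ Finset.Icc 1 n, f t = ∑ s ∈ Finset.range n, f (s + 1) := by
  induction n with
  | zero => simp
  | succ n ih => rw [Finset.sum_Icc_succ_top (by omega), ih, Finset.sum_range_succ]

namespace Model

section Loss

variable {k p q : ℕ} {F Θ : Type*} [MetricSpace F] [MeasurableSpace F] [TopologicalSpace Θ]
  {M : Model k p q F Θ}
  {Ω : Type*} [MeasurableSpace Ω] {P : Measure Ω} {X : ℤ → Ω → (Fin k → ℝ)}

omit [TopologicalSpace Θ] in
theorem loss_eq (x : Fin k → ℝ) (y : M.State) :
    M.loss x y = 2⁻¹ * (∑ i, ∑ j, x i * ((M.link y)⁻¹ i j * x j) + Real.log (M.link y).det) := by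
  simp only [loss, dotProduct, Matrix.mulVec, Finset.mul_sum]

omit [TopologicalSpace Θ] in
theorem posSemidef_link (y : M.State) : (M.link y).PosSemidef :=
  M.posSemidef _ (Subtype.prop _)

omit [TopologicalSpace Θ] in
theorem log_det_le_loss (x : Fin k → ℝ) (y : M.State) :
    2⁻¹ * Real.log (M.link y).det ≤ M.loss x y := by
  have h := (posSemidef_link y).inv.dotProduct_mulVec_nonneg x
  rw [loss]
  simp only [star_trivial] at h
  linarith

theorem IV.continuous_inv (h : M.IV P X) (i j : Fin k) :
    Continuous fun y => (M.link y)⁻¹ i j := by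
  obtain ⟨K, hK⟩ := h.inv_lipschitz
  exact (hK i j).continuous

theorem IV.continuous_logDet (h : M.IV P X) : Continuous fun y => Real.log (M.link y).det := by
  obtain ⟨K, hK⟩ := h.logDet_lipschitz
  exact hK.continuous

theorem IV.continuous_loss (h : M.IV P X) :
    Continuous fun z : (Fin k → ℝ) × M.State => M.loss z.1 z.2 := by
  simp only [loss_eq]
  refine continuous_const.mul (Continuous.add ?_ (h.continuous_logDet.comp continuous_snd))
  refine continuous_finsetSum _ fun i _ => continuous_finsetSum _ fun j _ => ?_
  have h1 := (h.continuous_inv i j).comp (continuous_snd (X := Fin k → ℝ))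
  have hi : Continuous fun z : (Fin k → ℝ) × M.State => z.1 i :=
    (continuous_apply i).comp continuous_fst
  have hj : Continuous fun z : (Fin k → ℝ) × M.State => z.1 j :=
    (continuous_apply j).comp continuous_fst
  exact hi.mul (h1.mul hj)

theorem IV.exists_loss_lipschitz (h : M.IV P X) :
    ∃ K : ℝ, 0 ≤ K ∧ ∀ x y y', |M.loss x y - M.loss x y'| ≤ K * (1 + ‖x‖ ^ 2) * dist y y' := by
  obtain ⟨K₁, hK₁⟩ := h.inv_lipschitz
  obtain ⟨K₂, hK₂⟩ := h.logDet_lipschitz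
  refine ⟨k * (k * K₁) + K₂, by positivity, fun x y y' => ?_⟩
  have hij : ∀ i j, |x i * ((M.link y)⁻¹ i j * x j) - x i * ((M.link y')⁻¹ i j * x j)|
      ≤ K₁ * ‖x‖ ^ 2 * dist y y' := fun i j => by
    have e : x i * ((M.link y)⁻¹ i j * x j) - x i * ((M.link y')⁻¹ i j * x j)
        = x i * x j * ((M.link y)⁻¹ i j - (M.link y')⁻¹ i j) := by ring
    have h1 : |x i| ≤ ‖x‖ := norm_le_pi_norm x i
    have h2 : |x j| ≤ ‖x‖ := norm_le_pi_norm x j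
    have h3 : |(M.link y)⁻¹ i j - (M.link y')⁻¹ i j| ≤ K₁ * dist y y' := (hK₁ i j).dist_le_mul y y'
    rw [e, abs_mul, abs_mul]
    calc |x i| * |x j| * |(M.link y)⁻¹ i j - (M.link y')⁻¹ i j|
        ≤ ‖x‖ * ‖x‖ * (K₁ * dist y y') := by gcongr
      _ = _ := by ring
  have hsum : |∑ i, ∑ j, x i * ((M.link y)⁻¹ i j * x j)
      - ∑ i, ∑ j, x i * ((M.link y')⁻¹ i j * x j)| ≤ k * (k * (K₁ * ‖x‖ ^ 2 * dist y y')) := by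
    rw [← Finset.sum_sub_distrib]
    refine (Finset.abs_sum_le_sum_abs _ _).trans ?_
    refine (Finset.sum_le_card_nsmul _ _ (k * (K₁ * ‖x‖ ^ 2 * dist y y')) fun i _ => ?_).trans_eq
      (by simp)
    rw [← Finset.sum_sub_distrib]
    refine (Finset.abs_sum_le_sum_abs _ _).trans ?_
    exact (Finset.sum_le_card_nsmul _ _ _ fun j _ => hij i j).trans_eq (by simp)
  have hdet : |Real.log (M.link y).det - Real.log (M.link y').det| ≤ K₂ * dist y y' :=
    hK₂.dist_le_mul y y'
  rw [loss_eq, loss_eq, ← mul_sub, abs_mul, abs_of_nonneg (by norm_num : (0 : ℝ) ≤ 2⁻¹),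
    add_sub_add_comm]
  have h4 := abs_add_le (∑ i, ∑ j, x i * ((M.link y)⁻¹ i j * x j)
      - ∑ i, ∑ j, x i * ((M.link y')⁻¹ i j * x j))
      (Real.log (M.link y).det - Real.log (M.link y').det)
  have hd : 0 ≤ dist y y' := dist_nonneg
  have h5 : 0 ≤ (k : ℝ) * (k * K₁) * dist y y' := by positivity
  have h6 : 0 ≤ (K₂ : ℝ) * ‖x‖ ^ 2 * dist y y' := by positivity
  have h7 := abs_nonneg (∑ i, ∑ j, x i * ((M.link y)⁻¹ i j * x j)
      - ∑ i, ∑ j, x i * ((M.link y')⁻¹ i j * x j) +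
      (Real.log (M.link y).det - Real.log (M.link y').det))
  nlinarith

variable [CompactSpace Θ] [NeZero p] {E : M.LagMetric} {y : Fin p → M.State} {ω : Ω}

/-- The criterion based on the forecasts and that based on the stationary solution differ by a
bounded amount. -/
theorem Tame.exists_sum_loss_sub_le (h : M.Tame X E y ω) (hIV : M.IV P X)
    {ζ : Ω → Θ → (Fin p → M.State)} (hζ : Continuous (ζ ω))
    (hXω : ∀ ε > 0, ∃ C, ∀ n : ℕ, Real.posLog ‖X (n : ℤ) ω‖ ≤ ε * n + C) :
    ∃ U, ∀ (n : ℕ) θ, |∑ t ∈ Finset.Icc 1 n, M.loss (X (t : ℤ) ω) (M.gHat X ζ ω θ t)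
      - ∑ t ∈ Finset.Icc 1 n, M.loss (X (t : ℤ) ω) (M.g X y t ω θ)| ≤ U := by
  obtain ⟨C, δ, hδ, hC⟩ := h.exists_dist_gHat_le hζ
  obtain ⟨K, hK0, hK⟩ := hIV.exists_loss_lipschitz
  -- With `δ / 4`, the factor `‖X_n‖ ^ 2` grows at most like `exp (δ n / 2)`, half the decay rate of
  -- the forecast error, and the differences are dominated by a geometric series.
  obtain ⟨C', hC'⟩ := hXω (δ / 4) (by positivity)
  have hr : Real.exp (-(δ / 2)) < 1 := Real.exp_lt_one_iff.2 (by linarith)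
  let A := K * 2 * Real.exp (2 * C' + C)
  have hA : 0 ≤ A := by positivity
  have hterm : ∀ (n : ℕ) θ, |M.loss (X (n : ℤ) ω) (M.gHat X ζ ω θ n)
      - M.loss (X (n : ℤ) ω) (M.g X y n ω θ)| ≤ A * Real.exp (-(δ / 2)) ^ n := fun n θ => by
    have h1 : 1 + ‖X (n : ℤ) ω‖ ^ 2 ≤ 2 * Real.exp (2 * (δ / 4 * n + C')) := by
      have h2 := (le_exp_posLog (norm_nonneg (X (n : ℤ) ω))).trans (Real.exp_le_exp.2 (hC' n))
      have h3 : 1 ≤ Real.exp (δ / 4 * n + C') :=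
        Real.one_le_exp (Real.posLog_nonneg.trans (hC' n))
      have h4 : Real.exp (2 * (δ / 4 * n + C')) = Real.exp (δ / 4 * n + C') ^ 2 := by
        rw [← Real.exp_nat_mul]; norm_num
      rw [h4]
      nlinarith [norm_nonneg (X (n : ℤ) ω)]
    refine (hK _ _ _).trans ((mul_le_mul (mul_le_mul_of_nonneg_left h1 hK0) (hC n θ) dist_nonneg
      (by positivity)).trans_eq ?_)
    rw [← Real.exp_nat_mul, mul_assoc, mul_assoc, ← Real.exp_add, mul_assoc, mul_assoc,
      ← Real.exp_add]
    ring_nf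
  refine ⟨A * (1 - Real.exp (-(δ / 2)))⁻¹, fun n θ => ?_⟩
  rw [← Finset.sum_sub_distrib]
  refine (Finset.abs_sum_le_sum_abs _ _).trans ?_
  refine (Finset.sum_le_sum fun t _ => hterm t θ).trans ?_
  rw [← Finset.mul_sum]
  refine mul_le_mul_of_nonneg_left ?_ hA
  rw [← tsum_geometric_of_lt_one (Real.exp_pos _).le hr]
  exact (summable_geometric_of_lt_one (Real.exp_pos _).le hr).sum_le_tsum _
    fun i _ => by positivity

end Loss

/-! ### Consistency from separation of the limit criterion -/

section Wald

variable {k p q : ℕ} [NeZero p] {F Θ : Type*} [MetricSpace F] [MeasurableSpace F]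
  [MetricSpace Θ] [CompactSpace Θ] {M : Model k p q F Θ}
  {Ω : Type*} {X : ℤ → Ω → (Fin k → ℝ)} {E : M.LagMetric}
  [TopologicalSpace.SeparableSpace F] [BorelSpace F]
  [MeasurableSpace Ω] {P : Measure Ω} [IsProbabilityMeasure P]

-- The past at time `t` stops at `X_{t-1}`, so the loss of time `t - 1` is the latest one that it
-- determines.
omit [CompactSpace Θ] [IsProbabilityMeasure P] in
theorem causal_loss (hX : IsStationaryErgodic P X) {y : Fin p → M.State}
    (hy : ∀ᵐ ω ∂P, M.Tame X E y ω) (hIV : M.IV P X) (θ : Θ) :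
    Causal P X fun t ω => M.loss (X (t - 1) ω) (M.g X y (t - 1) ω θ) := by
  have : SecondCountableTopology F := UniformSpace.secondCountable_of_separable F
  have h1 : Causal P X fun t => X (t - 1) := by simpa using Causal.lagged (P := P) (X := X) 0
  have h2 : Causal P X fun t ω => M.g X y (t - 1) ω θ := by simpa using (causal_g hX hy θ).lag 1
  exact (h1.prodMk h2).comp (g := fun z => M.loss z.1 z.2) hIV.continuous_loss.measurable

theorem ae_posLog_norm_sublinear (hX : IsStationaryErgodic P X)
    (hlog : ∫⁻ ω, ENNReal.ofReal (Real.posLog ‖X 0 ω‖) ∂P < ⊤) :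
    ∀ᵐ ω ∂P, ∀ ε > 0, ∃ C, ∀ n : ℕ, Real.posLog ‖X (n : ℤ) ω‖ ≤ ε * n + C := by
  have h1 : Causal P X fun t => X (t - 1) := by simpa using Causal.lagged (P := P) (X := X) 0
  have h2 : Causal P X fun t ω => ENNReal.ofReal (Real.posLog ‖X (t - 1) ω‖) :=
    h1.comp (g := fun x => ENNReal.ofReal (Real.posLog ‖x‖))
      (ENNReal.measurable_ofReal.comp (Real.continuous_posLog.comp continuous_norm).measurable)
  have h3 := (h2.identDistrib hX 0 1).lintegral_eq
  simp only [sub_self] at h3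
  filter_upwards [h2.ae_sublinear_ennreal hX (h3.trans_lt hlog)] with ω h ε hε
  obtain ⟨C, hC⟩ := (h 1 ε hε).1
  refine ⟨|C|, fun n => ?_⟩
  have h4 := (hC n).trans (ENNReal.ofReal_le_ofReal
    (add_le_add le_rfl (le_abs_self C) : ε * n + C ≤ ε * n + |C|))
  rw [add_sub_cancel_left] at h4
  exact (ENNReal.ofReal_le_ofReal_iff (by positivity)).1 h4

/-- Uniform lower bound of the criterion in a neighbourhood of `θ`. -/
theorem exists_nhds_le_sum_loss (hX : IsStationaryErgodic P X) {y : Fin p → M.State}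
    (hy : ∀ᵐ ω ∂P, M.Tame X E y ω) (hIV : M.IV P X) {c v : ℝ} (hcv : c ≤ v) (θ : Θ)
    (hlow : ∀ᵐ ω ∂P, ∀ t θ, c ≤ M.loss (X t ω) (M.g X y t ω θ))
    (hgt : ENNReal.ofReal (v - c)
      < ∫⁻ ω, ENNReal.ofReal (M.loss (X 0 ω) (M.g X y 0 ω θ) - c) ∂P) :
    ∃ B ∈ 𝓝 θ, ∃ a > v, ∀ᵐ ω ∂P, ∃ C, ∀ (n : ℕ), ∀ θ' ∈ B,
      a * n - C ≤ ∑ t ∈ Finset.Icc 1 n, M.loss (X (t : ℤ) ω) (M.g X y t ω θ') := by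
  obtain ⟨D, hDc, hD⟩ := TopologicalSpace.exists_countable_dense Θ
  let B : ℕ → Set Θ := fun n => Metric.ball θ (1 / (n + 1))
  have hBanti : Antitone B := fun a b hab => Metric.ball_subset_ball (Nat.one_div_le_one_div hab)
  let s : ℤ → Ω → Θ → ENNReal := fun t ω θ' =>
    ENNReal.ofReal (M.loss (X (t - 1) ω) (M.g X y (t - 1) ω θ') - c)
  -- The infimum runs over a countable dense part of the ball, for measurability, and is capped at
  -- `n`, for integrability: the mean loss at `θ` may be infinite.
  let e : ℕ → ℤ → Ω → ENNReal := fun n t ω => min (⨅ θ' : ↥(B n ∩ D), s t ω θ') n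
  have he : ∀ n, Causal P X (e n) := fun n => by
    have := (hDc.mono (Set.inter_subset_right (s := B n))).to_subtype
    have h1 : Causal P X fun t ω => ⨅ θ' : ↥(B n ∩ D), s t ω θ' := Causal.iInf fun θ' =>
      (causal_loss hX hy hIV (θ' : Θ)).comp (g := fun z => ENNReal.ofReal (z - c))
        (ENNReal.measurable_ofReal.comp (measurable_id.sub_const c))
    exact h1.comp (g := fun z => min z (n : ENNReal)) (measurable_id.min measurable_const)
  have hsc : ∀ ω, M.Tame X E y ω → ∀ t, Continuous fun θ' =>
      M.loss (X t ω) (M.g X y t ω θ') := fun ω hω t =>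
    hIV.continuous_loss.comp (continuous_const.prodMk (hω.continuous_g t))
  have hmono : ∀ ω, Monotone fun n => e n 1 ω := fun ω i j hij =>
    min_le_min (le_iInf fun θ' => iInf_le (fun θ' : ↥(B i ∩ D) => s 1 ω θ')
      ⟨θ', hBanti hij θ'.2.1, θ'.2.2⟩) (by exact_mod_cast hij)
  -- By continuity in the parameter, infima over shrinking balls with growing caps exhaust the value
  -- at `θ`; monotone convergence then makes some mean exceed `v - c`.
  have hsup : ∀ᵐ ω ∂P, ENNReal.ofReal (M.loss (X 0 ω) (M.g X y 0 ω θ) - c) ≤ ⨆ n, e n 1 ω := by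
    filter_upwards [hy] with ω hω
    refine le_of_forall_lt fun z hz => ?_
    have hcont : Continuous fun θ' => s 1 ω θ' := by
      simp only [s, sub_self]
      exact ENNReal.continuous_ofReal.comp ((hsc ω hω 0).sub continuous_const)
    obtain ⟨z', hz', hz''⟩ := exists_between hz
    have hev : ∀ᶠ θ' in 𝓝 θ, z' < s 1 ω θ' := by
      refine hcont.continuousAt.eventually (lt_mem_nhds ?_)
      simpa only [s, sub_self] using hz''
    obtain ⟨ε, hε, hball⟩ := Metric.eventually_nhds_iff_ball.1 hev
    obtain ⟨n₁, hn₁⟩ := exists_nat_one_div_lt hε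
    obtain ⟨n₂, hn₂⟩ := ENNReal.exists_nat_gt (ne_top_of_lt hz'')
    refine hz'.trans_le (le_trans ?_ (le_iSup _ (max n₁ n₂)))
    refine le_min (le_iInf fun θ' => (hball _ ?_).le) (hn₂.le.trans ?_)
    · exact Metric.ball_subset_ball hn₁.le (hBanti (le_max_left n₁ n₂) θ'.2.1)
    · exact_mod_cast le_max_right n₁ n₂
  have hlt := hgt.trans_le (lintegral_mono_ae hsup)
  rw [lintegral_iSup' (fun n => (he n).aemeasurable hX 1) (.of_forall hmono), lt_iSup_iff] at hlt
  obtain ⟨n, hn⟩ := hlt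
  have hle : ∀ t ω, e n t ω ≤ n := fun t ω => min_le_right _ _
  have hfin : ∀ t ω, e n t ω < ⊤ := fun t ω => (hle t ω).trans_lt (by simp)
  have hint_ne : ∫⁻ ω, e n 1 ω ∂P ≠ ⊤ := by
    refine ne_top_of_le_ne_top ?_ (lintegral_mono (hle 1))
    simp
  have hcr : Causal P X fun t ω => -(e n t ω).toReal :=
    (he n).comp (g := fun z => -z.toReal) ENNReal.measurable_toReal.neg
  have hident := hcr.identDistrib hX 0 1
  have hi1 : Integrable (fun ω => -(e n 1 ω).toReal) P :=
    (integrable_toReal_of_lintegral_ne_top ((he n).aemeasurable hX 1) hint_ne).neg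
  have hI : v - c < ∫ ω, (e n 1 ω).toReal ∂P := by
    rw [integral_toReal ((he n).aemeasurable hX 1) (.of_forall (hfin 1))]
    exact (ENNReal.ofReal_lt_iff_lt_toReal (by linarith) hint_ne).1 hn
  obtain ⟨a, ha, ha'⟩ := exists_between hI
  refine ⟨B n, Metric.ball_mem_nhds _ Nat.one_div_pos_of_nat, a + c, by linarith, ?_⟩
  have hsum := hcr.ae_sum_le hX (a := -a) (hident.integrable_iff.2 hi1)
    (by rw [hident.integral_eq, integral_neg]; linarith)
  filter_upwards [hsum, hy, hlow] with ω h1 h2 h3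
  -- Time `2`, because `e n t` bounds the loss at time `t - 1` and the criterion starts at time `1`.
  obtain ⟨C, hC⟩ := (h1 2).1
  refine ⟨C, fun N θ' hθ' => ?_⟩
  have hpt : ∀ t, c + (e n t ω).toReal ≤ M.loss (X (t - 1) ω) (M.g X y (t - 1) ω θ') := fun t => by
    have hcl : IsClosed {θ' | c + (e n t ω).toReal
        ≤ M.loss (X (t - 1) ω) (M.g X y (t - 1) ω θ')} :=
      isClosed_le continuous_const (hsc ω h2 (t - 1))
    refine closure_minimal (fun θ'' hθ'' => ?_) hcl
      (hD.open_subset_closure_inter Metric.isOpen_ball hθ')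
    have h4 : e n t ω ≤ s t ω θ'' :=
      (min_le_left _ _).trans (iInf_le (fun θ' : ↥(B n ∩ D) => s t ω θ') ⟨θ'', hθ''⟩)
    have h5 : 0 ≤ M.loss (X (t - 1) ω) (M.g X y (t - 1) ω θ'') - c := sub_nonneg.2 (h3 _ _)
    have h6 := ENNReal.toReal_mono ENNReal.ofReal_ne_top h4
    rw [ENNReal.toReal_ofReal h5] at h6
    change c + _ ≤ _
    linarith
  rw [sum_Icc_one_eq_sum_range]
  have h4 := hC N
  have h5 : ∑ i ∈ Finset.range N, (c + (e n (2 + (i : ℤ)) ω).toReal)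
      ≤ ∑ i ∈ Finset.range N, M.loss (X ((i + 1 : ℕ) : ℤ) ω) (M.g X y (i + 1 : ℕ) ω θ') := by
    refine Finset.sum_le_sum fun i _ => ?_
    have := hpt (2 + i)
    rwa [show (2 + (i : ℤ) - 1) = ((i + 1 : ℕ) : ℤ) by push_cast; ring] at this
  rw [Finset.sum_add_distrib, Finset.sum_const, Finset.card_range, nsmul_eq_mul] at h5
  rw [Finset.sum_neg_distrib] at h4
  linarith

/-- Outside the ball of radius `1 / (m + 1)` the sums grow with slope at least `a m > v`; at `θ₀`
the slope is at most halfway between `v` and `a m`. Forecasts change the sums by at most `U`, so no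
minimiser lies outside the ball for large `n`. Countably many radii discard countably many null
sets. -/
theorem ae_tendsto_of_separation (hX : IsStationaryErgodic P X) {y : Fin p → M.State}
    (hy : ∀ᵐ ω ∂P, M.Tame X E y ω) (hIV : M.IV P X) {c : ℝ} {θ₀ : Θ}
    (hlog : ∫⁻ ω, ENNReal.ofReal (Real.posLog ‖X 0 ω‖) ∂P < ⊤)
    (hlow : ∀ᵐ ω ∂P, ∀ t θ, c ≤ M.loss (X t ω) (M.g X y t ω θ))
    (hint : Integrable (fun ω => M.loss (X 0 ω) (M.g X y 0 ω θ₀)) P)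
    (hgt : ∀ θ ≠ θ₀, ENNReal.ofReal ((∫ ω, M.loss (X 0 ω) (M.g X y 0 ω θ₀) ∂P) - c)
      < ∫⁻ ω, ENNReal.ofReal (M.loss (X 0 ω) (M.g X y 0 ω θ) - c) ∂P)
    {ζ : Ω → Θ → (Fin p → M.State)} (hζ : ∀ ω, Continuous (ζ ω)) {θhat : ℕ → Ω → Θ}
    (hθhat : ∀ᵐ ω ∂P, ∀ n : ℕ, 1 ≤ n → ∀ θ, M.qlik X ζ n ω (θhat n ω) ≤ M.qlik X ζ n ω θ) :
    ∀ᵐ ω ∂P, Tendsto (fun n => θhat n ω) atTop (𝓝 θ₀) := by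
  set v := ∫ ω, M.loss (X 0 ω) (M.g X y 0 ω θ₀) ∂P with hv
  have hcv : c ≤ v := by
    have h1 : ∫ _, c ∂P ≤ v := integral_mono_ae (integrable_const c) hint (by
      filter_upwards [hlow] with ω h using h 0 θ₀)
    simpa using h1
  have hfar : ∀ m : ℕ, ∃ a > v, ∀ᵐ ω ∂P, ∃ C, ∀ (n : ℕ),
      ∀ θ' ∈ (Metric.ball θ₀ (1 / ((m : ℝ) + 1)))ᶜ,
      a * n - C ≤ ∑ t ∈ Finset.Icc 1 n, M.loss (X (t : ℤ) ω) (M.g X y t ω θ') := fun m => by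
    refine (Metric.isOpen_ball.isClosed_compl.isCompact).induction_on
      (p := fun B => ∃ a > v, ∀ᵐ ω ∂P, ∃ C, ∀ (n : ℕ), ∀ θ' ∈ B,
        a * n - C ≤ ∑ t ∈ Finset.Icc 1 n, M.loss (X (t : ℤ) ω) (M.g X y t ω θ'))
      ⟨v + 1, by linarith, .of_forall fun _ => ⟨0, fun _ _ h => h.elim⟩⟩ ?_ ?_ ?_
    · rintro A B hAB ⟨a, ha, h⟩
      refine ⟨a, ha, h.mono ?_⟩
      rintro ω ⟨C, hC⟩
      exact ⟨C, fun n θ' hθ' => hC n θ' (hAB hθ')⟩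
    · rintro A B ⟨a, ha, h⟩ ⟨b, hb, h'⟩
      refine ⟨min a b, lt_min ha hb, ?_⟩
      filter_upwards [h, h']
      rintro ω ⟨C, hC⟩ ⟨C', hC'⟩
      refine ⟨max C C', fun n θ' hθ' => ?_⟩
      have hn : (0 : ℝ) ≤ n := n.cast_nonneg
      rcases hθ' with h1 | h1
      · refine le_trans ?_ (hC n θ' h1)
        exact sub_le_sub (mul_le_mul_of_nonneg_right (min_le_left _ _) hn) (le_max_left _ _)
      · refine le_trans ?_ (hC' n θ' h1)
        exact sub_le_sub (mul_le_mul_of_nonneg_right (min_le_right _ _) hn) (le_max_right _ _)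
    · intro θ hθ
      have hne : θ ≠ θ₀ := by
        rintro rfl
        exact hθ (Metric.mem_ball_self Nat.one_div_pos_of_nat)
      obtain ⟨B, hB, h⟩ := exists_nhds_le_sum_loss hX hy hIV hcv θ hlow (hgt θ hne)
      exact ⟨B, mem_nhdsWithin_of_mem_nhds hB, h⟩
  choose a ha hfar using hfar
  have hcausal := causal_loss hX hy hIV θ₀
  have hident := hcausal.identDistrib hX 0 1
  simp only [sub_self] at hident
  have hnear : ∀ m : ℕ, ∀ᵐ ω ∂P, ∃ C, ∀ n : ℕ,
      ∑ t ∈ Finset.Icc 1 n, M.loss (X (t : ℤ) ω) (M.g X y t ω θ₀)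
        ≤ (v + (a m - v) / 2) * n + C := fun m => by
    have h1 := hcausal.ae_sum_le hX (a := v + (a m - v) / 2) (hident.integrable_iff.2 hint)
      (by rw [hident.integral_eq]; linarith [ha m])
    filter_upwards [h1] with ω hω
    obtain ⟨C, hC⟩ := (hω 2).1
    refine ⟨C, fun n => ?_⟩
    rw [sum_Icc_one_eq_sum_range]
    refine le_of_eq_of_le (Finset.sum_congr rfl fun i _ => ?_) (hC n)
    rw [show (2 + (i : ℤ) - 1) = ((i + 1 : ℕ) : ℤ) by push_cast; ring]
  filter_upwards [hθhat, ae_all_iff.2 hfar, ae_all_iff.2 hnear, hy,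
    ae_posLog_norm_sublinear hX hlog] with ω h1 h2 h3 h4 h5
  obtain ⟨U, hU⟩ := h4.exists_sum_loss_sub_le hIV (hζ ω) h5
  rw [Metric.tendsto_atTop']
  intro ε hε
  obtain ⟨m, hm⟩ := exists_nat_one_div_lt hε
  obtain ⟨C, hC⟩ := h2 m
  obtain ⟨C', hC'⟩ := h3 m
  have hη : 0 < (a m - v) / 2 := by linarith [ha m]
  -- A minimiser outside the ball would give `a m * n - C - U ≤ (v + (a m - v) / 2) * n + C' + U`,
  -- which fails for `n ≥ N`.
  obtain ⟨N, hN⟩ := exists_nat_gt ((C + C' + 2 * U) / ((a m - v) / 2))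
  refine ⟨max N 1, fun n hn => ?_⟩
  have hn1 : 1 ≤ n := (le_max_right _ _).trans hn.le
  have hnN : (N : ℝ) ≤ n := by exact_mod_cast (le_max_left N 1).trans hn.le
  by_contra hcon
  have hmem : θhat n ω ∈ (Metric.ball θ₀ (1 / ((m : ℝ) + 1)))ᶜ := fun hb =>
    hcon ((Metric.mem_ball.1 hb).trans hm)
  have h6 := hC n _ hmem
  have h7 := hC' n
  have h8 := abs_le.1 (hU n (θhat n ω))
  have h9 := abs_le.1 (hU n θ₀)
  have h10 := h1 n hn1 θ₀
  have hn0 : (0 : ℝ) < n := by exact_mod_cast hn1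
  rw [qlik, qlik] at h10
  have h11 := le_of_mul_le_mul_left h10 (inv_pos.2 hn0)
  have h12 : C + C' + 2 * U < (a m - v) / 2 * n := by
    have := (div_lt_iff₀ hη).1 (hN.trans_le hnN)
    linarith
  nlinarith [h8.1, h9.2]

end Wald

end Model

/-! ### Positive semidefinite matrices -/

section Matrix

variable {k : ℕ} {A B S : Matrix (Fin k) (Fin k) ℝ}

open scoped MatrixOrder in
theorem posSemidef_matSqrt (A : Matrix (Fin k) (Fin k) ℝ) : (matSqrt A).PosSemidef :=
  Matrix.nonneg_iff_posSemidef.1 (CFC.sqrt_nonneg A)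

open scoped MatrixOrder in
theorem matSqrt_mul_matSqrt (hA : A.PosSemidef) : matSqrt A * matSqrt A = A :=
  CFC.sqrt_mul_sqrt_self A (Matrix.nonneg_iff_posSemidef.2 hA)

open scoped MatrixOrder in
theorem eq_of_mul_self_eq_mul_self (hA : A.PosSemidef) (hB : B.PosSemidef) (h : A * A = B * B) :
    A = B := by
  rw [← CFC.sqrt_mul_self A (Matrix.nonneg_iff_posSemidef.2 hA), h,
    CFC.sqrt_mul_self B (Matrix.nonneg_iff_posSemidef.2 hB)]

theorem isClosed_posSemidef :
    IsClosed {B : Fin k → Fin k → ℝ | (Matrix.of B).PosSemidef} := by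
  have hB : Continuous fun B : Fin k → Fin k → ℝ => (Matrix.of B : Matrix (Fin k) (Fin k) ℝ) :=
    continuous_id
  simp only [Matrix.posSemidef_iff_dotProduct_mulVec, Set.ofPred_and, Set.ofPred_forall]
  refine IsClosed.inter (isClosed_eq hB.matrix_conjTranspose hB) (isClosed_iInter fun x => ?_)
  exact isClosed_le continuous_const (continuous_const.dotProduct (hB.matrix_mulVec continuous_const))

/-- Squaring is a continuous injection on the closed, hence Polish, set of positive semidefinite
matrices. It is therefore a measurable embedding, and the root is measurable because its square is.
-/
theorem measurable_matSqrt {T : Type*} [MeasurableSpace T] {f : T → Matrix (Fin k) (Fin k) ℝ}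
    (hf : ∀ i j, Measurable fun u => f u i j) (hpsd : ∀ u, (f u).PosSemidef) (i j : Fin k) :
    Measurable fun u => matSqrt (f u) i j := by
  let T' : Set (Fin k → Fin k → ℝ) := {B | (Matrix.of B).PosSemidef}
  have : PolishSpace T' := isClosed_posSemidef.polishSpace
  let sq : T' → (Fin k → Fin k → ℝ) := fun B i j => ∑ l, B.1 i l * B.1 l j
  have hsq : Continuous sq := by
    refine continuous_pi fun i => continuous_pi fun j => continuous_finsetSum _ fun l _ => ?_
    have h : ∀ a b, Continuous fun B : T' => B.1 a b := fun a b =>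
      (continuous_apply b).comp ((continuous_apply a).comp continuous_subtype_val)
    exact (h _ _).mul (h _ _)
  have hinj : Function.Injective sq := fun B C h => by
    refine Subtype.ext ?_
    refine eq_of_mul_self_eq_mul_self (A := Matrix.of B.1) (B := Matrix.of C.1) B.2 C.2 ?_
    ext i j
    exact congrFun (congrFun h i) j
  let κ : T → T' := fun u => ⟨fun i j => matSqrt (f u) i j, posSemidef_matSqrt (f u)⟩
  have hκ : Measurable κ := by
    rw [← (hsq.measurableEmbedding hinj).measurable_comp_iff]
    refine measurable_pi_lambda _ fun i => measurable_pi_lambda _ fun j => ?_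
    have e : (fun u => (sq ∘ κ) u i j) = fun u => f u i j := by
      funext u
      have := congrFun (congrFun (matSqrt_mul_matSqrt (hpsd u)) i) j
      rwa [Matrix.mul_apply] at this
    rw [e]
    exact hf i j
  exact (measurable_pi_apply j).comp ((measurable_pi_apply i).comp (measurable_subtype_coe.comp hκ))

theorem dotProduct_mulVec_conj (hS : S.PosSemidef) (A : Matrix (Fin k) (Fin k) ℝ)
    (z : Fin k → ℝ) :
    dotProduct (S.mulVec z) (A.mulVec (S.mulVec z)) = dotProduct z ((S * A * S).mulVec z) := by
  have hT : S.transpose = S := by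
    rw [← Matrix.conjTranspose_eq_transpose_of_trivial]; exact hS.isHermitian
  rw [← Matrix.mulVec_mulVec, ← Matrix.mulVec_mulVec, Matrix.dotProduct_mulVec z S,
    ← Matrix.mulVec_transpose, hT]

/-- The inequality `log x ≤ x - 1` summed over the eigenvalues; its strictness off `x = 1` gives the
equality case below. -/
theorem log_det_le_trace_sub (hB : B.PosDef) : Real.log B.det ≤ B.trace - k := by
  have h := hB.1
  rw [h.det_eq_prod_eigenvalues, h.trace_eq_sum_eigenvalues]
  simp only [RCLike.ofReal_real_eq_id, id]
  rw [Real.log_prod fun i _ => (hB.eigenvalues_pos i).ne']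
  have h1 : ∑ i, Real.log (h.eigenvalues i) ≤ ∑ i, (h.eigenvalues i - 1) :=
    Finset.sum_le_sum fun i _ => Real.log_le_sub_one_of_pos (hB.eigenvalues_pos i)
  simpa using h1

theorem eq_one_of_log_det_eq (hB : B.PosDef) (heq : Real.log B.det = B.trace - k) : B = 1 := by
  have h := hB.1
  rw [h.det_eq_prod_eigenvalues, h.trace_eq_sum_eigenvalues] at heq
  simp only [RCLike.ofReal_real_eq_id, id] at heq
  rw [Real.log_prod fun i _ => (hB.eigenvalues_pos i).ne'] at heq
  have h1 : ∀ i ∈ Finset.univ, Real.log (h.eigenvalues i) ≤ h.eigenvalues i - 1 := fun i _ =>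
    Real.log_le_sub_one_of_pos (hB.eigenvalues_pos i)
  have h2 : ∑ i, Real.log (h.eigenvalues i) = ∑ i, (h.eigenvalues i - 1) := by simpa using heq
  have h3 := (Finset.sum_eq_sum_iff_of_le h1).1 h2
  have h4 : h.eigenvalues = fun _ => 1 := funext fun i => by
    by_contra hne
    exact (Real.log_lt_sub_one_of_pos (hB.eigenvalues_pos i) hne).ne (h3 i (Finset.mem_univ i))
  rw [h.spectral_theorem, h4]
  have : (RCLike.ofReal ∘ fun _ : Fin k => (1 : ℝ)) = fun _ => (1 : ℝ) := by
    funext; simp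
  rw [this, Matrix.diagonal_one, map_one]

theorem posDef_conj_inv (hS : S.PosDef) (hA : A.PosDef) : (S * A⁻¹ * S).PosDef := by
  have h := hA.inv.conjTranspose_mul_mul_same (B := S)
    (Matrix.mulVec_injective_of_isUnit hS.isUnit)
  rwa [hS.1] at h

theorem log_det_conj_inv (hS : S.PosDef) (hA : A.PosDef) :
    Real.log (S * A⁻¹ * S).det = Real.log (S * S).det - Real.log A.det := by
  rw [Matrix.det_mul, Matrix.det_mul, Matrix.det_mul, Matrix.det_nonsing_inv, Ring.inverse_eq_inv',
    Real.log_mul (mul_ne_zero hS.det_pos.ne' (inv_ne_zero hA.det_pos.ne')) hS.det_pos.ne',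
    Real.log_mul hS.det_pos.ne' (inv_ne_zero hA.det_pos.ne'),
    Real.log_mul hS.det_pos.ne' hS.det_pos.ne', Real.log_inv]
  ring

theorem eq_of_conj_inv_eq_one (hS : S.PosDef) (hA : A.PosDef) (h : S * A⁻¹ * S = 1) :
    A = S * S := by
  have hSu : IsUnit S.det := hS.det_pos.ne'.isUnit
  have hAu : IsUnit A.det := hA.det_pos.ne'.isUnit
  have h1 : S⁻¹ = S * A⁻¹ := Matrix.inv_eq_left_inv h
  calc A = S * S⁻¹ * A := by rw [Matrix.mul_nonsing_inv _ hSu, one_mul]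
    _ = S * S * (A⁻¹ * A) := by rw [h1]; simp only [mul_assoc]
    _ = S * S := by rw [Matrix.nonsing_inv_mul _ hAu, mul_one]

/-- Leibniz expansion, with each entry bounded by the norm of its column and `log⁺` of sums and
products split into sums of `log⁺`. -/
theorem posLog_det_le (S : Matrix (Fin k) (Fin k) ℝ) :
    Real.posLog S.det ≤ Real.log (Fintype.card (Equiv.Perm (Fin k)))
      + Fintype.card (Equiv.Perm (Fin k)) * ∑ j, Real.posLog ‖S.mulVec (Pi.single j 1)‖ := by
  rw [Matrix.det_apply]
  refine (Real.posLog_sum _ _).trans ?_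
  rw [Finset.card_univ]
  gcongr
  refine (Finset.sum_le_card_nsmul _ _ _ fun σ _ => ?_).trans_eq
    (by rw [Finset.card_univ, nsmul_eq_mul])
  have h1 : Real.posLog (Equiv.Perm.sign σ • ∏ i, S (σ i) i) = Real.posLog (∏ i, S (σ i) i) := by
    rcases Int.units_eq_one_or (Equiv.Perm.sign σ) with h | h <;> rw [h] <;> simp
  rw [h1]
  refine (Real.posLog_prod _ _).trans (Finset.sum_le_sum fun i _ => ?_)
  rw [← Real.posLog_abs]
  refine Real.posLog_le_posLog (abs_nonneg _) ?_
  have := norm_le_pi_norm (S.mulVec (Pi.single i 1)) (σ i)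
  simpa using this

end Matrix

/-! ### Quadratic forms in a standardised vector -/

section Moments

variable {k : ℕ} {T : Type*} [MeasurableSpace T] {ν : Measure T} [IsProbabilityMeasure ν]
  {π : Measure (Fin k → ℝ)} [IsProbabilityMeasure π]

theorem measurable_mulVec {S : T → Matrix (Fin k) (Fin k) ℝ}
    (hS : ∀ i j, Measurable fun u => S u i j) :
    Measurable fun w : T × (Fin k → ℝ) => (S w.1).mulVec w.2 := by
  refine measurable_pi_lambda _ fun i => ?_
  simp only [Matrix.mulVec, dotProduct]
  exact Finset.measurable_fun_sum _ fun j _ => ((hS i j).comp measurable_fst).mul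
    ((measurable_pi_apply j).comp measurable_snd)

theorem measurable_posLog_norm_mulVec {S : T → Matrix (Fin k) (Fin k) ℝ}
    (hS : ∀ i j, Measurable fun u => S u i j) :
    Measurable fun w : T × (Fin k → ℝ) => ENNReal.ofReal (Real.posLog ‖(S w.1).mulVec w.2‖) :=
  ENNReal.measurable_ofReal.comp (Real.continuous_posLog.measurable.comp (measurable_mulVec hS).norm)

theorem measurable_posLog_norm_mulVec_left {S : T → Matrix (Fin k) (Fin k) ℝ}
    (hS : ∀ i j, Measurable fun u => S u i j) (z : Fin k → ℝ) :
    Measurable fun u => ENNReal.ofReal (Real.posLog ‖(S u).mulVec z‖) := by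
  have h : Measurable fun u => (S u).mulVec z := by
    refine measurable_pi_lambda _ fun i => ?_
    simp only [Matrix.mulVec, dotProduct]
    exact Finset.measurable_fun_sum _ fun j _ => (hS i j).mul_const _
  exact ENNReal.measurable_ofReal.comp (Real.continuous_posLog.measurable.comp h.norm)

theorem lintegral_posLog_mulVec_add_lt_top {S : T → Matrix (Fin k) (Fin k) ℝ}
    (hS : ∀ i j, Measurable fun u => S u i j) {a b : Fin k → ℝ}
    (ha : ∫⁻ u, ENNReal.ofReal (Real.posLog ‖(S u).mulVec a‖) ∂ν < ⊤)
    (hb : ∫⁻ u, ENNReal.ofReal (Real.posLog ‖(S u).mulVec b‖) ∂ν < ⊤) :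
    ∫⁻ u, ENNReal.ofReal (Real.posLog ‖(S u).mulVec (a + b)‖) ∂ν < ⊤ := by
  have hlog : 0 ≤ Real.log 2 := Real.log_nonneg one_le_two
  have hle : ∀ u, ENNReal.ofReal (Real.posLog ‖(S u).mulVec (a + b)‖) ≤
      ENNReal.ofReal (Real.log 2) + ENNReal.ofReal (Real.posLog ‖(S u).mulVec a‖) +
        ENNReal.ofReal (Real.posLog ‖(S u).mulVec b‖) := fun u => by
    rw [← ENNReal.ofReal_add hlog Real.posLog_nonneg,
      ← ENNReal.ofReal_add (add_nonneg hlog Real.posLog_nonneg) Real.posLog_nonneg,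
      Matrix.mulVec_add]
    refine ENNReal.ofReal_le_ofReal ?_
    linarith [Real.posLog_norm_add_le ((S u).mulVec a) ((S u).mulVec b)]
  refine (lintegral_mono hle).trans_lt ?_
  rw [lintegral_add_right _ (measurable_posLog_norm_mulVec_left hS b),
    lintegral_add_right _ (measurable_posLog_norm_mulVec_left hS a), lintegral_const,
    measure_univ, mul_one]
  exact ENNReal.add_lt_top.2 ⟨ENNReal.add_lt_top.2 ⟨ENNReal.ofReal_lt_top, ha⟩, hb⟩

theorem lintegral_posLog_mulVec_smul_lt_top {S : T → Matrix (Fin k) (Fin k) ℝ}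
    (c : ℝ) {z : Fin k → ℝ}
    (hz : ∫⁻ u, ENNReal.ofReal (Real.posLog ‖(S u).mulVec z‖) ∂ν < ⊤) :
    ∫⁻ u, ENNReal.ofReal (Real.posLog ‖(S u).mulVec (c • z)‖) ∂ν < ⊤ := by
  have hle : ∀ u, ENNReal.ofReal (Real.posLog ‖(S u).mulVec (c • z)‖) ≤
      ENNReal.ofReal (Real.posLog ‖c‖) + ENNReal.ofReal (Real.posLog ‖(S u).mulVec z‖) :=
    fun u => by
      rw [← ENNReal.ofReal_add Real.posLog_nonneg Real.posLog_nonneg, Matrix.mulVec_smul, norm_smul]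
      exact ENNReal.ofReal_le_ofReal Real.posLog_mul
  refine (lintegral_mono hle).trans_lt ?_
  rw [lintegral_add_left measurable_const, lintegral_const, measure_univ, mul_one]
  exact ENNReal.add_lt_top.2 ⟨ENNReal.ofReal_lt_top, hz⟩

/-- The vectors `z` for which `S z` has a finite logarithmic moment. -/
def logMomentSubmodule (ν : Measure T) [IsProbabilityMeasure ν] (S : T → Matrix (Fin k) (Fin k) ℝ)
    (hS : ∀ i j, Measurable fun u => S u i j) : Submodule ℝ (Fin k → ℝ) where
  carrier := {z | ∫⁻ u, ENNReal.ofReal (Real.posLog ‖(S u).mulVec z‖) ∂ν < ⊤}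
  zero_mem' := by simp
  add_mem' ha hb := lintegral_posLog_mulVec_add_lt_top hS ha hb
  smul_mem' c _ hz := lintegral_posLog_mulVec_smul_lt_top c hz

-- The second moment of `f` is the sum of its squared coefficients, so a law with identity second
-- moment is not carried by a hyperplane.
omit [IsProbabilityMeasure π] in
theorem linearMap_eq_zero_of_ae (hint : ∀ i j, Integrable (fun z : Fin k → ℝ => z i * z j) π)
    (hπ : ∀ i j, ∫ z, z i * z j ∂π = (1 : Matrix (Fin k) (Fin k) ℝ) i j)
    {f : (Fin k → ℝ) →ₗ[ℝ] ℝ} (hf : ∀ᵐ z ∂π, f z = 0) : f = 0 := by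
  have hfz : ∀ z, f z = ∑ i, z i * f (Pi.single i 1) := fun z => by
    rw [LinearMap.pi_apply_eq_sum_univ f z]
    refine Finset.sum_congr rfl fun i _ => ?_
    rw [smul_eq_mul]
    congr 2
    funext j
    simp [Pi.single_apply, eq_comm]
  have h1 : ∫ z, f z * f z ∂π = ∑ i, f (Pi.single i 1) * f (Pi.single i 1) := by
    have e : (fun z => f z * f z) = fun z => ∑ i, ∑ j,
        f (Pi.single i 1) * f (Pi.single j 1) * (z i * z j) := by
      funext z
      rw [hfz z, Finset.sum_mul_sum]
      exact Finset.sum_congr rfl fun i _ => Finset.sum_congr rfl fun j _ => by ring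
    rw [e, integral_finsetSum _ fun i _ => integrable_finsetSum _ fun j _ => (hint i j).const_mul _]
    refine Finset.sum_congr rfl fun i _ => ?_
    rw [integral_finsetSum _ fun j _ => (hint i j).const_mul _]
    simp only [integral_const_mul, hπ, Matrix.one_apply]
    simp
  have h2 : ∫ z, f z * f z ∂π = 0 := by
    rw [integral_congr_ae (g := fun _ => 0) (by filter_upwards [hf] with z hz; rw [hz, mul_zero])]
    simp
  rw [h2] at h1
  have h3 := (Finset.sum_eq_zero_iff_of_nonneg fun i _ => mul_self_nonneg _).1 h1.symm
  ext i
  simpa using h3 i (Finset.mem_univ i)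

/-- By Fubini, `S z` has a logarithmic moment for almost every `z`. Such `z` form a subspace, which
cannot be proper under a law with identity second moment. It contains the basis vectors, so every
column of `S` has a logarithmic moment. -/
theorem lintegral_posLog_det_lt_top {S : T → Matrix (Fin k) (Fin k) ℝ}
    (hS : ∀ i j, Measurable fun u => S u i j)
    (hint : ∀ i j, Integrable (fun z : Fin k → ℝ => z i * z j) π)
    (hπ : ∀ i j, ∫ z, z i * z j ∂π = (1 : Matrix (Fin k) (Fin k) ℝ) i j)
    (hfin : ∫⁻ w, ENNReal.ofReal (Real.posLog ‖(S w.1).mulVec w.2‖) ∂(ν.prod π) < ⊤) :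
    ∫⁻ u, ENNReal.ofReal (Real.posLog (S u).det) ∂ν < ⊤ := by
  have hm := measurable_posLog_norm_mulVec hS
  rw [lintegral_prod_symm _ hm.aemeasurable] at hfin
  have hae := ae_lt_top hm.lintegral_prod_left' hfin.ne
  have htop : logMomentSubmodule ν S hS = ⊤ := by
    by_contra hne
    obtain ⟨f, hf, hker⟩ := Submodule.exists_le_ker_of_lt_top _ (lt_top_iff_ne_top.2 hne)
    refine hf (linearMap_eq_zero_of_ae hint hπ ?_)
    filter_upwards [hae] with z hz
    exact hker (show z ∈ logMomentSubmodule ν S hS from hz)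
  have hj : ∀ j, ∫⁻ u, ENNReal.ofReal (Real.posLog ‖(S u).mulVec (Pi.single j 1)‖) ∂ν < ⊤ :=
    fun j => (htop ▸ Submodule.mem_top : Pi.single j 1 ∈ logMomentSubmodule ν S hS)
  refine (lintegral_mono fun u => ENNReal.ofReal_le_ofReal (posLog_det_le (S u))).trans_lt ?_
  have hcard : (0 : ℝ) ≤ Fintype.card (Equiv.Perm (Fin k)) := Nat.cast_nonneg _
  have hlog : 0 ≤ Real.log (Fintype.card (Equiv.Perm (Fin k))) := Real.log_natCast_nonneg _
  have hsum : ∀ u, 0 ≤ ∑ j, Real.posLog ‖(S u).mulVec (Pi.single j 1)‖ := fun u =>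
    Finset.sum_nonneg fun j _ => Real.posLog_nonneg
  simp only [ENNReal.ofReal_add hlog (mul_nonneg hcard (hsum _)), ENNReal.ofReal_mul hcard,
    ENNReal.ofReal_sum_of_nonneg fun _ _ => Real.posLog_nonneg]
  rw [lintegral_add_left measurable_const, lintegral_const, measure_univ, mul_one,
    lintegral_const_mul _ (Finset.measurable_fun_sum _ fun j _ => measurable_posLog_norm_mulVec_left hS _),
    lintegral_finsetSum _ fun j _ => measurable_posLog_norm_mulVec_left hS _]
  exact ENNReal.add_lt_top.2 ⟨ENNReal.ofReal_lt_top, ENNReal.mul_lt_top ENNReal.ofReal_lt_top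
    (ENNReal.sum_lt_top.2 fun j _ => hj j)⟩

omit [IsProbabilityMeasure π] in
theorem integral_dotProduct_mulVec (hint : ∀ i j, Integrable (fun z : Fin k → ℝ => z i * z j) π)
    (hπ : ∀ i j, ∫ z, z i * z j ∂π = (1 : Matrix (Fin k) (Fin k) ℝ) i j)
    (A : Matrix (Fin k) (Fin k) ℝ) : ∫ z, dotProduct z (A.mulVec z) ∂π = A.trace := by
  have e : (fun z : Fin k → ℝ => dotProduct z (A.mulVec z))
      = fun z => ∑ i, ∑ j, A i j * (z i * z j) := by
    funext z
    simp only [dotProduct, Matrix.mulVec, Finset.mul_sum]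
    exact Finset.sum_congr rfl fun i _ => Finset.sum_congr rfl fun j _ => by ring
  rw [e, integral_finsetSum _ fun i _ => integrable_finsetSum _ fun j _ => (hint i j).const_mul (A i j),
    Matrix.trace]
  refine Finset.sum_congr rfl fun i _ => ?_
  rw [integral_finsetSum _ fun j _ => (hint i j).const_mul (A i j)]
  simp only [integral_const_mul, hπ, Matrix.one_apply]
  simp

/-- Integrating out `z` first turns the quadratic form into the trace. Only the quadratic form is
assumed integrable, not the entries of `A`. -/
theorem integral_prod_dotProduct_mulVec
    (hint : ∀ i j, Integrable (fun z : Fin k → ℝ => z i * z j) π)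
    (hπ : ∀ i j, ∫ z, z i * z j ∂π = (1 : Matrix (Fin k) (Fin k) ℝ) i j)
    {A : T → Matrix (Fin k) (Fin k) ℝ}
    (hA : Integrable (fun w : T × (Fin k → ℝ) => dotProduct w.2 ((A w.1).mulVec w.2)) (ν.prod π)) :
    Integrable (fun u => (A u).trace) ν ∧
      ∫ w, dotProduct w.2 ((A w.1).mulVec w.2) ∂(ν.prod π) = ∫ u, (A u).trace ∂ν := by
  have h1 := hA.integral_prod_left
  have h2 := integral_prod _ hA
  simp only [integral_dotProduct_mulVec hint hπ] at h1 h2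
  exact ⟨h1, h2⟩

end Moments

/-! ### Separation of the limit criterion -/

/-- The innovation `Z_0` is independent of the causal functionals at time `0` of a non anticipative
process. -/
theorem Causal.indepFun {k : ℕ} {Ω S S' : Type*} [MeasurableSpace Ω] [MeasurableSpace S]
    [MeasurableSpace S'] {P : Measure Ω} {Z : ℤ → Ω → (Fin k → ℝ)}
    {X : ℤ → Ω → S} {F : ℤ → Ω → S'} (hF : Causal P X F) (hIN : IN P Z)
    (hX : ∀ t, ∃ X' : Ω → S, Measurable[pastSigma Z t] X' ∧ X t =ᵐ[P] X') :
    IndepFun (F 0) (Z 0) P := by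
  obtain ⟨G, hG, hFG⟩ := hF
  choose X' hX' hXX' using hX
  have hmono : ∀ n : ℕ, pastSigma Z (0 - 1 - n) ≤ pastSigma Z (-1) := fun n =>
    iSup₂_le fun s hs => le_iSup₂_of_le (f := fun s (_ : s ≤ -1) =>
      MeasurableSpace.comap (Z s) inferInstance) s (by omega) le_rfl
  -- The versions `X'` are needed because `X` is a function of the past innovations only up to null
  -- sets.
  have hm : Measurable[pastSigma Z (-1)] fun ω => G fun n => X' (0 - 1 - n) ω :=
    @Measurable.comp _ _ _ (pastSigma Z (-1)) _ _ _ _ hG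
      (@measurable_pi_lambda _ _ _ (pastSigma Z (-1)) _ _ fun n => (hX' _).mono (hmono n) le_rfl)
  have hind : Indep (pastSigma Z (-1)) (MeasurableSpace.comap (Z 0) inferInstance) P := by
    have h := indep_iSup_of_disjoint (fun i => (hIN.measurable i).comap_le)
      ((iIndepFun_iff_iIndep _ _ _).1 hIN.indep) (S := Set.Iic (-1)) (T := {0})
      (Set.disjoint_singleton_right.2 (by simp))
    simpa only [Set.mem_Iic, Set.mem_singleton_iff, iSup_iSup_eq_left] using h
  have h2 : IndepFun (fun ω => G fun n => X' (0 - 1 - n) ω) (Z 0) P := by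
    rw [IndepFun_iff_Indep]
    exact indep_of_indep_of_le_left hind hm.comap_le
  refine h2.congr ?_ .rfl
  filter_upwards [hFG 0, ae_all_iff.2 fun n : ℕ => hXX' (0 - 1 - n)] with ω h3 h4
  rw [h3]
  congr 1
  funext n
  exact (h4 n).symm

namespace Model

variable {k p q : ℕ} {F Θ : Type*} [MetricSpace F] [MeasurableSpace F] [MetricSpace Θ]
  {M : Model k p q F Θ} {Ω : Type*} [MeasurableSpace Ω] {P : Measure Ω}
  {X : ℤ → Ω → (Fin k → ℝ)}

omit [MetricSpace Θ] in
theorem link_injective (M : Model k p q F Θ) : Function.Injective M.link := fun _ _ h =>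
  (Equiv.ofInjective M.h M.injective).symm.injective (Subtype.ext h)

theorem IV.posDef_link (h : M.IV P X) (y : M.State) : (M.link y).PosDef :=
  (posSemidef_link y).posDef_iff_det_ne_zero.2 (h.det_pos y).ne'

/-- Only `ℓ⁻¹` is assumed Lipschitz; inverting it again through determinant and adjugate makes `ℓ`
continuous. -/
theorem IV.measurable_link [BorelSpace F] (h : M.IV P X) (i j : Fin k) :
    Measurable fun y => M.link y i j := by
  have h1 : Continuous fun y => (M.link y)⁻¹ := continuous_matrix h.continuous_inv
  have h2 : ∀ y, M.link y = ((M.link y)⁻¹.det)⁻¹ • (M.link y)⁻¹.adjugate := fun y => by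
    rw [← Ring.inverse_eq_inv', ← Matrix.inv_def,
      Matrix.nonsing_inv_nonsing_inv _ (h.det_pos y).ne'.isUnit]
  have h3 : Continuous M.link := by
    rw [funext h2]
    exact (h1.matrix_det.inv₀ fun y => (h.posDef_link y).inv.det_pos.ne').smul h1.matrix_adjugate
  exact (h3.matrix_elem i j).measurable

theorem IV.posDef_matSqrt_link (h : M.IV P X) (y : M.State) : (matSqrt (M.link y)).PosDef := by
  refine (posSemidef_matSqrt _).posDef_iff_det_ne_zero.2 fun h0 => (h.det_pos y).ne' ?_
  rw [← matSqrt_mul_matSqrt (posSemidef_link y), Matrix.det_mul, h0, mul_zero]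

variable [NeZero p] [CompactSpace Θ] {E : M.LagMetric}
  [TopologicalSpace.SeparableSpace F] [BorelSpace F] [IsProbabilityMeasure P]

/-- The function `C` has a positive minimum on the compact `Θ`. Causality carries the bound from
time `0` to all times, continuity from a countable dense set to all parameters. -/
theorem IV.exists_le_logDet (hIV : M.IV P X) (hX : IsStationaryErgodic P X) [Nonempty Θ]
    {y : Fin p → M.State} (hy : ∀ᵐ ω ∂P, M.Tame X E y ω) :
    ∃ c, ∀ᵐ ω ∂P, ∀ t θ, c ≤ Real.log (M.link (M.g X y t ω θ)).det := by
  obtain ⟨C, hC, hC0, hlow⟩ := hIV.lowerBound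
  obtain ⟨θ₁, -, hmin⟩ := isCompact_univ.exists_isMinOn Set.univ_nonempty hC.continuousOn
  obtain ⟨D, hDc, hD⟩ := TopologicalSpace.exists_countable_dense Θ
  refine ⟨Real.log (C θ₁), ?_⟩
  have hθ : ∀ θ t, ∀ᵐ ω ∂P, Real.log (C θ₁) ≤ Real.log (M.link (M.g X y t ω θ)).det := fun θ t => by
    have hmeas : MeasurableSet {x : M.State | Real.log (C θ₁) ≤ Real.log (M.link x).det} :=
      (isClosed_le continuous_const hIV.continuous_logDet).measurableSet
    refine (causal_g hX hy θ).ae_mem hX hmeas 0 t ?_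
    obtain ⟨Y, hY, hYg⟩ := exists_isStationarySolution hX hy θ
    filter_upwards [hlow θ Y hY, hYg] with ω h1 h2
    rw [h2] at h1
    exact Real.log_le_log (hC0 θ₁) ((hmin (Set.mem_univ θ)).trans h1)
  have hall : ∀ᵐ ω ∂P, ∀ θ ∈ D, ∀ t, Real.log (C θ₁) ≤ Real.log (M.link (M.g X y t ω θ)).det :=
    (ae_ball_iff hDc).2 fun θ _ => ae_all_iff.2 (hθ θ)
  filter_upwards [hall, hy] with ω h1 h2 t θ
  have hcl : IsClosed {θ | Real.log (C θ₁) ≤ Real.log (M.link (M.g X y t ω θ)).det} :=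
    isClosed_le continuous_const (hIV.continuous_logDet.comp (h2.continuous_g t))
  exact closure_minimal (fun θ hθ => h1 θ hθ t) hcl (hD θ)

-- At `θ₀` the observation is `S Z_0`, with `S` the root of `ℓ(g_0(θ₀))`, independent of `Z_0`. Its
-- logarithmic moment passes to `det S`, and `det ℓ = (det S) ^ 2`.
omit [CompactSpace Θ] in
theorem lintegral_posLog_det_g_lt_top {θ₀ : Θ} {Z : ℤ → Ω → (Fin k → ℝ)} {V : ℤ → Ω → M.vol}
    (hST : M.ST P θ₀ Z X V) (hIN : IN P Z) (hIV : M.IV P X)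
    {y : Fin p → M.State} (hy : ∀ᵐ ω ∂P, M.Tame X E y ω)
    (hV : ∀ᵐ ω ∂P, X 0 ω = (matSqrt (M.link (M.g X y 0 ω θ₀))).mulVec (Z 0 ω)) :
    ∫⁻ ω, ENNReal.ofReal (Real.posLog (M.link (M.g X y 0 ω θ₀)).det) ∂P < ⊤ := by
  have hX := hST.ergodic
  have hc := causal_g hX hy θ₀
  have hgm := hc.aemeasurable hX 0
  have hind := hc.indepFun hIN hST.nonAnticipative
  have hmap := hind.map_prod_eq_prod_map_map hgm (hIN.measurable 0).aemeasurable
  have := Measure.isProbabilityMeasure_map (μ := P) hgm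
  have := Measure.isProbabilityMeasure_map (μ := P) (hIN.measurable 0).aemeasurable
  have hS := measurable_matSqrt hIV.measurable_link (fun y => posSemidef_link y)
  have hm := measurable_posLog_norm_mulVec hS
  have hprod : AEMeasurable (fun ω => (M.g X y 0 ω θ₀, Z 0 ω)) P :=
    hgm.prodMk (hIN.measurable 0).aemeasurable
  have hzz : ∀ i j, Measurable fun z : Fin k → ℝ => z i * z j := fun i j =>
    (measurable_pi_apply i).mul (measurable_pi_apply j)
  have key := lintegral_posLog_det_lt_top (ν := P.map fun ω => M.g X y 0 ω θ₀)
    (π := P.map (Z 0)) hS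
    (fun i j => (integrable_map_measure (hzz i j).aestronglyMeasurable
      (hIN.measurable 0).aemeasurable).2 (hIN.integrable i j))
    (fun i j => by
      rw [integral_map (hIN.measurable 0).aemeasurable (hzz i j).aestronglyMeasurable]
      exact hIN.secondMoment i j)
    (by
      rw [← hmap, lintegral_map' hm.aemeasurable hprod]
      refine lt_of_eq_of_lt (lintegral_congr_ae ?_) hST.logMoment
      filter_upwards [hV] with ω h
      rw [← h])
  have hlogdet : Measurable fun x : M.State =>
      ENNReal.ofReal (Real.posLog (matSqrt (M.link x)).det) := by
    refine ENNReal.measurable_ofReal.comp (Real.continuous_posLog.measurable.comp ?_)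
    simp only [Matrix.det_apply]
    exact Finset.measurable_fun_sum _ fun σ _ =>
      (Finset.measurable_fun_prod _ fun i _ => hS _ _).const_smul _
  rw [lintegral_map' hlogdet.aemeasurable hgm] at key
  have h2 : ∀ x : M.State, ENNReal.ofReal (Real.posLog (M.link x).det)
      = 2 * ENNReal.ofReal (Real.posLog (matSqrt (M.link x)).det) := fun x => by
    conv_lhs => rw [← matSqrt_mul_matSqrt (posSemidef_link x), Matrix.det_mul, ← sq]
    rw [Real.posLog_pow, ENNReal.ofReal_mul (by positivity)]
    norm_num
  simp only [h2]
  rw [lintegral_const_mul' _ _ (by norm_num)]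
  exact ENNReal.mul_lt_top (by norm_num) key

/-- The limit criterion at the true parameter. -/
theorem integrable_loss_true {θ₀ : Θ} {Z : ℤ → Ω → (Fin k → ℝ)} {V : ℤ → Ω → M.vol}
    (hST : M.ST P θ₀ Z X V) (hIN : IN P Z) (hIV : M.IV P X)
    {y : Fin p → M.State} (hy : ∀ᵐ ω ∂P, M.Tame X E y ω)
    (hV : ∀ᵐ ω ∂P, X 0 ω = (matSqrt (M.link (M.g X y 0 ω θ₀))).mulVec (Z 0 ω)) {c : ℝ}
    (hc : ∀ᵐ ω ∂P, ∀ t θ, c ≤ Real.log (M.link (M.g X y t ω θ)).det) :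
    Integrable (fun ω => Real.log (M.link (M.g X y 0 ω θ₀)).det) P ∧
    Integrable (fun ω => M.loss (X 0 ω) (M.g X y 0 ω θ₀)) P ∧
    ∫ ω, M.loss (X 0 ω) (M.g X y 0 ω θ₀) ∂P
      = 2⁻¹ * (k + ∫ ω, Real.log (M.link (M.g X y 0 ω θ₀)).det ∂P) := by
  have hX := hST.ergodic
  have hgm := (causal_g hX hy θ₀).aemeasurable hX 0
  have hlm : AEMeasurable (fun ω => Real.log (M.link (M.g X y 0 ω θ₀)).det) P :=
    hIV.continuous_logDet.measurable.comp_aemeasurable hgm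
  have hfin := lintegral_posLog_det_g_lt_top hST hIN hIV hy hV
  have hpos : Integrable (fun ω => Real.posLog (M.link (M.g X y 0 ω θ₀)).det) P := by
    refine (lintegral_ofReal_ne_top_iff_integrable ?_
      (.of_forall fun _ => Real.posLog_nonneg)).1 hfin.ne
    have : AEMeasurable (fun ω => max 0 (Real.log (M.link (M.g X y 0 ω θ₀)).det)) P :=
      aemeasurable_const.max hlm
    exact this.aestronglyMeasurable
  have hlog : Integrable (fun ω => Real.log (M.link (M.g X y 0 ω θ₀)).det) P := by
    refine (hpos.add (integrable_const |c|)).mono' hlm.aestronglyMeasurable ?_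
    filter_upwards [hc] with ω h
    have h1 := h 0 θ₀
    have h2 : Real.log (M.link (M.g X y 0 ω θ₀)).det
        ≤ Real.posLog (M.link (M.g X y 0 ω θ₀)).det := le_max_right _ _
    have h3 : 0 ≤ Real.posLog (M.link (M.g X y 0 ω θ₀)).det := Real.posLog_nonneg
    rw [Real.norm_eq_abs, abs_le, Pi.add_apply]
    constructor
    · linarith [neg_abs_le c]
    · linarith [abs_nonneg c]
  -- At `θ₀` the roots cancel against `ℓ⁻¹`, leaving the squared Euclidean norm of `Z_0`, of mean
  -- `k`.
  have hloss : ∀ᵐ ω ∂P, M.loss (X 0 ω) (M.g X y 0 ω θ₀) = 2⁻¹ * (∑ i, Z 0 ω i * Z 0 ω i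
      + Real.log (M.link (M.g X y 0 ω θ₀)).det) := by
    filter_upwards [hV] with ω h
    rw [loss]
    nth_rw 1 2 [h]
    rw [dotProduct_mulVec_conj (posSemidef_matSqrt _)]
    have hS : IsUnit (matSqrt (M.link (M.g X y 0 ω θ₀))).det :=
      (hIV.posDef_matSqrt_link _).det_pos.ne'.isUnit
    have e : matSqrt (M.link (M.g X y 0 ω θ₀)) * (M.link (M.g X y 0 ω θ₀))⁻¹
        * matSqrt (M.link (M.g X y 0 ω θ₀)) = 1 := by
      conv_lhs =>
        enter [1, 2, 1]
        rw [← matSqrt_mul_matSqrt (posSemidef_link (M.g X y 0 ω θ₀))]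
      rw [Matrix.mul_inv_rev, ← mul_assoc, Matrix.mul_nonsing_inv _ hS, one_mul,
        Matrix.nonsing_inv_mul _ hS]
    rw [e, Matrix.one_mulVec]
    rfl
  have hsum : Integrable (fun ω => ∑ i, Z 0 ω i * Z 0 ω i) P :=
    integrable_finsetSum _ fun i _ => hIN.integrable i i
  refine ⟨hlog, ((hsum.add hlog).const_mul 2⁻¹).congr (hloss.mono fun ω h => h.symm), ?_⟩
  rw [integral_congr_ae hloss, integral_const_mul, integral_add hsum hlog,
    integral_finsetSum _ fun i _ => hIN.integrable i i]
  simp [hIN.secondMoment]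

/-- The limit criterion is strictly minimal at the true parameter. -/
theorem lt_lintegral_loss {θ₀ : Θ} {Z : ℤ → Ω → (Fin k → ℝ)} {V : ℤ → Ω → M.vol}
    (hST : M.ST P θ₀ Z X V) (hIN : IN P Z) (hIV : M.IV P X)
    {y : Fin p → M.State} (hy : ∀ᵐ ω ∂P, M.Tame X E y ω)
    (hV : ∀ᵐ ω ∂P, X 0 ω = (matSqrt (M.link (M.g X y 0 ω θ₀))).mulVec (Z 0 ω)) {c : ℝ}
    (hc : ∀ᵐ ω ∂P, ∀ t θ, c ≤ Real.log (M.link (M.g X y t ω θ)).det) {θ : Θ}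
    (hne : ¬ ∀ᵐ ω ∂P, M.g X y 0 ω θ = M.g X y 0 ω θ₀) :
    ENNReal.ofReal ((∫ ω, M.loss (X 0 ω) (M.g X y 0 ω θ₀) ∂P) - 2⁻¹ * c)
      < ∫⁻ ω, ENNReal.ofReal (M.loss (X 0 ω) (M.g X y 0 ω θ) - 2⁻¹ * c) ∂P := by
  -- If the mean loss at `θ` does not exceed the one at `θ₀`, it is finite. The quadratic form is
  -- nonnegative and `log det` is bounded below, so both are then integrable separately.
  by_contra! hle
  refine hne ?_
  have hX := hST.ergodic
  obtain ⟨hlog₀, hint₀, hv⟩ := integrable_loss_true hST hIN hIV hy hV hc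
  have hcg := causal_g hX hy θ
  have hcg₀ := causal_g hX hy θ₀
  have hgm := hcg.aemeasurable hX 0
  have hlow : ∀ θ, ∀ᵐ ω ∂P, 2⁻¹ * c ≤ M.loss (X 0 ω) (M.g X y 0 ω θ) := fun θ => by
    filter_upwards [hc] with ω h
    exact le_trans (by linarith [h 0 θ]) (log_det_le_loss _ _)
  have : SecondCountableTopology F := UniformSpace.secondCountable_of_separable F
  have hlossm : AEMeasurable (fun ω => M.loss (X 0 ω) (M.g X y 0 ω θ)) P :=
    hIV.continuous_loss.measurable.comp_aemeasurable ((hX.measurable 0).aemeasurable.prodMk hgm)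
  have hsub : Integrable (fun ω => M.loss (X 0 ω) (M.g X y 0 ω θ) - 2⁻¹ * c) P :=
    (lintegral_ofReal_ne_top_iff_integrable (hlossm.sub_const _).aestronglyMeasurable
      ((hlow θ).mono fun ω h => sub_nonneg.2 h)).1 (ne_top_of_le_ne_top ENNReal.ofReal_ne_top hle)
  have hint : Integrable (fun ω => M.loss (X 0 ω) (M.g X y 0 ω θ)) P := by
    exact (hsub.add (integrable_const (2⁻¹ * c))).congr (.of_forall fun ω => by simp)
  have hEle : ∫ ω, M.loss (X 0 ω) (M.g X y 0 ω θ) ∂P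
      ≤ ∫ ω, M.loss (X 0 ω) (M.g X y 0 ω θ₀) ∂P := by
    rw [← ofReal_integral_eq_lintegral_ofReal hsub ((hlow θ).mono fun ω h => sub_nonneg.2 h)] at hle
    have h0 : 0 ≤ (∫ ω, M.loss (X 0 ω) (M.g X y 0 ω θ₀) ∂P) - 2⁻¹ * c := by
      have : ∫ _, 2⁻¹ * c ∂P ≤ ∫ ω, M.loss (X 0 ω) (M.g X y 0 ω θ₀) ∂P :=
        integral_mono_ae (integrable_const _) hint₀ (hlow θ₀)
      simpa using this
    have h1 := (ENNReal.ofReal_le_ofReal_iff h0).1 hle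
    rw [integral_sub hint (integrable_const _)] at h1
    simpa using h1
  -- the quadratic form and the log determinant are integrable
  let Q : Ω → ℝ := fun ω =>
    dotProduct (X 0 ω) ((M.link (M.g X y 0 ω θ))⁻¹.mulVec (X 0 ω))
  let l : Ω → ℝ := fun ω => Real.log (M.link (M.g X y 0 ω θ)).det
  have hlm : AEMeasurable l P := hIV.continuous_logDet.measurable.comp_aemeasurable hgm
  have hQl : ∀ ω, M.loss (X 0 ω) (M.g X y 0 ω θ) = 2⁻¹ * (Q ω + l ω) := fun ω => rfl
  have hQ0 : ∀ ω, 0 ≤ Q ω := fun ω => by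
    have := (posSemidef_link (M.g X y 0 ω θ)).inv.dotProduct_mulVec_nonneg (X 0 ω)
    simpa only [star_trivial] using this
  have hlint : Integrable l P := by
    refine ((hint.abs.const_mul 2).add (integrable_const |c|)).mono' hlm.aestronglyMeasurable ?_
    filter_upwards [hc] with ω h
    have h1 : c ≤ l ω := h 0 θ
    have h2 := hQ0 ω
    have h3 := hQl ω
    have h4 := le_abs_self (M.loss (X 0 ω) (M.g X y 0 ω θ))
    rw [Real.norm_eq_abs, abs_le, Pi.add_apply]
    constructor
    · linarith [neg_abs_le c, abs_nonneg (M.loss (X 0 ω) (M.g X y 0 ω θ))]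
    · linarith [abs_nonneg c]
  have hQint : Integrable Q P := by
    have e : Q = fun ω => 2 * M.loss (X 0 ω) (M.g X y 0 ω θ) - l ω := by
      funext ω
      rw [hQl]
      ring
    rw [e]
    exact (hint.const_mul 2).sub hlint
  -- conditioning on the past
  let U : Ω → M.State × M.State := fun ω => (M.g X y 0 ω θ, M.g X y 0 ω θ₀)
  have hcU : Causal P X fun t ω => (M.g X y t ω θ, M.g X y t ω θ₀) := hcg.prodMk hcg₀
  have hUm : AEMeasurable U P := hcU.aemeasurable hX 0
  have hZm := (hIN.measurable 0).aemeasurable (μ := P)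
  have hmap := (hcU.indepFun hIN hST.nonAnticipative).map_prod_eq_prod_map_map hUm hZm
  have := Measure.isProbabilityMeasure_map (μ := P) hUm
  have := Measure.isProbabilityMeasure_map (μ := P) hZm
  -- As `X_0 = S Z_0`, the quadratic form at `θ` is that of `A` in `Z_0`, where `A` depends on the
  -- past only.
  let A : M.State × M.State → Matrix (Fin k) (Fin k) ℝ := fun u =>
    matSqrt (M.link u.2) * (M.link u.1)⁻¹ * matSqrt (M.link u.2)
  have hS := measurable_matSqrt hIV.measurable_link (fun y => posSemidef_link y)
  have hAm : ∀ i j, Measurable fun u => A u i j := fun i j => by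
    simp only [A, Matrix.mul_apply]
    exact Finset.measurable_fun_sum _ fun a _ => (Finset.measurable_fun_sum _ fun b _ =>
      ((hS _ _).comp measurable_snd).mul
        ((hIV.continuous_inv _ _).measurable.comp measurable_fst)).mul
      ((hS _ _).comp measurable_snd)
  have hqm : Measurable fun w : (M.State × M.State) × (Fin k → ℝ) =>
      dotProduct w.2 ((A w.1).mulVec w.2) := by
    simp only [dotProduct]
    exact Finset.measurable_fun_sum _ fun i _ => ((measurable_pi_apply i).comp measurable_snd).mul
      ((measurable_pi_apply i).comp (measurable_mulVec hAm))
  have hprod : AEMeasurable (fun ω => (U ω, Z 0 ω)) P := hUm.prodMk hZm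
  have hQA : Q =ᵐ[P] fun ω => dotProduct (Z 0 ω) ((A (U ω)).mulVec (Z 0 ω)) := by
    filter_upwards [hV] with ω h
    simp only [Q]
    rw [h, dotProduct_mulVec_conj (posSemidef_matSqrt _)]
  have hzz : ∀ i j, Measurable fun z : Fin k → ℝ => z i * z j := fun i j =>
    (measurable_pi_apply i).mul (measurable_pi_apply j)
  obtain ⟨htr, htr'⟩ := integral_prod_dotProduct_mulVec (ν := P.map U) (π := P.map (Z 0)) (A := A)
    (fun i j => (integrable_map_measure (hzz i j).aestronglyMeasurable hZm).2 (hIN.integrable i j))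
    (fun i j => by
      rw [integral_map hZm (hzz i j).aestronglyMeasurable]
      exact hIN.secondMoment i j)
    (by
      rw [← hmap, integrable_map_measure hqm.aestronglyMeasurable hprod]
      exact hQint.congr hQA)
  rw [← hmap, integral_map hprod hqm.aestronglyMeasurable, ← integral_congr_ae hQA,
    integral_map hUm htr.1] at htr'
  rw [integrable_map_measure htr.1 hUm] at htr
  replace htr : Integrable (fun ω => (A (U ω)).trace) P := htr
  -- the integrated divergence vanishes
  have hpd : ∀ ω, (A (U ω)).PosDef := fun ω =>
    posDef_conj_inv (hIV.posDef_matSqrt_link _) (hIV.posDef_link _)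
  have hld : ∀ ω, Real.log (A (U ω)).det
      = Real.log (M.link (M.g X y 0 ω θ₀)).det - l ω := fun ω => by
    have h := log_det_conj_inv (hIV.posDef_matSqrt_link (M.g X y 0 ω θ₀))
      (hIV.posDef_link (M.g X y 0 ω θ))
    rw [matSqrt_mul_matSqrt (posSemidef_link _)] at h
    exact h
  -- Twice the conditional excess loss given the past: `tr A - k - log det A`, nonnegative and zero
  -- only at `A = 1`.
  let Δ : Ω → ℝ := fun ω =>
    (A (U ω)).trace - k - (Real.log (M.link (M.g X y 0 ω θ₀)).det - l ω)
  have hΔ0 : ∀ ω, 0 ≤ Δ ω := fun ω => by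
    have := log_det_le_trace_sub (hpd ω)
    simp only [Δ]
    rw [← hld]
    linarith
  have hΔ1 : Integrable (fun ω => (A (U ω)).trace - k) P := Integrable.sub htr (integrable_const _)
  have hΔ2 : Integrable (fun ω => Real.log (M.link (M.g X y 0 ω θ₀)).det - l ω) P :=
    hlog₀.sub hlint
  have hΔint : ∫ ω, Δ ω ∂P ≤ 0 := by
    have e1 : ∫ ω, M.loss (X 0 ω) (M.g X y 0 ω θ) ∂P
        = 2⁻¹ * (∫ ω, Q ω ∂P + ∫ ω, l ω ∂P) := by
      simp only [hQl]
      rw [integral_const_mul, integral_add hQint hlint]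
    have e2 : ∫ ω, Δ ω ∂P = ∫ ω, (A (U ω)).trace ∂P - k
        - (∫ ω, Real.log (M.link (M.g X y 0 ω θ₀)).det ∂P - ∫ ω, l ω ∂P) := by
      simp only [Δ]
      rw [integral_sub hΔ1 hΔ2, integral_sub htr (integrable_const _), integral_sub hlog₀ hlint]
      simp
    rw [e1, hv, htr'] at hEle
    rw [e2]
    linarith
  have hΔae := (integral_eq_zero_iff_of_nonneg hΔ0 (hΔ1.sub hΔ2)).1
    (le_antisymm hΔint (integral_nonneg hΔ0))
  filter_upwards [hΔae] with ω h
  have h1 : Δ ω = 0 := h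
  have h2 := eq_one_of_log_det_eq (hpd ω) (by rw [hld]; simp only [Δ] at h1; linarith)
  have h3 := eq_of_conj_inv_eq_one (hIV.posDef_matSqrt_link _) (hIV.posDef_link _) h2
  rw [matSqrt_mul_matSqrt (posSemidef_link _)] at h3
  exact M.link_injective h3

end Model

end

end VolatilitySRE

theorem mainTheorem2
    {k p q : ℕ} [NeZero p]
    {F : Type*} [MetricSpace F] [TopologicalSpace.SeparableSpace F] [MeasurableSpace F]
    [BorelSpace F]
    {Θ : Type*} [MetricSpace Θ] [CompactSpace Θ]
    {Ω : Type*} [MeasurableSpace Ω] (P : MeasureTheory.Measure Ω)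
    [MeasureTheory.IsProbabilityMeasure P]
    (M : VolatilitySRE.Model k p q F Θ) (E : M.LagMetric) (θ₀ : Θ)
    (Z X : ℤ → Ω → (Fin k → ℝ)) (V : ℤ → Ω → M.vol)
    (hST : M.ST P θ₀ Z X V)
    (hCI : M.CI P X E)
    (hIN : VolatilitySRE.IN P Z)
    (hIV : M.IV P X)
    (hId : M.Identifiable P θ₀ X V)
    (ζ : Ω → Θ → (Fin p → M.State)) (hζ : ∀ ω, Continuous (ζ ω))
    (θhat : ℕ → Ω → Θ)
    (hθhat : ∀ᵐ ω ∂P, ∀ n : ℕ, 1 ≤ n → ∀ θ, M.qlik X ζ n ω (θhat n ω) ≤ M.qlik X ζ n ω θ) :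
    ∀ᵐ ω ∂P, Filter.Tendsto (fun n => θhat n ω) Filter.atTop (nhds θ₀) := by
  have hX := hST.ergodic
  have : Nonempty Θ := ⟨θ₀⟩
  obtain ⟨y, hy⟩ := hCI.exists_ae_tame hX
  obtain ⟨c, hc⟩ := hIV.exists_le_logDet hX hy
  -- Identifiability speaks of measurable stationary solutions; one of them agrees almost surely
  -- with the pathwise limit `g`, which transfers it.
  have hid : ∀ θ, (∀ᵐ ω ∂P, M.g X y 0 ω θ = M.toState (V 0 ω)) ↔ θ = θ₀ := fun θ => by
    obtain ⟨Y, hY, hYg⟩ := VolatilitySRE.Model.exists_isStationarySolution hX hy θ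
    rw [← hId θ Y hY]
    refine Filter.eventually_congr ?_
    filter_upwards [hYg] with ω h
    rw [h]
  have hg₀ := (hid θ₀).2 rfl
  have hV : ∀ᵐ ω ∂P, X 0 ω
      = (VolatilitySRE.matSqrt (M.link (M.g X y 0 ω θ₀))).mulVec (Z 0 ω) := by
    filter_upwards [hg₀, hST.observation] with ω h1 h2
    rw [h1, M.link_toState, h2]
  refine VolatilitySRE.Model.ae_tendsto_of_separation hX hy hIV (c := 2⁻¹ * c) hST.logMoment ?_
    (VolatilitySRE.Model.integrable_loss_true hST hIN hIV hy hV hc).2.1 (fun θ hθ => ?_) hζ hθhat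
  · filter_upwards [hc] with ω h t θ
    exact le_trans (by linarith [h t θ]) (VolatilitySRE.Model.log_det_le_loss _ _)
  · refine VolatilitySRE.Model.lt_lintegral_loss hST hIN hIV hy hV hc fun h => hθ ?_
    refine (hid θ).1 ?_
    filter_upwards [h, hg₀] with ω h1 h2
    rw [h1, h2]
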